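/- **Proposition.** Let $a>0$, $\mathbb H=\{\operatorname{Im} z>0\}$, and let $(\mu_t)_{t\ge 0}$ be the hydrodynamic limit of the Dyson model started from two sources: a weakly continuous family of probability measures on $\mathbb R$ with $\mu_0=\frac12(\delta_a+\delta_{-a})$ whose Green's function $M_t(z)=\int_{\mathbb R}\frac{2\,\mu_t(du)}{z-u}$ solves the complex Burgers equation $\partial_t M_t=-2M_t\,\partial_z M_t$ for $t\ge0$, $z\in\mathbb C\setminus\mathbb R$. Let $g_t$ be the multiple SLE in the hydrodynamic limit, i.e. the solution of $\partial_t g_t(z)=M_t(g_t(z))$, $g_0(z)=z\in\mathbb H$, and let $D_t\subset\mathbb H$ be its domain of definition, i.e. the set of $z\in\mathbb H$ for which the solution exists in $\mathbb H$ on all of $[0,t]$. For $t\ge0$ put $$b_\pm(t)=\sqrt{(1+2t)\pm2\sqrt{t(t+2)}}\,\bigl\{(1-t)\pm\sqrt{t(t+2)}\bigr\}$$ ($b_-(t)$ being used for $t<1/4$ only). For $\xi\in[0,1]$ let $\sigma_t^+(\xi)=(1-\xi)b_-(t)+\xi b_+(t)$ if $0\le t<\frac14$ and $\sigma_t^+(\xi)=\xi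 b_+(t)$ if $t\ge\frac14$. With real cube roots and non-negative real square roots, let $$S(\sigma,t)=\sqrt[3]{\sigma^3+3\sqrt3\,\sqrt{-\sigma^4-2(2t^2-10t-1)\sigma^2+(4t-1)^3}-9\sigma(2t+1)},$$ $$v(\sigma,t)=-\frac{(S(\sigma,t)-\sigma)^2-3(4t-1)}{6S(\sigma,t)},\qquad w(\sigma,t)=\sqrt{3v(\sigma,t)^2-2\sigma v(\sigma,t)+4t-1},$$ where, if $S(\sigma,t)=0$, $v(\sigma,t)$ is the limiting value $\frac{\sigma}{3}-\frac16\sqrt[3]{2(\sigma^3-9\sigma(2t+1))}$. Let $$V_t(z)=\sqrt{1+(z^2-1)\,e^{4tz^2/(z^2-1)^2}},$$ with the square root taken in the closed upper half-plane (and non-negative on $[0,\infty)$), and $V_0(\pm1)=1$. Put $$\Gamma_s^+(\xi)=a\,V_{s/a^2}\Bigl(v\bigl(\sigma^+_{s/a^2}(\xi),\tfrac{s}{a^2}\bigr)+i\,w\bigl(\sigma^+_{s/a^2}(\xi),\tfrac{s}{a^2}\bigr)\Bigr),$$ $$K_t^+=\{\Gamma_s^+(\xi):\ \xi\in[0,1],\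 0\le s\le t\},\qquad K_t^-=-\overline{K_t^+}=\{-\overline z: z\in K_t^+\}.$$ Then for every $t\ge0$ the following hold. 1. With the critical time $t_c=a^2/4$, $$\operatorname{supp}\mu_t=\begin{cases}\{x\in\mathbb R: a\,b_-(t/a^2)\le|x|\le a\,b_+(t/a^2)\},&0\le t<t_c,\\ \{x\in\mathbb R: |x|\le a\,b_+(t/a^2)\},&t\ge t_c.\end{cases}$$ 2. $\displaystyle\bigcup_{0\le s\le t}g_s^{-1}(\operatorname{supp}\mu_s)=K_t^+\cup K_t^-$, where $g_s^{-1}(\operatorname{supp}\mu_s)$ is the set of $z\in\mathbb C$ for which there are $z_n\in D_s$ with $z_n\to z$ and $g_s(z_n)\to u$ for some $u\in\operatorname{supp}\mu_s$. 3. If $t>0$, the SLE hull $K_t=\overline{\mathbb H\setminus D_t}$ satisfies $K_t=K_t^+\cup K_t^-$. -/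

import Mathlib

open MeasureTheory Filter Topology

noncomputable section

namespace MultipleSLE

/-! ### The deterministic Loewner evolution driven by a flow of probability measures -/

/-- The open upper half-plane, as a subset of `ℂ`. -/
def upperHalf : Set ℂ := {z | 0 < z.im}

/-- The Green's function (resolvent) `M_t(z) = ∫ 2 μ_t(du) / (z - u)`. -/
def green (μ : ℝ → ProbabilityMeasure ℝ) (t : ℝ) (z : ℂ) : ℂ :=
  ∫ u : ℝ, 2 / (z - (u : ℂ)) ∂(μ t : Measure ℝ)

/-- `μ` (restricted to times `t ≥ 0`) is the hydrodynamic limit of the Dyson model started from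
`μ₀`: a weakly continuous flow of probability measures with initial value `μ₀` whose Green's
function solves the complex Burgers equation `∂M/∂t = -2 M ∂M/∂z` on `ℂ \ ℝ`
(one-sided time derivative at `t = 0`). -/
structure IsHydrodynamicLimit (μ₀ : Measure ℝ) (μ : ℝ → ProbabilityMeasure ℝ) : Prop where
  initial : (μ 0 : Measure ℝ) = μ₀
  continuousOn : ContinuousOn μ (Set.Ici 0)
  burgers : ∀ t : ℝ, 0 ≤ t → ∀ z : ℂ, z.im ≠ 0 →
    HasDerivWithinAt (fun s : ℝ => green μ s z)
      (-2 * green μ t z * deriv (green μ t) z) (Set.Ici 0) t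

/-- `γ` is a trajectory on `[0, t]` in the upper half-plane of the Loewner equation
`∂g/∂s = M_s(g)` started from `z`. -/
def IsLoewnerPath (μ : ℝ → ProbabilityMeasure ℝ) (t : ℝ) (z : ℂ) (γ : ℝ → ℂ) : Prop :=
  γ 0 = z ∧ ∀ s ∈ Set.Icc 0 t, γ s ∈ upperHalf ∧
    HasDerivWithinAt γ (green μ s (γ s)) (Set.Icc 0 t) s

/-- `D_t`, the domain of definition of `g_t`: the points of the upper half-plane from which the
Loewner equation has a solution up to and including time `t`. -/
def loewnerDomain (μ : ℝ → ProbabilityMeasure ℝ) (t : ℝ) : Set ℂ :=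
  {z | z ∈ upperHalf ∧ ∃ γ : ℝ → ℂ, IsLoewnerPath μ t z γ}

open Classical in
/-- The Loewner map `g_t` on `D_t` (the solution of the Loewner equation is unique on `[0, t]`);
its value outside `D_t` is irrelevant. -/
def loewnerMap (μ : ℝ → ProbabilityMeasure ℝ) (t : ℝ) (z : ℂ) : ℂ :=
  if h : ∃ γ : ℝ → ℂ, IsLoewnerPath μ t z γ then h.choose t else 0

/-- The hull `K_t`, the closure of `ℍ \ D_t`. -/
def hull (μ : ℝ → ProbabilityMeasure ℝ) (t : ℝ) : Set ℂ :=
  closure (upperHalf \ loewnerDomain μ t)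

/-- The curve `g_t⁻¹(supp μ_t)`, where `g_t : D_t → ℍ` is extended to the boundary: the points `z`
of the closed half-plane such that `g_t`, along `D_t ∋ w → z`, accumulates at some point `u` of the
closed support of `μ_t`. -/
def hullCurve (μ : ℝ → ProbabilityMeasure ℝ) (t : ℝ) : Set ℂ :=
  {z | ∃ u ∈ (μ t : Measure ℝ).support,
    MapClusterPt (u : ℂ) (𝓝[loewnerDomain μ t] z) (loewnerMap μ t)}

/-! ### The explicit formulas for two sources -/

/-- The initial measure `(δ_a + δ_{-a}) / 2`. -/
def twoSources (a : ℝ) : Measure ℝ :=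
  (2 : ENNReal)⁻¹ • (Measure.dirac a + Measure.dirac (-a))

/-- `b_+(t)`. -/
def bPlus (t : ℝ) : ℝ :=
  √((1 + 2 * t) + 2 * √(t * (t + 2))) * ((1 - t) + √(t * (t + 2)))

/-- `b_-(t)`, used for `0 ≤ t < 1/4` only. -/
def bMinus (t : ℝ) : ℝ :=
  √((1 + 2 * t) - 2 * √(t * (t + 2))) * ((1 - t) - √(t * (t + 2)))

/-- The critical time `t_c = a² / 4`. -/
def criticalTime (a : ℝ) : ℝ := a ^ 2 / 4

/-- The set claimed to be the support of `μ_t`: two intervals before the critical time, one interval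
from then on. -/
def twoSourceSupport (a t : ℝ) : Set ℝ :=
  if t < criticalTime a then
    {x | a * bMinus (t / a ^ 2) ≤ |x| ∧ |x| ≤ a * bPlus (t / a ^ 2)}
  else {x | |x| ≤ a * bPlus (t / a ^ 2)}

/-- The parametrization `σ_t⁺(ξ)`, `ξ ∈ [0, 1]`, of the non-negative part of the support
(for `a = 1`). -/
def sigmaPlus (t ξ : ℝ) : ℝ :=
  if t < 1 / 4 then (1 - ξ) * bMinus t + ξ * bPlus t else ξ * bPlus t

/-- The real cube root of a real number. -/
def realCbrt (x : ℝ) : ℝ := if 0 ≤ x then x ^ (1 / 3 : ℝ) else -((-x) ^ (1 / 3 : ℝ))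

/-- The Cardano cube root `S(σ, t)` of the cubic `h³ - σ h² + (4t - 1) h + σ = 0`. -/
def cardanoS (σ t : ℝ) : ℝ :=
  realCbrt (σ ^ 3
    + 3 * √3 * √(-σ ^ 4 - 2 * (2 * t ^ 2 - 10 * t - 1) * σ ^ 2 + (4 * t - 1) ^ 3)
    - 9 * σ * (2 * t + 1))

/-- `v(σ, t)`. Where `S(σ, t) = 0` the quotient is `0 / 0` on the support, with a removable
singularity; its value there is the limit. -/
def vPart (σ t : ℝ) : ℝ :=
  if cardanoS σ t = 0 then σ / 3 - realCbrt (2 * (σ ^ 3 - 9 * σ * (2 * t + 1))) / 6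
  else -((cardanoS σ t - σ) ^ 2 - 3 * (4 * t - 1)) / (6 * cardanoS σ t)

/-- `w(σ, t)`. -/
def wPart (σ t : ℝ) : ℝ :=
  √(3 * vPart σ t ^ 2 - 2 * σ * vPart σ t + 4 * t - 1)

/-- The square root with values in the closed upper half-plane (and the non-negative one on
non-negative reals). -/
def upperSqrt (ζ : ℂ) : ℂ :=
  if (ζ ^ (1 / 2 : ℂ)).im < 0 then -(ζ ^ (1 / 2 : ℂ)) else ζ ^ (1 / 2 : ℂ)

/-- `V_t(z) = √(1 + (z² - 1) exp(4 t z² / (z² - 1)²))`, with the branch for which `V_0(z) = z` on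
the upper half-plane. (At `t = 0`, `z = 1` the division by zero is harmless: `V_0(1) = 1`.) -/
def vMap (t : ℝ) (z : ℂ) : ℂ :=
  upperSqrt (1 + (z ^ 2 - 1) * Complex.exp (4 * (t : ℂ) * z ^ 2 / (z ^ 2 - 1) ^ 2))

/-- `Γ_s⁺(ξ) = a V_{s/a²}(v + i w)`, with `v`, `w` evaluated at `(σ⁺_{s/a²}(ξ), s/a²)`. -/
def gammaPlus (a s ξ : ℝ) : ℂ :=
  (a : ℂ) * vMap (s / a ^ 2)
    ((vPart (sigmaPlus (s / a ^ 2) ξ) (s / a ^ 2) : ℂ)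
      + Complex.I * (wPart (sigmaPlus (s / a ^ 2) ξ) (s / a ^ 2) : ℂ))

/-- `K_t⁺`. -/
def hullPlus (a t : ℝ) : Set ℂ :=
  {z | ∃ s ∈ Set.Icc 0 t, ∃ ξ ∈ Set.Icc (0 : ℝ) 1, z = gammaPlus a s ξ}

/-- `K_t⁻`, the mirror image of `K_t⁺` in the imaginary axis. -/
def hullMinus (a t : ℝ) : Set ℂ :=
  (fun z : ℂ => -(starRingEnd ℂ) z) '' hullPlus a t

end MultipleSLE

end

/-! The Burgers equation is solved by characteristics. With $M_0(h)=2h/(h^2-a^2)$, the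
characteristic from $h$ sits at $h+2tM_0(h)$ (`charMap`) and $M_t$ is constant along it. Hence
`charMap a t` is a bijection of `charDomain a t` onto $\mathbb H$. On the upper part of the
boundary, `charCurve a t`, given by $4t(|h|^2+a^2)=|h^2-a^2|^2$, the characteristic reaches the real
line.

The Loewner flow is integrable in the coordinate $h=g_t-2tM_t(g_t)$: the quantity
$(h^2-a^2)\exp(tM_0(h)^2)$ (`firstIntegral`) is conserved and equals $z^2-a^2$ at time 0
(`IsLoewnerPath.firstIntegral_eq`). So $g_t^{-1}$ is `charMap a t h` $\mapsto z$ with $z^2=a^2+$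
`firstIntegral a t h`. What remains is the behaviour at the boundary.

Support (`IsHydrodynamicLimit.mem_support_iff`): $\operatorname{supp}\mu_t$ is the image of
`charCurve a t`. Off that image $-\operatorname{Im}M_t=O(\operatorname{Im}z)$, so there is no mass;
on it, a gap in the support would give `charMap` a Lipschitz local inverse at a critical point.

Curves and hull: a phase estimate (`im_mul_exp_hitExponent`) shows that $h$ and $z$ lie on the same
side of the imaginary axis, which fixes the branch of the square root up to the boundary. The
lifetime of $z$ ends when $h$ reaches the curve, and a point $z$ attached to the curve is not in the
domain, by the open mapping theorem. Both unions are therefore the symmetrized image of `hitRegion a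
t` under `hitPoint` (`iUnion_hullCurve`, `hull_eq`).

Explicit form: for $a=1$ the curve point over $\sigma$ is a root of $h^3-\sigma h^2+(4t-1)h+\sigma$,
and Cardano's formula gives $v+iw$. Its radicand is non-negative exactly for $\sigma$ in the
asserted support; scaling handles general $a$. -/

noncomputable section

namespace MultipleSLE

/-! ### Green's function of a probability measure -/

section Green

variable {μ : ℝ → ProbabilityMeasure ℝ} {t : ℝ} {z w : ℂ} {δ ε : ℝ}

theorem abs_im_le_norm_sub (z : ℂ) (u : ℝ) : |z.im| ≤ ‖z - u‖ := by
  simpa using Complex.abs_im_le_norm (z - u)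

theorem sub_ofReal_ne_zero (hz : z.im ≠ 0) (u : ℝ) : z - u ≠ 0 := by
  intro h
  apply hz
  simpa using congrArg Complex.im h

theorem norm_two_div_le (hδ : 0 < δ) {x : ℂ} (hx : δ ≤ ‖x‖) : ‖2 / x‖ ≤ 2 / δ := by
  rw [norm_div, Complex.norm_two]
  gcongr

/-- Asking for the distance bound only almost everywhere also covers real points inside a gap of the
support. -/
theorem integrable_green_of_ae {ν : Measure ℝ} [IsFiniteMeasure ν] (hδ : 0 < δ)
    (hz : ∀ᵐ u : ℝ ∂ν, δ ≤ ‖z - u‖) : Integrable (fun u : ℝ => 2 / (z - (u : ℂ))) ν := by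
  refine Integrable.of_bound (C := 2 / δ)
    (Measurable.aestronglyMeasurable (by fun_prop)) ?_
  filter_upwards [hz] with u hu using norm_two_div_le hδ hu

theorem integrable_green (ν : Measure ℝ) [IsFiniteMeasure ν] (hz : z.im ≠ 0) :
    Integrable (fun u : ℝ => 2 / (z - (u : ℂ))) ν :=
  integrable_green_of_ae (abs_pos.2 hz) (ae_of_all _ (abs_im_le_norm_sub z))

theorem norm_two_div_mul_le (hδ : 0 < δ) (hε : 0 < ε) {x y : ℂ} (hx : δ ≤ ‖x‖) (hy : ε ≤ ‖y‖) :
    ‖2 / (x * y)‖ ≤ 2 / (δ * ε) := by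
  apply norm_two_div_le (by positivity)
  rw [norm_mul]
  gcongr

/-- The divided difference of `-M_t` at `z` and `w`. -/
def greenSlope (μ : ℝ → ProbabilityMeasure ℝ) (t : ℝ) (z w : ℂ) : ℂ :=
  ∫ u : ℝ, 2 / ((z - (u : ℂ)) * (w - (u : ℂ))) ∂(μ t : Measure ℝ)

theorem norm_greenSlope_le (hδ : 0 < δ) (hε : 0 < ε)
    (hz : ∀ᵐ u : ℝ ∂(μ t : Measure ℝ), δ ≤ ‖z - u‖)
    (hw : ∀ᵐ u : ℝ ∂(μ t : Measure ℝ), ε ≤ ‖w - u‖) :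
    ‖greenSlope μ t z w‖ ≤ 2 / (δ * ε) := by
  refine (norm_integral_le_of_norm_le_const (C := 2 / (δ * ε)) ?_).trans (by simp)
  filter_upwards [hz, hw] with u hu hu' using norm_two_div_mul_le hδ hε hu hu'

theorem green_sub_green_of_ae (hδ : 0 < δ) (hε : 0 < ε)
    (hz : ∀ᵐ u : ℝ ∂(μ t : Measure ℝ), δ ≤ ‖z - u‖)
    (hw : ∀ᵐ u : ℝ ∂(μ t : Measure ℝ), ε ≤ ‖w - u‖) :
    green μ t z - green μ t w = -((z - w) * greenSlope μ t z w) := by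
  rw [green, green, greenSlope, ← integral_sub (integrable_green_of_ae hδ hz)
    (integrable_green_of_ae hε hw), ← integral_const_mul, ← integral_neg]
  apply integral_congr_ae
  filter_upwards [hz, hw] with u hu hu'
  have h1 : z - (u : ℂ) ≠ 0 := norm_pos_iff.1 (hδ.trans_le hu)
  have h2 : w - (u : ℂ) ≠ 0 := norm_pos_iff.1 (hε.trans_le hu')
  field_simp
  ring

theorem green_sub_green (hz : z.im ≠ 0) (hw : w.im ≠ 0) :
    green μ t z - green μ t w = -((z - w) * greenSlope μ t z w) :=
  green_sub_green_of_ae (abs_pos.2 hz) (abs_pos.2 hw)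
    (ae_of_all _ (abs_im_le_norm_sub z)) (ae_of_all _ (abs_im_le_norm_sub w))

theorem norm_greenSlope_le_im (hz : z.im ≠ 0) (hw : w.im ≠ 0) :
    ‖greenSlope μ t z w‖ ≤ 2 / (|z.im| * |w.im|) :=
  norm_greenSlope_le (abs_pos.2 hz) (abs_pos.2 hw)
    (ae_of_all _ (abs_im_le_norm_sub z)) (ae_of_all _ (abs_im_le_norm_sub w))

theorem norm_green_le (hz : z.im ≠ 0) : ‖green μ t z‖ ≤ 2 / |z.im| := by
  refine (norm_integral_le_of_norm_le_const (C := 2 / |z.im|) ?_).trans (by simp)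
  exact ae_of_all _ fun u => norm_two_div_le (abs_pos.2 hz) (abs_im_le_norm_sub z u)

theorem norm_green_sub_le (hz : z.im ≠ 0) (hw : w.im ≠ 0) :
    ‖green μ t z - green μ t w‖ ≤ 2 / (|z.im| * |w.im|) * ‖z - w‖ := by
  rw [green_sub_green hz hw, norm_neg, norm_mul, mul_comm]
  gcongr
  exact norm_greenSlope_le_im hz hw

theorem greenSlope_sub_le (hz : z.im ≠ 0) (hw : w.im ≠ 0) :
    ‖greenSlope μ t z w - greenSlope μ t w w‖ ≤ 2 / (|z.im| * |w.im| * |w.im|) * ‖z - w‖ := by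
  have hz' := abs_pos.2 hz
  have hw' := abs_pos.2 hw
  have hint : ∀ {x y : ℂ}, x.im ≠ 0 → y.im ≠ 0 →
      Integrable (fun u : ℝ => 2 / ((x - (u : ℂ)) * (y - (u : ℂ)))) (μ t : Measure ℝ) := by
    intro x y hx hy
    refine Integrable.of_bound (C := 2 / (|x.im| * |y.im|))
      (Measurable.aestronglyMeasurable (by fun_prop)) ?_
    exact ae_of_all _ fun u => norm_two_div_mul_le (abs_pos.2 hx) (abs_pos.2 hy)
      (abs_im_le_norm_sub x u) (abs_im_le_norm_sub y u)
  rw [greenSlope, greenSlope, ← integral_sub (hint hz hw) (hint hw hw)]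
  refine (norm_integral_le_of_norm_le_const
    (C := 2 / (|z.im| * |w.im| * |w.im|) * ‖z - w‖) ?_).trans (by simp)
  refine ae_of_all _ fun u => ?_
  have h1 := sub_ofReal_ne_zero hz u
  have h2 := sub_ofReal_ne_zero hw u
  have : 2 / ((z - (u : ℂ)) * (w - u)) - 2 / ((w - (u : ℂ)) * (w - u))
      = -(2 / (((z - u) * (w - u)) * (w - u)) * (z - w)) := by
    field_simp
    ring
  rw [this, norm_neg, norm_mul]
  gcongr
  refine norm_two_div_mul_le (by positivity) hw' ?_ (abs_im_le_norm_sub w u)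
  rw [norm_mul]
  gcongr <;> apply abs_im_le_norm_sub

theorem hasDerivAt_green (hz : z.im ≠ 0) : HasDerivAt (green μ t) (-greenSlope μ t z z) z := by
  rw [hasDerivAt_iff_tendsto_slope]
  have hne : ∀ᶠ w in 𝓝[≠] z, w.im ≠ 0 :=
    nhdsWithin_le_nhds ((Complex.continuous_im.continuousAt).eventually_ne hz)
  have hlim : Tendsto (fun w => greenSlope μ t w z) (𝓝[≠] z) (𝓝 (greenSlope μ t z z)) := by
    rw [tendsto_iff_norm_sub_tendsto_zero]
    have hb : Tendsto (fun w : ℂ => 2 / (|w.im| * |z.im| * |z.im|) * ‖w - z‖) (𝓝[≠] z) (𝓝 0) := by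
      apply tendsto_nhdsWithin_of_tendsto_nhds
      have : ContinuousAt (fun w : ℂ => 2 / (|w.im| * |z.im| * |z.im|) * ‖w - z‖) z := by
        have : |z.im| * |z.im| * |z.im| ≠ 0 := by simp [hz]
        fun_prop (disch := assumption)
      simpa [ContinuousAt] using this
    refine squeeze_zero' (Eventually.of_forall fun _ => norm_nonneg _) ?_ hb
    filter_upwards [hne] with w hw using greenSlope_sub_le hw hz
  refine hlim.neg.congr' ?_
  filter_upwards [hne, self_mem_nhdsWithin] with w hw hwz
  rw [slope_def_field, green_sub_green hw hz]
  have : w - z ≠ 0 := sub_ne_zero.2 hwz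
  field_simp

theorem deriv_green (hz : z.im ≠ 0) : deriv (green μ t) z = -greenSlope μ t z z :=
  (hasDerivAt_green hz).deriv

theorem norm_deriv_green_le (hz : z.im ≠ 0) : ‖deriv (green μ t) z‖ ≤ 2 / (|z.im| * |z.im|) := by
  rw [deriv_green hz, norm_neg]
  exact norm_greenSlope_le_im hz hz

theorem im_two_div (z : ℂ) (u : ℝ) :
    (2 / (z - (u : ℂ))).im = -(2 * z.im / ‖z - u‖ ^ 2) := by
  rw [Complex.div_im, Complex.sq_norm]
  simp

theorem neg_im_green (hz : z.im ≠ 0) :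
    -(green μ t z).im = ∫ u : ℝ, 2 * z.im / ‖z - u‖ ^ 2 ∂(μ t : Measure ℝ) := by
  have h := integral_im (𝕜 := ℂ) (integrable_green (μ t : Measure ℝ) hz)
  rw [green, ← RCLike.im_to_complex, ← h, ← integral_neg]
  congr 1
  ext u
  rw [RCLike.im_to_complex, im_two_div, neg_neg]

theorem integrable_poisson (ν : Measure ℝ) [IsFiniteMeasure ν] (hz : z.im ≠ 0) :
    Integrable (fun u : ℝ => 2 * z.im / ‖z - u‖ ^ 2) ν := by
  refine ((integrable_green ν hz).im.neg).congr (ae_of_all _ fun u => ?_)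
  simp only [Pi.neg_apply, RCLike.im_to_complex, im_two_div, neg_neg]

theorem im_green_nonpos (hz : 0 < z.im) : (green μ t z).im ≤ 0 := by
  have h := neg_im_green (μ := μ) (t := t) hz.ne'
  have : 0 ≤ -(green μ t z).im := by
    rw [h]
    exact integral_nonneg fun u => by positivity
  linarith

end Green

/-! ### Differentiating the Green's function along curves -/

section HydrodynamicLimit

variable {μ₀ : Measure ℝ} {μ : ℝ → ProbabilityMeasure ℝ}

/-- The kernel is bounded and continuous in `u`, so weak continuity of the flow applies. This is the
only use of that hypothesis; it replaces joint differentiability of $M$ in the chain rule. -/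
theorem IsHydrodynamicLimit.continuousOn_greenSlope (hμ : IsHydrodynamicLimit μ₀ μ) {z : ℂ}
    (hz : z.im ≠ 0) : ContinuousOn (fun s => greenSlope μ s z z) (Set.Ici 0) := by
  intro s hs
  let f : BoundedContinuousFunction ℝ ℂ := BoundedContinuousFunction.ofNormedAddCommGroup
    (fun u : ℝ => 2 / ((z - (u : ℂ)) * (z - (u : ℂ))))
    (by
      have := sub_ofReal_ne_zero hz
      refine continuous_const.div (by fun_prop) fun u => mul_ne_zero (this u) (this u))
    (2 / (|z.im| * |z.im|))
    (fun u => norm_two_div_mul_le (abs_pos.2 hz) (abs_pos.2 hz) (abs_im_le_norm_sub z u)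
      (abs_im_le_norm_sub z u))
  exact (ProbabilityMeasure.tendsto_iff_forall_integral_rclike_tendsto ℂ).1
    (hμ.continuousOn s hs) f

/-- Chain rule for `s ↦ M_s(γ_s)`. -/
theorem IsHydrodynamicLimit.hasDerivWithinAt_green_comp (hμ : IsHydrodynamicLimit μ₀ μ)
    {S : Set ℝ} (hS : S ⊆ Set.Ici 0) {s : ℝ} (hs : s ∈ S) {γ : ℝ → ℂ} {v : ℂ}
    (hγ : HasDerivWithinAt γ v S s) (him : (γ s).im ≠ 0) :
    HasDerivWithinAt (fun r => green μ r (γ r))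
      ((v - 2 * green μ s (γ s)) * deriv (green μ s) (γ s)) S s := by
  have hγc : Tendsto γ (𝓝[S] s) (𝓝 (γ s)) := hγ.continuousWithinAt
  have hne : ∀ᶠ r in 𝓝[S] s, (γ r).im ≠ 0 :=
    hγc.eventually ((Complex.continuous_im.continuousAt).eventually_ne him)
  -- The measure and the point vary together: weak continuity handles the measure at the fixed point
  -- `γ s`, and a Lipschitz bound uniform in the measure handles the point.
  have hslope : Tendsto (fun r => greenSlope μ r (γ r) (γ s)) (𝓝[S] s)
      (𝓝 (greenSlope μ s (γ s) (γ s))) := by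
    have h1 : Tendsto (fun r => greenSlope μ r (γ s) (γ s)) (𝓝[S] s)
        (𝓝 (greenSlope μ s (γ s) (γ s))) :=
      (hμ.continuousOn_greenSlope him s (hS hs)).mono_left (nhdsWithin_mono _ hS)
    have h2 : Tendsto (fun r => greenSlope μ r (γ r) (γ s) - greenSlope μ r (γ s) (γ s))
        (𝓝[S] s) (𝓝 0) := by
      rw [tendsto_zero_iff_norm_tendsto_zero]
      have hb : Tendsto (fun w : ℂ => 2 / (|w.im| * |(γ s).im| * |(γ s).im|) * ‖w - γ s‖)
          (𝓝 (γ s)) (𝓝 0) := by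
        have : ContinuousAt
            (fun w : ℂ => 2 / (|w.im| * |(γ s).im| * |(γ s).im|) * ‖w - γ s‖) (γ s) := by
          have : |(γ s).im| * |(γ s).im| * |(γ s).im| ≠ 0 := by simp [him]
          fun_prop (disch := assumption)
        simpa [ContinuousAt] using this
      refine squeeze_zero' (Eventually.of_forall fun _ => norm_nonneg _) ?_ (hb.comp hγc)
      filter_upwards [hne] with r hr using greenSlope_sub_le hr him
    simpa using h2.add h1
  have hB := (hμ.burgers s (hS hs) (γ s) him).mono hS
  have hA : HasDerivWithinAt (fun r => green μ r (γ r) - green μ r (γ s))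
      (v * deriv (green μ s) (γ s)) S s := by
    rw [hasDerivWithinAt_iff_tendsto_slope] at hγ ⊢
    have hslope' := hslope.mono_left (nhdsWithin_mono s (Set.sdiff_subset (s := S) (t := {s})))
    have := (hγ.mul hslope').neg
    rw [deriv_green him, mul_neg]
    refine this.congr' ?_
    filter_upwards [hne.filter_mono (nhdsWithin_mono s (Set.sdiff_subset (s := S) (t := {s})))]
      with r hr
    simp only [slope_def_module, sub_self, sub_zero, green_sub_green hr him, Complex.real_smul]
    ring
  have := hA.add hB
  refine (this.congr_of_mem (fun r _ => ?_) hs).congr_deriv ?_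
  · simp
  · ring

end HydrodynamicLimit

/-! ### Characteristics of the Burgers equation with two sources -/

section Characteristics

/-- The Green's function of two sources at `±a`. -/
def initialGreen (a : ℝ) (h : ℂ) : ℂ := 2 * h / (h ^ 2 - (a : ℂ) ^ 2)

/-- The position at time `t` of the characteristic of the Burgers equation starting from `h`. -/
def charMap (a t : ℝ) (h : ℂ) : ℂ := h + 2 * t * initialGreen a h

/-- The first integral of the Loewner flow in the characteristic coordinate. -/
def firstIntegral (a t : ℝ) (h : ℂ) : ℂ :=
  (h ^ 2 - (a : ℂ) ^ 2) * Complex.exp (t * initialGreen a h ^ 2)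

/-- The points whose characteristic stays in the upper half-plane up to time `t`. -/
def charDomain (a t : ℝ) : Set ℂ :=
  {h | 0 < h.im ∧ 4 * t * (Complex.normSq h + a ^ 2) < Complex.normSq (h ^ 2 - (a : ℂ) ^ 2)}

/-- The points whose characteristic hits the real line at time `t`. -/
def charCurve (a t : ℝ) : Set ℂ :=
  {h | 0 ≤ h.im ∧ 4 * t * (Complex.normSq h + a ^ 2) = Complex.normSq (h ^ 2 - (a : ℂ) ^ 2)}

variable {a t : ℝ} {h z : ℂ}

theorem sq_sub_sq_ne_zero_of_im (hh : h.im ≠ 0) : h ^ 2 - (a : ℂ) ^ 2 ≠ 0 := by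
  intro h0
  rw [sq_sub_sq, mul_eq_zero] at h0
  rcases h0 with h0 | h0 <;> simpa [hh] using congrArg Complex.im h0

theorem sq_sub_sq_ne_zero (ha : a ≠ 0) (ht : 0 < t)
    (hh : 4 * t * (Complex.normSq h + a ^ 2) ≤ Complex.normSq (h ^ 2 - (a : ℂ) ^ 2)) :
    h ^ 2 - (a : ℂ) ^ 2 ≠ 0 := by
  apply Complex.normSq_pos.1
  have := Complex.normSq_nonneg h
  have : 0 < a ^ 2 := by positivity
  exact lt_of_lt_of_le (by positivity) hh

theorem im_mul_conj_sq_sub_sq (a : ℝ) (h : ℂ) :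
    (h * (starRingEnd ℂ) (h ^ 2 - (a : ℂ) ^ 2)).im = -((Complex.normSq h + a ^ 2) * h.im) := by
  simp [Complex.normSq_apply, pow_two]
  ring

theorem im_initialGreen (a : ℝ) (h : ℂ) : (initialGreen a h).im
    = -(2 * (Complex.normSq h + a ^ 2) * h.im / Complex.normSq (h ^ 2 - (a : ℂ) ^ 2)) := by
  rw [initialGreen, div_eq_mul_inv, Complex.inv_def, ← mul_assoc, Complex.im_mul_ofReal, mul_assoc,
    show (2 : ℂ) = ((2 : ℝ) : ℂ) by norm_num, Complex.im_ofReal_mul, im_mul_conj_sq_sub_sq]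
  field_simp

/-- With `h.im` factored out, the sign of the image's height becomes the inequality in `charDomain`,
and its vanishing the equation of `charCurve`. -/
theorem im_charMap (a t : ℝ) (h : ℂ) : (charMap a t h).im
    = h.im * (1 - 4 * t * (Complex.normSq h + a ^ 2) / Complex.normSq (h ^ 2 - (a : ℂ) ^ 2)) := by
  have : (2 * (t : ℂ) * initialGreen a h).im = 2 * t * (initialGreen a h).im := by
    rw [show (2 : ℂ) * t = ((2 * t : ℝ) : ℂ) by push_cast; ring, Complex.im_ofReal_mul]
  rw [charMap, Complex.add_im, this, im_initialGreen]
  ring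

theorem charMap_mul (hq : h ^ 2 - (a : ℂ) ^ 2 ≠ 0) :
    charMap a t h * (h ^ 2 - (a : ℂ) ^ 2) = h * (h ^ 2 - (a : ℂ) ^ 2) + 4 * t * h := by
  rw [charMap, initialGreen]
  field_simp
  ring

theorem mem_charDomain_iff (hh : 0 < h.im) : h ∈ charDomain a t ↔ 0 < (charMap a t h).im := by
  have hq := Complex.normSq_pos.2 (sq_sub_sq_ne_zero_of_im (a := a) hh.ne')
  rw [im_charMap, mul_pos_iff_of_pos_left hh, sub_pos, div_lt_one hq]
  exact ⟨fun h' => h'.2, fun h' => ⟨hh, h'⟩⟩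

/-- Here $t|M_0(h)|^2=4t|h|^2/|h^2-a^2|^2$. The bound controls both the displacement `charMap a t h
- h` (by $2\sqrt t$) and the exponent of `firstIntegral`, which keeps preimages bounded. -/
theorem mul_norm_initialGreen_sq_le (ht : 0 ≤ t)
    (hh : 4 * t * (Complex.normSq h + a ^ 2) ≤ Complex.normSq (h ^ 2 - (a : ℂ) ^ 2)) :
    t * ‖initialGreen a h‖ ^ 2 ≤ 1 := by
  rw [Complex.sq_norm, initialGreen, map_div₀, map_mul, Complex.normSq_ofNat, mul_div_assoc']
  apply div_le_one_of_le₀ _ (Complex.normSq_nonneg _)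
  have : 0 ≤ 4 * t * a ^ 2 := by positivity
  linarith

/-- Every point of the upper half-plane lies on a characteristic starting in it: by Vieta, one of
the roots of the defining cubic has positive imaginary part. -/
theorem exists_charMap_eq (hz : 0 < z.im) : ∃ h ∈ charDomain a t, charMap a t h = z := by
  suffices ∃ h : ℂ, 0 < h.im ∧
      h ^ 3 - z * h ^ 2 + (4 * t - (a : ℂ) ^ 2) * h + (a : ℂ) ^ 2 * z = 0 by
    obtain ⟨h, hh, hc⟩ := this
    have hq := sq_sub_sq_ne_zero_of_im (a := a) hh.ne'
    have hH : charMap a t h = z := by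
      apply mul_right_cancel₀ hq
      rw [charMap_mul hq]
      linear_combination hc
    exact ⟨h, (mem_charDomain_iff hh).2 (hH ▸ hz), hH⟩
  have hsq : ∀ b c : ℂ, ∃ x : ℂ, x ^ 2 + b * x + c = 0 := by
    intro b c
    obtain ⟨y, hy⟩ := IsAlgClosed.exists_pow_nat_eq (b ^ 2 / 4 - c) (n := 2) (by norm_num)
    exact ⟨y - b / 2, by linear_combination hy⟩
  obtain ⟨r, hr⟩ : ∃ r : ℂ,
      r ^ 3 - z * r ^ 2 + (4 * t - (a : ℂ) ^ 2) * r + (a : ℂ) ^ 2 * z = 0 := by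
    let p : Polynomial ℂ := Polynomial.X ^ 3 - Polynomial.C z * Polynomial.X ^ 2
      + Polynomial.C (4 * t - (a : ℂ) ^ 2) * Polynomial.X + Polynomial.C ((a : ℂ) ^ 2 * z)
    have hp : p.degree = 3 := by
      simp only [p]
      compute_degree!
    obtain ⟨r, hr⟩ := IsAlgClosed.exists_root p (by rw [hp]; norm_num)
    exact ⟨r, by simpa [p] using hr⟩
  by_cases hr0 : 0 < r.im
  · exact ⟨r, hr0, hr⟩
  -- `x` is a root of the cubic divided by $X-r$. The three roots sum to `z`, so the last one is `z
  -- - r - x`.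
  obtain ⟨x, hx⟩ := hsq (r - z) (r ^ 2 - z * r + (4 * t - (a : ℂ) ^ 2))
  by_cases hx0 : 0 < x.im
  · exact ⟨x, hx0, by linear_combination (x - r) * hx + hr⟩
  refine ⟨z - r - x, ?_, by linear_combination (z - r - x - r) * hx + hr⟩
  simp only [Complex.sub_im]
  linarith

theorem green_twoSources {ν : ProbabilityMeasure ℝ} (hν : (ν : Measure ℝ) = twoSources a)
    (hz : z.im ≠ 0) : ∫ u : ℝ, 2 / (z - (u : ℂ)) ∂(ν : Measure ℝ) = initialGreen a z := by
  have h1 := sub_ofReal_ne_zero hz a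
  have h2 := sub_ofReal_ne_zero hz (-a)
  rw [hν, twoSources, integral_smul_measure, integral_add_measure (integrable_green _ hz)
    (integrable_green _ hz), integral_dirac, integral_dirac, initialGreen, sq_sub_sq]
  push_cast at h2 ⊢
  rw [sub_neg_eq_add] at h2 ⊢
  simp only [ENNReal.toReal_inv, ENNReal.toReal_ofNat, Complex.real_smul]
  push_cast
  field_simp
  ring

end Characteristics

/-! ### The Burgers equation solved along characteristics -/

section Burgers

variable {a t : ℝ} {h z : ℂ} {μ : ℝ → ProbabilityMeasure ℝ}

/-- The Green's function is constant along the characteristics. -/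
theorem IsHydrodynamicLimit.green_charMap (hμ : IsHydrodynamicLimit (twoSources a) μ)
    (ht : 0 ≤ t) (hh : h ∈ charDomain a t) : green μ t (charMap a t h) = initialGreen a h := by
  set m := initialGreen a h
  set c := min h.im (charMap a t h).im
  have hc : 0 < c := lt_min hh.1 ((mem_charDomain_iff hh.1).1 hh)
  let γ : ℝ → ℂ := fun s => charMap a s h
  -- The height of a characteristic is affine and non-increasing in time, so its value at time `t`
  -- bounds it from below.
  have him : ∀ s ∈ Set.Icc 0 t, c ≤ (γ s).im := by
    intro s hs
    have hm : m.im ≤ 0 := by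
      have := Complex.normSq_nonneg h
      have := hh.1
      simp only [m, im_initialGreen, Left.neg_nonpos_iff]
      exact div_nonneg (by positivity) (Complex.normSq_nonneg _)
    have e : ∀ r : ℝ, (charMap a r h).im = h.im + 2 * r * m.im := by
      intro r
      rw [charMap, Complex.add_im, show (2 : ℂ) * r = ((2 * r : ℝ) : ℂ) by push_cast; ring,
        Complex.im_ofReal_mul]
    refine (min_le_right _ _).trans ?_
    simp only [γ, e]
    nlinarith [hs.2]
  have hpos : ∀ s ∈ Set.Icc 0 t, 0 < (γ s).im := fun s hs => hc.trans_le (him s hs)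
  have hγ : ∀ s : ℝ, HasDerivAt γ (2 * m) s := by
    intro s
    have := (((Complex.ofRealCLM.hasDerivAt (x := s)).const_mul (2 : ℂ)).mul_const m).const_add h
    simpa [γ, charMap] using this
  have hd : ∀ s ∈ Set.Icc 0 t, HasDerivWithinAt (fun r => green μ r (γ r) - m)
      ((2 * m - 2 * green μ s (γ s)) * deriv (green μ s) (γ s)) (Set.Icc 0 t) s := fun s hs =>
    (hμ.hasDerivWithinAt_green_comp Set.Icc_subset_Ici_self hs (hγ s).hasDerivWithinAt
      (hpos s hs).ne').sub_const m
  -- The defect $M_s(\gamma_s)-m$ vanishes at $s=0$ and solves a linear equation with coefficient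
  -- $-2\,\partial_zM_s(\gamma_s)$, of norm at most $2\cdot 2/c^2$; Grönwall applies.
  have key := eq_zero_of_abs_deriv_le_mul_abs_self_of_eq_zero_right (K := 4 / (c * c))
    (fun s hs => (hd s hs).continuousWithinAt)
    (fun s hs => (hd s ⟨hs.1, hs.2.le⟩).mono_of_mem_nhdsWithin (Icc_mem_nhdsGE_of_mem hs)) ?_ ?_
    t ⟨ht, le_rfl⟩
  · exact sub_eq_zero.1 key
  · have h0 : γ 0 = h := by simp [γ, charMap]
    simp only [h0]
    rw [green, green_twoSources hμ.initial hh.1.ne', sub_self]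
  · intro s hs
    have hs' : s ∈ Set.Icc 0 t := ⟨hs.1, hs.2.le⟩
    rw [← mul_sub, norm_mul, norm_mul, ← norm_neg (m - _), neg_sub, Complex.norm_two]
    have h1 := norm_deriv_green_le (μ := μ) (t := s) (hpos s hs').ne'
    have h2 : 2 / (|(γ s).im| * |(γ s).im|) ≤ 2 / (c * c) := by
      have := (him s hs').trans (le_abs_self _)
      gcongr
    calc 2 * ‖green μ s (γ s) - m‖ * ‖deriv (green μ s) (γ s)‖
        ≤ 2 * ‖green μ s (γ s) - m‖ * (2 / (c * c)) := by gcongr; exact h1.trans h2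
      _ = 4 / (c * c) * ‖green μ s (γ s) - m‖ := by ring

/-- The starting point of the characteristic through `z` at time `t`. -/
def charInv (μ : ℝ → ProbabilityMeasure ℝ) (t : ℝ) (z : ℂ) : ℂ := z - 2 * t * green μ t z

/-- With `exists_charMap_eq` this makes `charMap a t` a bijection of `charDomain a t` onto the upper
half-plane. -/
theorem IsHydrodynamicLimit.charInv_charMap (hμ : IsHydrodynamicLimit (twoSources a) μ)
    (ht : 0 ≤ t) (hh : h ∈ charDomain a t) : charInv μ t (charMap a t h) = h := by
  rw [charInv, hμ.green_charMap ht hh, charMap]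
  ring

theorem IsHydrodynamicLimit.charInv_mem (hμ : IsHydrodynamicLimit (twoSources a) μ)
    (ht : 0 ≤ t) (hz : 0 < z.im) : charInv μ t z ∈ charDomain a t := by
  obtain ⟨h, hh, rfl⟩ := exists_charMap_eq (a := a) (t := t) hz
  rwa [hμ.charInv_charMap ht hh]

theorem IsHydrodynamicLimit.charMap_charInv (hμ : IsHydrodynamicLimit (twoSources a) μ)
    (ht : 0 ≤ t) (hz : 0 < z.im) : charMap a t (charInv μ t z) = z := by
  obtain ⟨h, hh, rfl⟩ := exists_charMap_eq (a := a) (t := t) hz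
  rw [hμ.charInv_charMap ht hh]

theorem IsHydrodynamicLimit.initialGreen_charInv (hμ : IsHydrodynamicLimit (twoSources a) μ)
    (ht : 0 ≤ t) (hz : 0 < z.im) : initialGreen a (charInv μ t z) = green μ t z := by
  rw [← hμ.green_charMap ht (hμ.charInv_mem ht hz), hμ.charMap_charInv ht hz]

end Burgers

/-! ### The Loewner flow -/

section LoewnerPath

variable {μ : ℝ → ProbabilityMeasure ℝ} {s t : ℝ} {z : ℂ} {γ : ℝ → ℂ}

theorem IsLoewnerPath.mono (hγ : IsLoewnerPath μ t z γ) (hst : s ≤ t) : IsLoewnerPath μ s z γ :=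
  ⟨hγ.1, fun r hr => ⟨(hγ.2 r ⟨hr.1, hr.2.trans hst⟩).1,
    (hγ.2 r ⟨hr.1, hr.2.trans hst⟩).2.mono (Set.Icc_subset_Icc_right hst)⟩⟩

theorem loewnerDomain_anti (hst : s ≤ t) : loewnerDomain μ t ⊆ loewnerDomain μ s :=
  fun _ ⟨hz, γ, hγ⟩ => ⟨hz, γ, hγ.mono hst⟩

theorem hasDerivWithinAt_im {S : Set ℝ} {v : ℂ} (hγ : HasDerivWithinAt γ v S s) :
    HasDerivWithinAt (fun s => (γ s).im) v.im S s :=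
  Complex.imCLM.hasFDerivAt.comp_hasDerivWithinAt s hγ

/-- Since $\operatorname{Im}M_s\le 0$ on the upper half-plane, trajectories descend. The final
height is thus a lower bound for the whole path, below which the vector field may be modified
freely. -/
theorem IsLoewnerPath.antitoneOn_im (hγ : IsLoewnerPath μ t z γ) :
    AntitoneOn (fun s => (γ s).im) (Set.Icc 0 t) := by
  have hd : ∀ s ∈ Set.Icc 0 t,
      HasDerivWithinAt (fun s => (γ s).im) (green μ s (γ s)).im (Set.Icc 0 t) s := fun s hs => 
    hasDerivWithinAt_im (hγ.2 s hs).2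
  refine antitoneOn_of_hasDerivWithinAt_nonpos (convex_Icc 0 t)
    (fun s hs => (hd s hs).continuousWithinAt)
    (fun s hs => (hd s (interior_subset hs)).mono interior_subset) fun s hs => ?_
  exact im_green_nonpos (hγ.2 s (interior_subset hs)).1

/-- The point `w` with its imaginary part raised to at least `c`. -/
def raise (c : ℝ) (w : ℂ) : ℂ := ⟨w.re, max w.im c⟩

theorem raise_of_le {c : ℝ} {w : ℂ} (h : c ≤ w.im) : raise c w = w := by
  apply Complex.ext <;> simp [raise, h]

theorem le_im_raise (c : ℝ) (w : ℂ) : c ≤ (raise c w).im := le_max_right _ _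

theorem norm_raise_sub_le (c : ℝ) (w w' : ℂ) : ‖raise c w - raise c w'‖ ≤ ‖w - w'‖ := by
  rw [← sq_le_sq₀ (norm_nonneg _) (norm_nonneg _), Complex.sq_norm, Complex.sq_norm,
    Complex.normSq_apply, Complex.normSq_apply]
  have := sq_le_sq.2 (abs_max_sub_max_le_abs w.im w'.im c)
  simp only [raise, Complex.sub_re, Complex.sub_im]
  nlinarith

/-- The Loewner vector field, made global by raising the argument above height `c`. -/
def raisedField (μ : ℝ → ProbabilityMeasure ℝ) (c s : ℝ) (w : ℂ) : ℂ := green μ s (raise c w)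

theorem norm_raisedField_le {c : ℝ} (hc : 0 < c) (s : ℝ) (w : ℂ) :
    ‖raisedField μ c s w‖ ≤ 2 / c := by
  have h := le_im_raise c w
  refine (norm_green_le (hc.trans_le h).ne').trans ?_
  rw [abs_of_pos (hc.trans_le h)]
  gcongr

theorem lipschitzWith_raisedField {c : ℝ} (hc : 0 < c) (s : ℝ) :
    LipschitzWith (2 / (c * c)).toNNReal (raisedField μ c s) := by
  refine LipschitzWith.of_dist_le_mul fun w w' => ?_
  rw [dist_eq_norm, dist_eq_norm, Real.coe_toNNReal _ (by positivity)]
  have h := hc.trans_le (le_im_raise c w)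
  have h' := hc.trans_le (le_im_raise c w')
  refine (norm_green_sub_le h.ne' h'.ne').trans ?_
  rw [abs_of_pos h, abs_of_pos h']
  gcongr
  exacts [le_im_raise c w, le_im_raise c w', norm_raise_sub_le c w w']

theorem IsHydrodynamicLimit.exists_raised_solution {μ₀ : Measure ℝ}
    (hμ : IsHydrodynamicLimit μ₀ μ) {c t₀ : ℝ} (hc : 0 < c) (ht₀ : t₀ ∈ Set.Icc 0 t) (w : ℂ) :
    ∃ γ : ℝ → ℂ, γ t₀ = w ∧ ∀ s ∈ Set.Icc 0 t,
      HasDerivWithinAt γ (raisedField μ c s (γ s)) (Set.Icc 0 t) s := by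
  have ht : 0 ≤ t := ht₀.1.trans ht₀.2
  -- The raised field is bounded by $2/c$ everywhere, so a ball of radius $(2/c)t$ contains the
  -- solution on all of $[0,t]$.
  have hPL : IsPicardLindelof (raisedField μ c) (⟨t₀, ht₀⟩ : Set.Icc 0 t) w
      (2 / c * t).toNNReal 0 (2 / c).toNNReal (2 / (c * c)).toNNReal := by
    refine ⟨fun s _ => (lipschitzWith_raisedField hc s).lipschitzOnWith, fun x _ => ?_,
      fun s _ x _ => ?_, ?_⟩
    · intro s hs
      exact (hμ.burgers s hs.1 _ (hc.trans_le (le_im_raise c x)).ne').continuousWithinAt.mono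
        Set.Icc_subset_Ici_self
    · rw [Real.coe_toNNReal _ (by positivity)]
      exact norm_raisedField_le hc s x
    · rw [Real.coe_toNNReal _ (by positivity), Real.coe_toNNReal _ (by positivity)]
      simp only [NNReal.coe_zero, sub_zero]
      have hmax : max (t - t₀) t₀ ≤ t := max_le (by linarith [ht₀.1]) ht₀.2
      exact mul_le_mul_of_nonneg_left hmax (by positivity : (0 : ℝ) ≤ 2 / c)
  exact hPL.exists_eq_forall_mem_Icc_hasDerivWithinAt₀

theorem raised_solution_unique {c : ℝ} (hc : 0 < c) {γ₁ γ₂ : ℝ → ℂ}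
    (h₁ : ∀ s ∈ Set.Icc 0 t, HasDerivWithinAt γ₁ (raisedField μ c s (γ₁ s)) (Set.Icc 0 t) s)
    (h₂ : ∀ s ∈ Set.Icc 0 t, HasDerivWithinAt γ₂ (raisedField μ c s (γ₂ s)) (Set.Icc 0 t) s)
    (h0 : γ₁ 0 = γ₂ 0) : Set.EqOn γ₁ γ₂ (Set.Icc 0 t) :=
  ODE_solution_unique (fun s => lipschitzWith_raisedField hc s)
    (fun s hs => (h₁ s hs).continuousWithinAt)
    (fun s hs => (h₁ s ⟨hs.1, hs.2.le⟩).mono_of_mem_nhdsWithin (Icc_mem_nhdsGE_of_mem hs))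
    (fun s hs => (h₂ s hs).continuousWithinAt)
    (fun s hs => (h₂ s ⟨hs.1, hs.2.le⟩).mono_of_mem_nhdsWithin (Icc_mem_nhdsGE_of_mem hs)) h0

theorem IsLoewnerPath.raised {c : ℝ} (hγ : IsLoewnerPath μ t z γ) (hc : c ≤ (γ t).im) :
    ∀ s ∈ Set.Icc 0 t, HasDerivWithinAt γ (raisedField μ c s (γ s)) (Set.Icc 0 t) s := by
  intro s hs
  have := hγ.antitoneOn_im hs ⟨hs.1.trans hs.2, le_rfl⟩ hs.2
  rw [raisedField, raise_of_le (hc.trans this)]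
  exact (hγ.2 s hs).2

theorem IsLoewnerPath.eqOn (ht : 0 ≤ t) {γ' : ℝ → ℂ} (hγ : IsLoewnerPath μ t z γ)
    (hγ' : IsLoewnerPath μ t z γ') : Set.EqOn γ γ' (Set.Icc 0 t) := by
  have h := (hγ.2 t ⟨ht, le_rfl⟩).1
  have h' := (hγ'.2 t ⟨ht, le_rfl⟩).1
  exact raised_solution_unique (lt_min h h') (hγ.raised (min_le_left _ _))
    (hγ'.raised (min_le_right _ _)) (hγ.1.trans hγ'.1.symm)

theorem IsLoewnerPath.loewnerMap_eq (ht : 0 ≤ t) (hγ : IsLoewnerPath μ t z γ) :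
    loewnerMap μ t z = γ t := by
  have h : ∃ γ : ℝ → ℂ, IsLoewnerPath μ t z γ := ⟨γ, hγ⟩
  rw [loewnerMap, dif_pos h]
  exact h.choose_spec.eqOn ht hγ ⟨ht, le_rfl⟩

variable {μ₀ : Measure ℝ}

/-- Points of the upper half-plane have a backward trajectory for all time. -/
theorem IsHydrodynamicLimit.exists_loewnerPath_ending (hμ : IsHydrodynamicLimit μ₀ μ)
    (ht : 0 ≤ t) {w : ℂ} (hw : 0 < w.im) : ∃ γ : ℝ → ℂ, γ t = w ∧ IsLoewnerPath μ t (γ 0) γ := by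
  -- The solution is higher than `w` at earlier times, so raising to height `w.im` never acts on it.
  obtain ⟨γ, hγt, hγ⟩ := hμ.exists_raised_solution hw (⟨ht, le_rfl⟩ : t ∈ Set.Icc 0 t) w
  have hd : ∀ s ∈ Set.Icc 0 t, HasDerivWithinAt (fun s => (γ s).im)
      (raisedField μ w.im s (γ s)).im (Set.Icc 0 t) s := fun s hs => 
    hasDerivWithinAt_im (hγ s hs)
  have hanti : AntitoneOn (fun s => (γ s).im) (Set.Icc 0 t) :=
    antitoneOn_of_hasDerivWithinAt_nonpos (convex_Icc 0 t)
      (fun s hs => (hd s hs).continuousWithinAt)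
      (fun s hs => (hd s (interior_subset hs)).mono interior_subset)
      fun s hs => im_green_nonpos (hw.trans_le (le_im_raise _ _))
  have him : ∀ s ∈ Set.Icc 0 t, w.im ≤ (γ s).im := fun s hs => by
    simpa [hγt] using hanti hs ⟨ht, le_rfl⟩ hs.2
  refine ⟨γ, hγt, rfl, fun s hs => ⟨hw.trans_le (him s hs), ?_⟩⟩
  simpa [raisedField, raise_of_le (him s hs)] using hγ s hs

/-- The lifetime of a trajectory is never attained. -/
theorem IsHydrodynamicLimit.exists_mem_loewnerDomain_gt (hμ : IsHydrodynamicLimit μ₀ μ)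
    (ht : 0 ≤ t) (hz : z ∈ loewnerDomain μ t) : ∃ s > t, z ∈ loewnerDomain μ s := by
  obtain ⟨hz0, γ, hγ⟩ := hz
  have hpos : 0 < (γ t).im := (hγ.2 t ⟨ht, le_rfl⟩).1
  -- Half the final height leaves room to continue past `t` before the modification of the field is
  -- felt.
  set c := (γ t).im / 2
  have hc : 0 < c := half_pos hpos
  obtain ⟨η, hη0, hη⟩ := hμ.exists_raised_solution hc
    (⟨le_rfl, by linarith⟩ : (0 : ℝ) ∈ Set.Icc 0 (t + 1)) z
  have hsub : Set.Icc 0 t ⊆ Set.Icc 0 (t + 1) := Set.Icc_subset_Icc_right (by linarith)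
  have heq : Set.EqOn η γ (Set.Icc 0 t) :=
    raised_solution_unique hc (fun s hs => (hη s (hsub hs)).mono hsub)
      (hγ.raised (half_le_self hpos.le)) (hη0.trans hγ.1.symm)
  have hcont : ContinuousWithinAt (fun s => (η s).im) (Set.Ici t) t := by
    have h1 : ContinuousWithinAt η (Set.Ici t) t :=
      (hη t ⟨ht, by linarith⟩).continuousWithinAt.mono_of_mem_nhdsWithin
        (Icc_mem_nhdsGE_of_mem ⟨ht, by linarith⟩)
    exact Complex.continuous_im.continuousAt.comp_continuousWithinAt h1
  have hev : ∀ᶠ s in 𝓝[≥] t, c ≤ (η s).im := by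
    refine (hcont.eventually_const_lt (?_ : c < (η t).im)).mono fun s hs => hs.le
    rw [heq ⟨ht, le_rfl⟩]
    exact half_lt_self hpos
  obtain ⟨u, hu, hu'⟩ := mem_nhdsGE_iff_exists_Icc_subset.1 hev
  have htu : t < u := hu
  have hm : t < min u (t + 1) := lt_min htu (by linarith)
  refine ⟨min u (t + 1), hm, hz0, η, hη0, fun s hs => ?_⟩
  have him : c ≤ (η s).im := by
    by_cases hst : s ≤ t
    · rw [heq ⟨hs.1, hst⟩]
      exact (half_le_self hpos.le).trans (hγ.antitoneOn_im ⟨hs.1, hst⟩ ⟨ht, le_rfl⟩ hst)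
    · exact hu' ⟨(not_le.1 hst).le, hs.2.trans (min_le_left _ _)⟩
  refine ⟨hc.trans_le him, ?_⟩
  have := (hη s ⟨hs.1, hs.2.trans (min_le_right _ _)⟩).mono
    (Set.Icc_subset_Icc_right (min_le_right u (t + 1)))
  rwa [raisedField, raise_of_le him] at this

end LoewnerPath

/-! ### The first integral and the inverse Loewner map -/

section LoewnerTwoSources

variable {a s t : ℝ} {h h' z : ℂ} {μ : ℝ → ProbabilityMeasure ℝ} {γ : ℝ → ℂ}

/-- Put $m=M_s(\gamma_s)$ and $k=\gamma_s-2sm$. Then $k'=-(m+2sm')$, and $m(k^2-a^2)=2k$ makes the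
derivative of $(k^2-a^2)e^{sm^2}$ cancel. -/
theorem IsLoewnerPath.firstIntegral_eq (hγ : IsLoewnerPath μ t z γ)
    (hμ : IsHydrodynamicLimit (twoSources a) μ) (ht : 0 ≤ t) :
    firstIntegral a t (charInv μ t (γ t)) = z ^ 2 - (a : ℂ) ^ 2 := by
  let m : ℝ → ℂ := fun s => green μ s (γ s)
  let k : ℝ → ℂ := fun s => γ s - 2 * s * m s
  have hk : ∀ s ∈ Set.Icc 0 t, m s = initialGreen a (k s) := fun s hs =>
    (hμ.initialGreen_charInv hs.1 (hγ.2 s hs).1).symm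
  have hd : ∀ s ∈ Set.Icc 0 t, HasDerivWithinAt
      (fun s => (k s ^ 2 - (a : ℂ) ^ 2) * Complex.exp (s * m s ^ 2)) 0 (Set.Icc 0 t) s := by
    intro s hs
    have hs' := hγ.2 s hs
    have hm : HasDerivWithinAt m ((m s - 2 * m s) * deriv (green μ s) (γ s)) (Set.Icc 0 t) s :=
      hμ.hasDerivWithinAt_green_comp Set.Icc_subset_Ici_self hs hs'.2
        (ne_of_gt hs'.1)
    set m' := (m s - 2 * m s) * deriv (green μ s) (γ s)
    have hid : HasDerivWithinAt (fun r : ℝ => (r : ℂ)) 1 (Set.Icc 0 t) s :=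
      (Complex.ofRealCLM.hasDerivAt (x := s)).hasDerivWithinAt
    have hk' : HasDerivWithinAt k (m s - (2 * 1 * m s + 2 * s * m')) (Set.Icc 0 t) s :=
      hs'.2.sub ((hid.const_mul 2).mul hm)
    have hE := ((hk'.pow 2).sub_const ((a : ℂ) ^ 2)).mul (hid.mul (hm.pow 2)).cexp
    have hq : m s * (k s ^ 2 - (a : ℂ) ^ 2) = 2 * k s := by
      have hk0 : (k s).im ≠ 0 := (hμ.charInv_mem hs.1 hs'.1).1.ne'
      rw [hk s hs, initialGreen, div_mul_cancel₀ _ (sq_sub_sq_ne_zero_of_im hk0)]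
    refine hE.congr_deriv ?_
    simp only [Pi.mul_apply, Pi.pow_apply, Nat.cast_ofNat]
    norm_num
    linear_combination (Complex.exp (s * m s ^ 2) * (m s + 2 * s * m')) * hq
  have hconst := constant_of_has_deriv_right_zero (fun s hs => (hd s hs).continuousWithinAt)
    (fun s hs => (hd s ⟨hs.1, hs.2.le⟩).mono_of_mem_nhdsWithin (Icc_mem_nhdsGE_of_mem hs))
    t ⟨ht, le_rfl⟩
  have hkt := hk t ⟨ht, le_rfl⟩
  simp only [hkt] at hconst
  have hk0 : k 0 = z := by simp [k, hγ.1]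
  rw [hk0] at hconst
  simpa [firstIntegral, k, m, charInv] using hconst

theorem eq_of_sq_eq_sq_of_im_pos {w z : ℂ} (hw : 0 < w.im) (hz : 0 < z.im) (h : w ^ 2 = z ^ 2) :
    w = z := by
  rcases sq_eq_sq_iff_eq_or_eq_neg.1 h with h | h
  · exact h
  · have := congrArg Complex.im h
    rw [Complex.neg_im] at this
    linarith

theorem IsHydrodynamicLimit.exists_loewnerPath (hμ : IsHydrodynamicLimit (twoSources a) μ)
    (ht : 0 ≤ t) (hh : h ∈ charDomain a t) : ∃ z γ, IsLoewnerPath μ t z γ ∧ 0 < z.im ∧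
      γ t = charMap a t h ∧ firstIntegral a t h = z ^ 2 - (a : ℂ) ^ 2 := by
  obtain ⟨γ, hγt, hγ⟩ := hμ.exists_loewnerPath_ending ht ((mem_charDomain_iff hh.1).1 hh)
  refine ⟨γ 0, γ, hγ, (hγ.2 0 ⟨le_rfl, ht⟩).1, hγt, ?_⟩
  rw [← hγ.firstIntegral_eq hμ ht, hγt, hμ.charInv_charMap ht hh]

/-- The backward trajectory from `charMap a t h` starts at a point with the same square as `z`; both
lie in the upper half-plane, so they coincide. -/
theorem IsHydrodynamicLimit.mem_loewnerDomain_of_firstIntegral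
    (hμ : IsHydrodynamicLimit (twoSources a) μ) (ht : 0 ≤ t) (hz : 0 < z.im)
    (hh : h ∈ charDomain a t) (hE : firstIntegral a t h = z ^ 2 - (a : ℂ) ^ 2) :
    z ∈ loewnerDomain μ t ∧ loewnerMap μ t z = charMap a t h := by
  obtain ⟨w, γ, hγ, hw, hγt, hE'⟩ := hμ.exists_loewnerPath ht hh
  obtain rfl : w = z := eq_of_sq_eq_sq_of_im_pos hw hz (by linear_combination hE - hE')
  exact ⟨⟨hz, γ, hγ⟩, (hγ.loewnerMap_eq ht).trans hγt⟩

theorem IsHydrodynamicLimit.exists_of_mem_loewnerDomain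
    (hμ : IsHydrodynamicLimit (twoSources a) μ) (ht : 0 ≤ t) (hz : z ∈ loewnerDomain μ t) :
    ∃ h ∈ charDomain a t, firstIntegral a t h = z ^ 2 - (a : ℂ) ^ 2 := by
  obtain ⟨-, γ, hγ⟩ := hz
  exact ⟨_, hμ.charInv_mem ht (hγ.2 t ⟨ht, le_rfl⟩).1, hγ.firstIntegral_eq hμ ht⟩

/-- Equal values come from the same starting point, hence have the same Loewner image, and `charMap`
is injective. No estimate on the formula is needed. -/
theorem IsHydrodynamicLimit.injOn_firstIntegral (hμ : IsHydrodynamicLimit (twoSources a) μ)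
    (ht : 0 ≤ t) : Set.InjOn (firstIntegral a t) (charDomain a t) := by
  intro h hh h' hh' hE
  obtain ⟨z, γ, hγ, hz, hγt, hE'⟩ := hμ.exists_loewnerPath ht hh
  have h1 := (hμ.mem_loewnerDomain_of_firstIntegral ht hz hh hE').2
  have h2 := (hμ.mem_loewnerDomain_of_firstIntegral ht hz hh' (hE ▸ hE')).2
  rw [← hμ.charInv_charMap ht hh, ← hμ.charInv_charMap ht hh', ← h1, ← h2]

end LoewnerTwoSources

/-! ### Elementary estimates on the first integral -/

section Sqrt

/-- The signs give $|z-w|\le|z+w|$. This makes square roots in a closed quadrant unique and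
Hölder-$\frac12$ continuous, branch point included. -/
theorem norm_sub_sq_le {z w : ℂ} (hre : 0 ≤ z.re * w.re) (him : 0 ≤ z.im * w.im) :
    ‖z - w‖ ^ 2 ≤ ‖z ^ 2 - w ^ 2‖ := by
  rw [sq_sub_sq, norm_mul, sq]
  gcongr
  rw [← sq_le_sq₀ (norm_nonneg _) (norm_nonneg _), Complex.sq_norm, Complex.sq_norm,
    Complex.normSq_apply, Complex.normSq_apply]
  simp only [Complex.sub_re, Complex.sub_im, Complex.add_re, Complex.add_im]
  nlinarith

theorem eq_of_sq_eq_sq_of_quadrant {z w : ℂ} (hre : 0 ≤ z.re * w.re) (him : 0 ≤ z.im * w.im)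
    (h : z ^ 2 = w ^ 2) : z = w := by
  have := norm_sub_sq_le hre him
  rw [h, sub_self, norm_zero] at this
  exact sub_eq_zero.1 (norm_eq_zero.1 (pow_eq_zero_iff two_ne_zero |>.1
    (le_antisymm this (by positivity))))

theorem upperSqrt_sq (ζ : ℂ) : upperSqrt ζ ^ 2 = ζ := by
  have h : (ζ ^ (1 / 2 : ℂ)) ^ 2 = ζ := by
    simp
  rw [upperSqrt]
  split_ifs
  · rw [neg_sq, h]
  · exact h

theorem upperSqrt_im_nonneg (ζ : ℂ) : 0 ≤ (upperSqrt ζ).im := by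
  rw [upperSqrt]
  split_ifs with h
  · simpa using h.le
  · exact not_lt.1 h

theorem upperSqrt_re_nonneg {ζ : ℂ} (hζ : 0 ≤ ζ.im) : 0 ≤ (upperSqrt ζ).re := by
  rcases eq_or_ne ζ 0 with rfl | h0
  · simp [upperSqrt]
  have harg := Complex.arg_nonneg_iff.2 hζ
  have harg' := Complex.arg_le_pi ζ
  have hlog : Complex.log ζ * (1 / 2 : ℂ) = ⟨Real.log ‖ζ‖ / 2, ζ.arg / 2⟩ := by
    apply Complex.ext
    · rw [show (1 / 2 : ℂ) = ((1 / 2 : ℝ) : ℂ) by push_cast; rfl, Complex.re_mul_ofReal,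
        Complex.log_re]
      ring
    · rw [show (1 / 2 : ℂ) = ((1 / 2 : ℝ) : ℂ) by push_cast; rfl, Complex.im_mul_ofReal,
        Complex.log_im]
      ring
  have hne : ¬ (ζ ^ (1 / 2 : ℂ)).im < 0 := by
    rw [Complex.cpow_def_of_ne_zero h0, hlog, Complex.exp_im, not_lt]
    exact mul_nonneg (Real.exp_pos _).le
      (Real.sin_nonneg_of_nonneg_of_le_pi (by linarith) (by linarith))
  rw [upperSqrt, if_neg hne, Complex.cpow_def_of_ne_zero h0, hlog, Complex.exp_re]
  exact mul_nonneg (Real.exp_pos _).le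
    (Real.cos_nonneg_of_mem_Icc ⟨by linarith, by linarith⟩)

theorem continuousOn_upperSqrt : ContinuousOn upperSqrt {ζ | 0 ≤ ζ.im} := by
  intro w hw
  rw [ContinuousWithinAt, tendsto_iff_norm_sub_tendsto_zero]
  have h1 : Tendsto (fun ζ : ℂ => √‖ζ - w‖) (𝓝[{ζ | 0 ≤ ζ.im}] w) (𝓝 0) := by
    have : ContinuousAt (fun ζ : ℂ => √‖ζ - w‖) w := by fun_prop
    simpa [ContinuousAt] using this.tendsto.mono_left nhdsWithin_le_nhds
  refine squeeze_zero' (Eventually.of_forall fun _ => norm_nonneg _) ?_ h1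
  filter_upwards [self_mem_nhdsWithin] with ζ hζ
  apply Real.le_sqrt_of_sq_le
  have := norm_sub_sq_le (z := upperSqrt ζ) (w := upperSqrt w)
    (mul_nonneg (upperSqrt_re_nonneg hζ) (upperSqrt_re_nonneg hw))
    (mul_nonneg (upperSqrt_im_nonneg ζ) (upperSqrt_im_nonneg w))
  rwa [upperSqrt_sq, upperSqrt_sq] at this

end Sqrt

/-! ### The argument of the first integral -/

section Phase

variable {a t κ : ℝ} {h z : ℂ}

/-- The exponent of the first integral, at the time at which the characteristic of `h` hits the
real line. -/
def hitExponent (a : ℝ) (h : ℂ) : ℂ :=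
  h ^ 2 * (starRingEnd ℂ) (h ^ 2 - (a : ℂ) ^ 2)
    / ((h ^ 2 - (a : ℂ) ^ 2) * ((Complex.normSq h + a ^ 2 : ℝ) : ℂ))

/-- The first integral at the time at which the characteristic of `h` hits the real line. -/
def hitIntegral (a : ℝ) (h : ℂ) : ℂ := (h ^ 2 - (a : ℂ) ^ 2) * Complex.exp (hitExponent a h)

theorem weight_pos (ha : a ≠ 0) (h : ℂ) : 0 < Complex.normSq h + a ^ 2 := by
  have := Complex.normSq_nonneg h
  positivity

/-- The real factor $\kappa$ lies in $[0,1]$ on `charClosure` and, where $h^2\ne a^2$, equals 1 on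
`charCurve`. One estimate on the time-free `hitExponent`, uniform in $\kappa$, then serves all
times. -/
theorem mul_initialGreen_sq (ha : a ≠ 0) (t : ℝ) (h : ℂ) : t * initialGreen a h ^ 2
    = ((4 * t * (Complex.normSq h + a ^ 2) / Complex.normSq (h ^ 2 - (a : ℂ) ^ 2) : ℝ) : ℂ)
      * hitExponent a h := by
  rcases eq_or_ne (h ^ 2 - (a : ℂ) ^ 2) 0 with hq | hq
  · simp [initialGreen, hitExponent, hq]
  have hN : ((Complex.normSq h + a ^ 2 : ℝ) : ℂ) ≠ 0 := by exact_mod_cast (weight_pos ha h).ne'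
  have hc : (starRingEnd ℂ) (h ^ 2 - (a : ℂ) ^ 2) ≠ 0 := (map_ne_zero _).2 hq
  rw [Complex.ofReal_div, Complex.normSq_eq_conj_mul_self (z := h ^ 2 - (a : ℂ) ^ 2), initialGreen,
    hitExponent, Complex.ofReal_mul (4 * t)]
  field_simp
  push_cast
  ring

theorem firstIntegral_eq_mul_exp (ha : a ≠ 0) (t : ℝ) (h : ℂ) :
    firstIntegral a t h = (h ^ 2 - (a : ℂ) ^ 2) * Complex.exp
      (((4 * t * (Complex.normSq h + a ^ 2) / Complex.normSq (h ^ 2 - (a : ℂ) ^ 2) : ℝ) : ℂ)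
        * hitExponent a h) := by
  rw [firstIntegral, mul_initialGreen_sq ha]

theorem firstIntegral_eq_hitIntegral (ha : a ≠ 0) (hh : h ∈ charCurve a t) :
    firstIntegral a t h = hitIntegral a h := by
  rw [firstIntegral_eq_mul_exp ha, hitIntegral, hh.2]
  rcases eq_or_ne (h ^ 2 - (a : ℂ) ^ 2) 0 with hq | hq
  · simp [hq]
  · rw [div_self (Complex.normSq_pos.2 hq).ne', Complex.ofReal_one, one_mul]

theorem norm_hitExponent_le (a : ℝ) (h : ℂ) : ‖hitExponent a h‖ ≤ 1 := by
  have hN : 0 ≤ Complex.normSq h + a ^ 2 := by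
    have := Complex.normSq_nonneg h
    positivity
  rw [hitExponent, norm_div, norm_mul, norm_mul, RCLike.norm_conj, Complex.norm_real,
    Real.norm_of_nonneg hN, norm_pow, Complex.sq_norm]
  apply div_le_one_of_le₀ _ (by positivity)
  rw [mul_comm]
  gcongr
  linarith [sq_nonneg a]

theorem continuous_hitIntegral (ha : a ≠ 0) : Continuous (hitIntegral a) := by
  rw [continuous_iff_continuousAt]
  intro h
  rcases eq_or_ne (h ^ 2 - (a : ℂ) ^ 2) 0 with hq | hq
  -- At $h=\pm a$ the exponent is discontinuous but bounded by 1, so the vanishing prefactor decides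
  -- the limit.
  · have h0 : hitIntegral a h = 0 := by rw [hitIntegral, hq, zero_mul]
    rw [ContinuousAt, h0, tendsto_zero_iff_norm_tendsto_zero]
    have h1 : Tendsto (fun k : ℂ => ‖k ^ 2 - (a : ℂ) ^ 2‖ * Real.exp 1) (𝓝 h) (𝓝 0) := by
      have : ContinuousAt (fun k : ℂ => ‖k ^ 2 - (a : ℂ) ^ 2‖ * Real.exp 1) h := by fun_prop
      simpa [ContinuousAt, hq] using this
    refine squeeze_zero (fun _ => norm_nonneg _) (fun k => ?_) h1
    rw [hitIntegral, norm_mul, Complex.norm_exp]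
    gcongr
    exact (Complex.re_le_norm _).trans (norm_hitExponent_le a k)
  · have hN : ((Complex.normSq h + a ^ 2 : ℝ) : ℂ) ≠ 0 := by
      exact_mod_cast (weight_pos ha h).ne'
    unfold hitIntegral hitExponent
    have : ContinuousAt (fun k : ℂ => k ^ 2 * (starRingEnd ℂ) (k ^ 2 - (a : ℂ) ^ 2)
        / ((k ^ 2 - (a : ℂ) ^ 2) * ((Complex.normSq k + a ^ 2 : ℝ) : ℂ))) h := by
      refine ContinuousAt.div ?_ ?_ (mul_ne_zero hq hN)
      · exact ((continuous_pow 2).mul (Complex.continuous_conj.comp (by fun_prop))).continuousAt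
      · have : Continuous fun k : ℂ => ((Complex.normSq k + a ^ 2 : ℝ) : ℂ) :=
          Complex.continuous_ofReal.comp (Complex.continuous_normSq.add continuous_const)
        exact ((by fun_prop : Continuous fun k : ℂ => k ^ 2 - (a : ℂ) ^ 2).mul this).continuousAt
    fun_prop

theorem im_sq_sub_sq (a : ℝ) (h : ℂ) : (h ^ 2 - (a : ℂ) ^ 2).im = 2 * (h.re * h.im) := by
  simp [pow_two]
  ring

/-- Write $h^2-a^2=\rho e^{i\theta}$ with $\theta\in[0,\pi]$. The exponential changes the argument
to $\theta-c\sin\theta$ with $|c|\le1$, and $\sin\theta\le\min(\theta,\pi-\theta)$ keeps it in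
$[0,\pi]$. -/
theorem im_mul_exp_hitExponent (ha : a ≠ 0) (hκ : 0 ≤ κ) (hκ' : κ ≤ 1)
    (hq : 0 ≤ (h ^ 2 - (a : ℂ) ^ 2).im) :
    0 ≤ ((h ^ 2 - (a : ℂ) ^ 2) * Complex.exp (κ * hitExponent a h)).im ∧
    (0 < (h ^ 2 - (a : ℂ) ^ 2).im →
      0 < ((h ^ 2 - (a : ℂ) ^ 2) * Complex.exp (κ * hitExponent a h)).im) := by
  rcases eq_or_ne (h ^ 2 - (a : ℂ) ^ 2) 0 with hq0 | hq0
  · simp [hq0]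
  set q : ℂ := h ^ 2 - (a : ℂ) ^ 2 with hqdef
  set N : ℝ := Complex.normSq h + a ^ 2 with hN
  have hNpos : 0 < N := weight_pos ha h
  have hρ : 0 < ‖q‖ := norm_pos_iff.2 hq0
  have hre : q.re = ‖q‖ * Real.cos q.arg := (Complex.norm_mul_cos_arg q).symm
  have him : q.im = ‖q‖ * Real.sin q.arg := (Complex.norm_mul_sin_arg q).symm
  set ρ := ‖q‖
  set θ := q.arg
  have hθ0 : 0 ≤ θ := Complex.arg_nonneg_iff.2 hq
  have hθπ : θ ≤ Real.pi := Complex.arg_le_pi q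
  have hs0 : 0 ≤ Real.sin θ := Real.sin_nonneg_of_nonneg_of_le_pi hθ0 hθπ
  have hcs := Real.sin_sq_add_cos_sq θ
  have hsq : q.re * q.re + q.im * q.im = ρ ^ 2 := by
    rw [← Complex.normSq_apply, ← Complex.sq_norm]
  -- the imaginary part of the exponent
  have hX : (hitExponent a h).im = -(Real.sin θ * ((ρ + 2 * a ^ 2 * Real.cos θ) / N)) := by
    have e : hitExponent a h = (((ρ ^ 2 * N)⁻¹ : ℝ) : ℂ)
        * ((q + (a : ℂ) ^ 2) * (starRingEnd ℂ) q ^ 2) := by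
      have h1 : ((ρ ^ 2 : ℝ) : ℂ) = q * (starRingEnd ℂ) q := by
        rw [Complex.mul_conj, Complex.sq_norm]
      have h2 : (N : ℂ) ≠ 0 := by exact_mod_cast hNpos.ne'
      have h3 : (starRingEnd ℂ) q ≠ 0 := (map_ne_zero _).2 hq0
      rw [hitExponent, ← hN, ← hqdef, Complex.ofReal_inv, Complex.ofReal_mul, h1]
      field_simp
      rw [hqdef]
      ring
    have e2 : ((q + (a : ℂ) ^ 2) * (starRingEnd ℂ) q ^ 2).im
        = -(q.im * (q.re * q.re + q.im * q.im)) - 2 * a ^ 2 * (q.re * q.im) := by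
      simp [pow_two]
      ring
    rw [e, Complex.im_ofReal_mul, e2, hsq, hre, him]
    field_simp
    ring
  -- it is at most `sin θ` in absolute value
  have hc : |(ρ + 2 * a ^ 2 * Real.cos θ) / N| ≤ 1 := by
    rw [abs_div, abs_of_pos hNpos, div_le_one hNpos]
    -- The quantity on the left is $|\operatorname{Re}(e^{-i\theta}h^2)|$, because $h^2=\rho
    -- e^{i\theta}+a^2$.
    have h1 : |ρ + a ^ 2 * Real.cos θ| ≤ Complex.normSq h := by
      have e : Complex.normSq h ^ 2 = Complex.normSq (q + (a : ℂ) ^ 2) := by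
        rw [← map_pow, hqdef]
        ring_nf
      apply abs_le_of_sq_le_sq _ (Complex.normSq_nonneg h)
      rw [e, Complex.normSq_apply]
      simp only [Complex.add_re, Complex.add_im, ← Complex.ofReal_pow, Complex.ofReal_re,
        Complex.ofReal_im, hre, him]
      have : 0 ≤ (a ^ 2 * Real.sin θ) ^ 2 := sq_nonneg _
      have e3 : Real.sin θ ^ 2 = 1 - Real.cos θ ^ 2 := by linarith
      have e4 : (a ^ 2 * Real.sin θ) ^ 2 = a ^ 4 * (1 - Real.cos θ ^ 2) := by rw [← e3]; ring
      have e5 : ρ * Real.sin θ * (ρ * Real.sin θ) = ρ ^ 2 * (1 - Real.cos θ ^ 2) := by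
        rw [← e3]; ring
      nlinarith
    have h2 : |a ^ 2 * Real.cos θ| ≤ a ^ 2 := by
      rw [abs_mul, abs_of_nonneg (sq_nonneg a)]
      exact mul_le_of_le_one_right (sq_nonneg a) (Real.abs_cos_le_one θ)
    calc |ρ + 2 * a ^ 2 * Real.cos θ|
        = |(ρ + a ^ 2 * Real.cos θ) + a ^ 2 * Real.cos θ| := by ring_nf
      _ ≤ _ := (abs_add_le _ _).trans (add_le_add h1 h2)
  set c := κ * ((ρ + 2 * a ^ 2 * Real.cos θ) / N) with hcdef
  have hc1 : |c| ≤ 1 := by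
    rw [hcdef, abs_mul, abs_of_nonneg hκ]
    exact mul_le_one₀ hκ' (abs_nonneg _) hc
  have key : (q * Complex.exp (κ * hitExponent a h)).im
      = ρ * Real.exp (κ * hitExponent a h).re * Real.sin (θ - c * Real.sin θ) := by
    have : (κ * hitExponent a h).im = -(c * Real.sin θ) := by
      rw [Complex.im_ofReal_mul, hX, hcdef]
      ring
    rw [Complex.mul_im, Complex.exp_re, Complex.exp_im, this, hre, him, Real.sin_sub, Real.sin_neg,
      Real.cos_neg]
    ring
  rw [key]
  have hstrict : 0 < q.im →
      0 < ρ * Real.exp (κ * hitExponent a h).re * Real.sin (θ - c * Real.sin θ) := by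
    intro hq'
    have hs : 0 < Real.sin θ := by
      rw [him] at hq'
      exact pos_of_mul_pos_right hq' hρ.le
    have hθ0' : 0 < θ := hθ0.lt_of_ne (fun h0 => by simp [← h0] at hs)
    have hθπ' : θ < Real.pi := hθπ.lt_of_ne (fun h0 => by simp [h0] at hs)
    have h1 := Real.sin_lt hθ0'
    have h2 : Real.sin θ < Real.pi - θ := by
      rw [← Real.sin_pi_sub]
      exact Real.sin_lt (by linarith)
    have h3 : |c * Real.sin θ| ≤ Real.sin θ := by
      rw [abs_mul, abs_of_pos hs]
      exact mul_le_of_le_one_left hs.le hc1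
    have h4 := abs_le.1 h3
    exact mul_pos (by positivity) (Real.sin_pos_of_pos_of_lt_pi (by linarith) (by linarith))
  refine ⟨?_, hstrict⟩
  rcases hq.eq_or_lt with h0 | h0
  · have hs : Real.sin θ = 0 := by
      rw [him] at h0
      exact (mul_eq_zero.1 h0.symm).resolve_left hρ.ne'
    simp [hs]
  · exact (hstrict h0).le

/-- The exponent is $-\kappa u$ with $u=y^2/(y^2+a^2)$; use $e^{-\kappa u}\ge1-u$ and
$(y^2+a^2)(1-u)=a^2$. In terms of $z^2=a^2+x$, the imaginary axis is preserved. -/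
theorem mul_exp_hitExponent_of_re_eq_zero (ha : a ≠ 0) (hκ' : κ ≤ 1)
    (hre : h.re = 0) : ∃ x : ℝ,
    (h ^ 2 - (a : ℂ) ^ 2) * Complex.exp (κ * hitExponent a h) = x ∧ x ≤ -a ^ 2 ∧
      (h.im ≠ 0 → x < -a ^ 2) := by
  set y := h.im
  have hN : 0 < y ^ 2 + a ^ 2 := by positivity
  have hh : h ^ 2 = ((-(y ^ 2) : ℝ) : ℂ) := by
    apply Complex.ext <;> simp [pow_two, hre, y]
  have hq : h ^ 2 - (a : ℂ) ^ 2 = ((-(y ^ 2 + a ^ 2) : ℝ) : ℂ) := by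
    rw [hh]; push_cast; ring
  have hn : Complex.normSq h = y ^ 2 := by rw [Complex.normSq_apply, hre]; ring
  have hX : hitExponent a h = ((-(y ^ 2 / (y ^ 2 + a ^ 2)) : ℝ) : ℂ) := by
    have hN' : ((y : ℂ) ^ 2 + (a : ℂ) ^ 2) ≠ 0 := by exact_mod_cast hN.ne'
    rw [hitExponent, hq, Complex.conj_ofReal, hn, hh]
    push_cast
    field_simp
  set u := y ^ 2 / (y ^ 2 + a ^ 2) with hu
  have hu0 : 0 ≤ u := by positivity
  have huN : (y ^ 2 + a ^ 2) * (1 - u) = a ^ 2 := by rw [hu]; field_simp; ring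
  have hexp : Real.exp (-u) ≤ Real.exp (κ * -u) := Real.exp_le_exp.2 (by nlinarith)
  refine ⟨-(y ^ 2 + a ^ 2) * Real.exp (κ * -u), ?_, ?_, ?_⟩
  · rw [hq, hX]
    push_cast
    rfl
  · have := Real.add_one_le_exp (-u)
    have : (y ^ 2 + a ^ 2) * (1 - u) ≤ (y ^ 2 + a ^ 2) * Real.exp (κ * -u) := by
      gcongr
      linarith
    linarith
  · intro hy
    have hu1 : 0 < u := by positivity
    have := Real.add_one_lt_exp (neg_ne_zero.2 hu1.ne')
    have : (y ^ 2 + a ^ 2) * (1 - u) < (y ^ 2 + a ^ 2) * Real.exp (κ * -u) := by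
      gcongr
      linarith
    linarith

/-- Only $y^2<a^2$ needs an argument: there $e^{-\kappa u}\ge1-y^2/a^2$. The result means $z^2\ge0$,
so a real `h` never corresponds to a `z` in the upper half-plane. -/
theorem mul_exp_hitExponent_of_im_eq_zero (ha : a ≠ 0) (hκ' : κ ≤ 1)
    (him : h.im = 0) : ∃ x : ℝ,
    (h ^ 2 - (a : ℂ) ^ 2) * Complex.exp (κ * hitExponent a h) = x ∧ -a ^ 2 ≤ x := by
  set y := h.re
  have hN : 0 < y ^ 2 + a ^ 2 := by positivity
  have ha2 : 0 < a ^ 2 := by positivity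
  have hh : h ^ 2 = ((y ^ 2 : ℝ) : ℂ) := by
    apply Complex.ext <;> simp [pow_two, him, y]
  have hq : h ^ 2 - (a : ℂ) ^ 2 = ((y ^ 2 - a ^ 2 : ℝ) : ℂ) := by
    rw [hh]; push_cast; ring
  have hn : Complex.normSq h = y ^ 2 := by rw [Complex.normSq_apply, him]; ring
  rcases eq_or_ne (y ^ 2 - a ^ 2) 0 with h0 | h0
  · exact ⟨0, by rw [hq, h0]; simp, by linarith⟩
  have hX : hitExponent a h = ((y ^ 2 / (y ^ 2 + a ^ 2) : ℝ) : ℂ) := by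
    have hN' : ((y : ℂ) ^ 2 + (a : ℂ) ^ 2) ≠ 0 := by exact_mod_cast hN.ne'
    have h0' : ((y : ℂ) ^ 2 - (a : ℂ) ^ 2) ≠ 0 := by exact_mod_cast h0
    rw [hitExponent, hq, Complex.conj_ofReal, hn, hh]
    push_cast
    field_simp
  set u := y ^ 2 / (y ^ 2 + a ^ 2) with hu
  have hu0 : 0 ≤ u := by positivity
  refine ⟨(y ^ 2 - a ^ 2) * Real.exp (κ * u), ?_, ?_⟩
  · rw [hq, hX]
    push_cast
    rfl
  rcases le_or_gt 0 (y ^ 2 - a ^ 2) with h1 | h1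
  · have : 0 ≤ (y ^ 2 - a ^ 2) * Real.exp (κ * u) := by positivity
    linarith
  have hu1 : κ * u ≤ y ^ 2 / a ^ 2 := by
    refine (mul_le_of_le_one_left hu0 hκ').trans ?_
    rw [hu]
    gcongr
    linarith [sq_nonneg y]
  have h2 : 1 - y ^ 2 / a ^ 2 ≤ Real.exp (-(κ * u)) := by
    linarith [Real.add_one_le_exp (-(κ * u))]
  have h3 : a ^ 2 - y ^ 2 ≤ a ^ 2 * Real.exp (-(κ * u)) := by
    calc a ^ 2 - y ^ 2 = a ^ 2 * (1 - y ^ 2 / a ^ 2) := by field_simp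
      _ ≤ _ := by gcongr
  have h4 : (a ^ 2 - y ^ 2) * Real.exp (κ * u) ≤ a ^ 2 := by
    calc (a ^ 2 - y ^ 2) * Real.exp (κ * u) ≤ a ^ 2 * Real.exp (-(κ * u)) * Real.exp (κ * u) := by
          gcongr
      _ = a ^ 2 := by rw [mul_assoc, ← Real.exp_add]; simp
  linarith

end Phase

/-! ### The curve of first hitting points of the characteristics -/

section HittingCurve

variable {a t : ℝ} {h h' z : ℂ}

/-- The closure of `charDomain a t` (for `t > 0`). -/
def charClosure (a t : ℝ) : Set ℂ :=
  {h | 0 ≤ h.im ∧ 4 * t * (Complex.normSq h + a ^ 2) ≤ Complex.normSq (h ^ 2 - (a : ℂ) ^ 2)}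

theorem charDomain_subset_charClosure : charDomain a t ⊆ charClosure a t :=
  fun _ h => ⟨h.1.le, h.2.le⟩

theorem charCurve_subset_charClosure : charCurve a t ⊆ charClosure a t :=
  fun _ h => ⟨h.1, h.2.le⟩

theorem isClosed_charClosure (a t : ℝ) : IsClosed (charClosure a t) := by
  have h1 : Continuous fun h : ℂ => 4 * t * (Complex.normSq h + a ^ 2) :=
    continuous_const.mul (Complex.continuous_normSq.add continuous_const)
  have h2 : Continuous fun h : ℂ => Complex.normSq (h ^ 2 - (a : ℂ) ^ 2) :=
    Complex.continuous_normSq.comp (by fun_prop)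
  exact (isClosed_le continuous_const Complex.continuous_im).inter (isClosed_le h1 h2)

theorem continuousAt_initialGreen (hq : h ^ 2 - (a : ℂ) ^ 2 ≠ 0) :
    ContinuousAt (initialGreen a) h := by
  unfold initialGreen
  fun_prop (disch := assumption)

theorem continuousAt_charMap (ha : a ≠ 0) (ht : 0 ≤ t) (hh : h ∈ charClosure a t) :
    ContinuousAt (charMap a t) h := by
  rcases ht.eq_or_lt with rfl | ht
  · have : charMap a 0 = fun h => h := by ext; simp [charMap]
    rw [this]
    fun_prop
  · have := continuousAt_initialGreen (sq_sub_sq_ne_zero ha ht hh.2)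
    unfold charMap
    fun_prop

theorem continuousAt_firstIntegral_uncurry (hq : h ^ 2 - (a : ℂ) ^ 2 ≠ 0) :
    ContinuousAt (fun p : ℝ × ℂ => firstIntegral a p.1 p.2) (t, h) := by
  have : ContinuousAt (fun p : ℝ × ℂ => initialGreen a p.2) (t, h) :=
    (continuousAt_initialGreen hq).comp (f := Prod.snd) (x := (t, h)) continuousAt_snd
  unfold firstIntegral
  fun_prop

theorem continuousAt_firstIntegral (ha : a ≠ 0) (ht : 0 ≤ t) (hh : h ∈ charClosure a t) :
    ContinuousAt (firstIntegral a t) h := by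
  rcases ht.eq_or_lt with rfl | ht
  · have : firstIntegral a 0 = fun h => h ^ 2 - (a : ℂ) ^ 2 := by ext; simp [firstIntegral]
    rw [this]
    fun_prop
  · have := continuousAt_initialGreen (sq_sub_sq_ne_zero ha ht hh.2)
    unfold firstIntegral
    fun_prop

theorem kappa_mem (ha : a ≠ 0) (ht : 0 ≤ t)
    (hh : 4 * t * (Complex.normSq h + a ^ 2) ≤ Complex.normSq (h ^ 2 - (a : ℂ) ^ 2)) :
    0 ≤ 4 * t * (Complex.normSq h + a ^ 2) / Complex.normSq (h ^ 2 - (a : ℂ) ^ 2) ∧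
    4 * t * (Complex.normSq h + a ^ 2) / Complex.normSq (h ^ 2 - (a : ℂ) ^ 2) ≤ 1 := by
  have hN := weight_pos ha h
  exact ⟨div_nonneg (by positivity) (Complex.normSq_nonneg _),
    div_le_one_of_le₀ hh (Complex.normSq_nonneg _)⟩

/-- The symmetry of the two sources reduces the left half-plane to the right one. -/
theorem firstIntegral_neg_conj (a t : ℝ) (h : ℂ) :
    firstIntegral a t (-(starRingEnd ℂ) h) = (starRingEnd ℂ) (firstIntegral a t h) := by
  have : initialGreen a (-(starRingEnd ℂ) h) = -(starRingEnd ℂ) (initialGreen a h) := by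
    simp [initialGreen, neg_div, map_ofNat (starRingEnd ℂ) 2]
  rw [firstIntegral, firstIntegral, this, map_mul, ← Complex.exp_conj]
  simp

theorem normSq_neg_conj_sq_sub_sq (a : ℝ) (h : ℂ) :
    Complex.normSq ((-(starRingEnd ℂ) h) ^ 2 - (a : ℂ) ^ 2)
      = Complex.normSq (h ^ 2 - (a : ℂ) ^ 2) := by
  rw [← Complex.normSq_conj (h ^ 2 - (a : ℂ) ^ 2)]
  simp

theorem neg_conj_mem_charDomain (hh : h ∈ charDomain a t) :
    -(starRingEnd ℂ) h ∈ charDomain a t := by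
  refine ⟨by simpa using hh.1, ?_⟩
  rw [normSq_neg_conj_sq_sub_sq, Complex.normSq_neg, Complex.normSq_conj]
  exact hh.2

theorem neg_conj_mem_charCurve (hh : h ∈ charCurve a t) :
    -(starRingEnd ℂ) h ∈ charCurve a t := by
  refine ⟨by simpa using hh.1, ?_⟩
  rw [normSq_neg_conj_sq_sub_sq, Complex.normSq_neg, Complex.normSq_conj]
  exact hh.2

theorem neg_conj_mem_charClosure (hh : h ∈ charClosure a t) :
    -(starRingEnd ℂ) h ∈ charClosure a t := by
  refine ⟨by simpa using hh.1, ?_⟩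
  rw [normSq_neg_conj_sq_sub_sq, Complex.normSq_neg, Complex.normSq_conj]
  exact hh.2

theorem im_firstIntegral_nonneg (ha : a ≠ 0) (ht : 0 ≤ t) (hh : h ∈ charClosure a t)
    (hre : 0 ≤ h.re) : 0 ≤ (firstIntegral a t h).im := by
  obtain ⟨h1, h2⟩ := kappa_mem ha ht hh.2
  rw [firstIntegral_eq_mul_exp ha]
  refine (im_mul_exp_hitExponent ha h1 h2 ?_).1
  rw [im_sq_sub_sq]
  have := mul_nonneg hre hh.1
  linarith

theorem firstIntegral_of_re_eq_zero (ha : a ≠ 0) (ht : 0 ≤ t) (hh : h ∈ charClosure a t)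
    (hre : h.re = 0) : ∃ x : ℝ, firstIntegral a t h = x ∧ x ≤ -a ^ 2 := by
  obtain ⟨-, h2⟩ := kappa_mem ha ht hh.2
  obtain ⟨x, hx, hx', -⟩ := mul_exp_hitExponent_of_re_eq_zero ha h2 hre
  exact ⟨x, by rw [firstIntegral_eq_mul_exp ha, hx], hx'⟩

theorem firstIntegral_of_im_eq_zero (ha : a ≠ 0) (ht : 0 ≤ t) (hh : h ∈ charClosure a t)
    (him : h.im = 0) : ∃ x : ℝ, firstIntegral a t h = x ∧ -a ^ 2 ≤ x := by
  obtain ⟨-, h2⟩ := kappa_mem ha ht hh.2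
  obtain ⟨x, hx, hx'⟩ := mul_exp_hitExponent_of_im_eq_zero ha h2 him
  exact ⟨x, by rw [firstIntegral_eq_mul_exp ha, hx], hx'⟩

theorem re_nonneg_of_firstIntegral (ha : a ≠ 0) (ht : 0 ≤ t) (hh : h ∈ charClosure a t)
    (hre : 0 ≤ h.re) (hz : 0 < z.im) (hE : firstIntegral a t h = z ^ 2 - (a : ℂ) ^ 2) :
    0 ≤ z.re := by
  have := im_firstIntegral_nonneg ha ht hh hre
  rw [hE, im_sq_sub_sq] at this
  exact nonneg_of_mul_nonneg_left (by linarith) hz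

theorem re_nonpos_of_firstIntegral (ha : a ≠ 0) (ht : 0 ≤ t) (hh : h ∈ charClosure a t)
    (hre : h.re ≤ 0) (hz : 0 < z.im) (hE : firstIntegral a t h = z ^ 2 - (a : ℂ) ^ 2) :
    z.re ≤ 0 := by
  have := re_nonneg_of_firstIntegral (z := -(starRingEnd ℂ) z) ha ht
    (neg_conj_mem_charClosure hh) (by simpa using hre) (by simpa using hz)
    (by rw [firstIntegral_neg_conj, hE]; simp)
  simpa using this

theorem hitIntegral_im_pos (ha : a ≠ 0) (hre : 0 < h.re) (him : 0 < h.im) :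
    0 < (hitIntegral a h).im := by
  have hq : 0 < (h ^ 2 - (a : ℂ) ^ 2).im := by
    rw [im_sq_sub_sq]
    positivity
  have := (im_mul_exp_hitExponent ha zero_le_one le_rfl hq.le).2 hq
  simpa [hitIntegral] using this

theorem hitIntegral_im_nonneg (ha : a ≠ 0) (hre : 0 ≤ h.re) (him : 0 ≤ h.im) :
    0 ≤ (hitIntegral a h).im := by
  have hq : 0 ≤ (h ^ 2 - (a : ℂ) ^ 2).im := by
    rw [im_sq_sub_sq]
    positivity
  have := (im_mul_exp_hitExponent ha zero_le_one le_rfl hq).1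
  simpa [hitIntegral] using this

/-- The point of the closed first quadrant from which the Loewner trajectory hits the real line
with characteristic coordinate `h`. -/
def hitPoint (a : ℝ) (h : ℂ) : ℂ := upperSqrt ((a : ℂ) ^ 2 + hitIntegral a h)

theorem hitPoint_sq (a : ℝ) (h : ℂ) : hitPoint a h ^ 2 - (a : ℂ) ^ 2 = hitIntegral a h := by
  rw [hitPoint, upperSqrt_sq]
  ring

theorem im_add_sq (a : ℝ) (x : ℂ) : ((a : ℂ) ^ 2 + x).im = x.im := by
  rw [Complex.add_im, ← Complex.ofReal_pow, Complex.ofReal_im, zero_add]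

theorem hitPoint_re_nonneg (ha : a ≠ 0) (hre : 0 ≤ h.re) (him : 0 ≤ h.im) :
    0 ≤ (hitPoint a h).re := by
  apply upperSqrt_re_nonneg
  rw [im_add_sq]
  exact hitIntegral_im_nonneg ha hre him

theorem hitPoint_im_nonneg (a : ℝ) (h : ℂ) : 0 ≤ (hitPoint a h).im := upperSqrt_im_nonneg _

/-- A real hitting point would make `hitIntegral a h` real and at least $-a^2$. The phase estimate
excludes this for $\operatorname{Re}h>0$, the strict bound on the imaginary axis for
$\operatorname{Re}h=0$. -/
theorem hitPoint_im_pos (ha : a ≠ 0) (hre : 0 ≤ h.re) (him : 0 < h.im) :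
    0 < (hitPoint a h).im := by
  refine (hitPoint_im_nonneg a h).lt_of_ne fun h0 => ?_
  have hsq := hitPoint_sq a h
  rcases hre.eq_or_lt with hre | hre
  · obtain ⟨x, hx, -, hx'⟩ :=
      mul_exp_hitExponent_of_re_eq_zero ha (le_refl (1 : ℝ)) hre.symm
    have hx' := hx' him.ne'
    rw [Complex.ofReal_one, one_mul, ← hitIntegral, ← hsq] at hx
    have := congrArg Complex.re hx
    simp only [Complex.sub_re, Complex.ofReal_re, pow_two, Complex.mul_re,
      ← h0] at this
    nlinarith [sq_nonneg (hitPoint a h).re]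
  · have := hitIntegral_im_pos ha hre him
    rw [← hsq, im_sq_sub_sq, ← h0] at this
    simp at this

theorem continuousOn_hitPoint (ha : a ≠ 0) :
    ContinuousOn (hitPoint a) {h | 0 ≤ h.re ∧ 0 ≤ h.im} := by
  refine continuousOn_upperSqrt.comp
    (continuous_const.add (continuous_hitIntegral ha)).continuousOn fun h hh => ?_
  rw [Set.mem_ofPred_eq, im_add_sq]
  exact hitIntegral_im_nonneg ha hh.1 hh.2

/-! The real algebra of the hitting curve. -/

theorem charCurve_zero (hh : h ∈ charCurve a 0) : h ^ 2 - (a : ℂ) ^ 2 = 0 := by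
  have := hh.2
  simp only [mul_zero, zero_mul] at this
  exact Complex.normSq_eq_zero.1 this.symm

/-- With $q=h^2-a^2$ and $N=|h|^2+a^2$ the curve is $4tN=q\bar q$, so $4th/q=h\bar q/N$, and $N+\bar
q=\bar h(h+\bar h)$. The case $q=0$ forces $t=0$ and `h` real. -/
theorem charMap_of_mem_charCurve (ha : a ≠ 0) (hh : h ∈ charCurve a t) :
    charMap a t h = ((2 * h.re * Complex.normSq h / (Complex.normSq h + a ^ 2) : ℝ) : ℂ) := by
  have hN : ((Complex.normSq h + a ^ 2 : ℝ) : ℂ) ≠ 0 := by exact_mod_cast (weight_pos ha h).ne'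
  have hP : (Complex.normSq h : ℂ) = h * (starRingEnd ℂ) h := by rw [Complex.mul_conj]
  have hv : ((2 * h.re : ℝ) : ℂ) = h + (starRingEnd ℂ) h := by
    rw [Complex.add_conj]
  have hC := congrArg (fun x : ℝ => (x : ℂ)) hh.2
  simp only [Complex.normSq_eq_conj_mul_self (z := h ^ 2 - (a : ℂ) ^ 2)] at hC
  rw [Complex.ofReal_div, eq_div_iff hN, Complex.ofReal_mul, hv, hP]
  rcases eq_or_ne (h ^ 2 - (a : ℂ) ^ 2) 0 with hq | hq
  · rw [hq, mul_zero] at hC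
    have hC' : (4 * t : ℂ) = 0 := by
      have := (mul_eq_zero.1 (by exact_mod_cast hC : 4 * t * (Complex.normSq h + a ^ 2) = 0))
      exact_mod_cast this.resolve_right (weight_pos ha h).ne'
    have ht0 : (t : ℂ) = 0 := by linear_combination hC' / 4
    have ha2 : (a : ℂ) ^ 2 = h ^ 2 := by linear_combination -hq
    have hc2 : (starRingEnd ℂ) h ^ 2 = (a : ℂ) ^ 2 := by
      have := congrArg (starRingEnd ℂ) ha2
      simp only [map_pow, Complex.conj_ofReal] at this
      exact this.symm
    have him : (starRingEnd ℂ) h = h := by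
      have : h.im = 0 := by
        by_contra h0
        exact sq_sub_sq_ne_zero_of_im h0 hq
      exact Complex.conj_eq_iff_im.2 this
    rw [charMap, ht0, him]
    push_cast
    rw [hP, him, ha2]
    ring
  · apply mul_right_cancel₀ hq
    have e : charMap a t h * ((Complex.normSq h + a ^ 2 : ℝ) : ℂ) * (h ^ 2 - (a : ℂ) ^ 2)
        = (charMap a t h * (h ^ 2 - (a : ℂ) ^ 2)) * ((Complex.normSq h + a ^ 2 : ℝ) : ℂ) := by ring
    rw [e, charMap_mul hq]
    push_cast at hC ⊢
    simp only [map_sub, map_pow, Complex.conj_ofReal] at hC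
    rw [hP] at hC ⊢
    linear_combination h * hC

theorem normSq_sq_sub_sq (a : ℝ) (h : ℂ) : Complex.normSq (h ^ 2 - (a : ℂ) ^ 2)
    = ((h.re - a) ^ 2 + h.im ^ 2) * ((h.re + a) ^ 2 + h.im ^ 2) := by
  simp [Complex.normSq_apply, pow_two]
  ring

theorem normSq_sq_sub_sq' (a : ℝ) (h : ℂ) : Complex.normSq (h ^ 2 - (a : ℂ) ^ 2)
    = (Complex.normSq h + a ^ 2) ^ 2 - 4 * h.re ^ 2 * a ^ 2 := by
  rw [normSq_sq_sub_sq, Complex.normSq_apply]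
  ring

/-- With $A,B=|h\mp a|^2$ the curve is $2t(A+B)=AB$, and $4AB\le(A+B)^2$ gives $8t\le A+B$. Moving
up adds some $d>0$ to both $A$ and $B$, and the right side gains $d(A+B)+d^2$ against $4td$ on the
left. -/
theorem add_mul_I_mem_charDomain (ha : a ≠ 0) (ht : 0 ≤ t) (hh : h ∈ charCurve a t) {ε : ℝ}
    (hε : 0 < ε) : h + ε * Complex.I ∈ charDomain a t := by
  obtain ⟨h0, h1⟩ := hh
  have hre : (h + ε * Complex.I).re = h.re := by simp
  have him : (h + ε * Complex.I).im = h.im + ε := by simp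
  refine ⟨by rw [him]; linarith, ?_⟩
  rw [normSq_sq_sub_sq] at h1 ⊢
  rw [Complex.normSq_apply] at h1 ⊢
  rw [hre, him]
  set A := (h.re - a) ^ 2 + h.im ^ 2 with hA
  set B := (h.re + a) ^ 2 + h.im ^ 2 with hB
  set d := 2 * h.im * ε + ε ^ 2 with hd
  have hdpos : 0 < d := by positivity
  have hAB : 0 < A + B := by
    have : A + B = 2 * (h.re ^ 2 + h.im ^ 2 + a ^ 2) := by rw [hA, hB]; ring
    rw [this]; positivity
  have h1' : 2 * t * (A + B) = A * B := by rw [← h1, hA, hB]; ring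
  have h8 : 8 * t ≤ A + B := by
    have : 8 * t * (A + B) ≤ (A + B) * (A + B) := by nlinarith [sq_nonneg (A - B)]
    exact le_of_mul_le_mul_right this hAB
  have e1 : 4 * t * (h.re * h.re + (h.im + ε) * (h.im + ε) + a ^ 2) = 2 * t * (A + B + 2 * d) := by
    rw [hA, hB, hd]; ring
  have e2 : ((h.re - a) ^ 2 + (h.im + ε) ^ 2) * ((h.re + a) ^ 2 + (h.im + ε) ^ 2)
      = (A + d) * (B + d) := by rw [hA, hB, hd]; ring
  rw [e1, e2]
  nlinarith [mul_le_mul_of_nonneg_left h8 hdpos.le, sq_pos_of_pos hdpos, mul_nonneg ht hdpos.le]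

/-- The boundary point of `charDomain` mapped to a given point of the hitting curve's image lies
on the hitting curve. -/
theorem mem_charCurve_of_charMap_eq (ha : a ≠ 0) (ht : 0 ≤ t) (hh : h ∈ charClosure a t)
    (hh' : h' ∈ charCurve a t) (heq : charMap a t h = charMap a t h') : h ∈ charCurve a t := by
  rcases ht.eq_or_lt with rfl | ht
  · have : h = h' := by simpa [charMap] using heq
    rwa [this]
  rcases hh.2.eq_or_lt with hC | hlt
  · exact ⟨hh.1, hC⟩
  exfalso
  have hq := sq_sub_sq_ne_zero ha ht hh.2
  have hqpos := Complex.normSq_pos.2 hq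
  have hN := weight_pos ha h
  have hN' := weight_pos ha h'
  rw [charMap_of_mem_charCurve ha hh'] at heq
  set N' := Complex.normSq h' + a ^ 2 with hN'def
  set σ := 2 * h'.re * Complex.normSq h' / N' with hσ
  have him : h.im = 0 := by
    have e := im_charMap a t h
    rw [heq, Complex.ofReal_im] at e
    have : 1 - 4 * t * (Complex.normSq h + a ^ 2) / Complex.normSq (h ^ 2 - (a : ℂ) ^ 2) ≠ 0 := by
      rw [sub_ne_zero]
      exact ((div_lt_one hqpos).2 hlt).ne'
    exact (mul_eq_zero.1 e.symm).resolve_right this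
  set x := h.re
  have hx : h = (x : ℂ) := Complex.ext (by simp [x]) (by simp [him])
  have hcubic : x ^ 3 - σ * x ^ 2 + (4 * t - a ^ 2) * x + a ^ 2 * σ = 0 := by
    have e := charMap_mul (t := t) hq
    rw [heq, hx] at e
    have : ((x ^ 3 - σ * x ^ 2 + (4 * t - a ^ 2) * x + a ^ 2 * σ : ℝ) : ℂ) = 0 := by
      push_cast
      linear_combination -e
    exact_mod_cast this
  have hlt' : 4 * t * (x ^ 2 + a ^ 2) < (x ^ 2 - a ^ 2) ^ 2 := by
    rw [normSq_sq_sub_sq, Complex.normSq_apply, him] at hlt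
    simp only [mul_zero, add_zero] at hlt
    calc 4 * t * (x ^ 2 + a ^ 2) = 4 * t * (h.re * h.re + a ^ 2) := by simp only [x]; ring
      _ < _ := hlt
      _ = _ := by simp only [x]; ring
  have hC := hh'.2
  rw [normSq_sq_sub_sq', ← hN'def] at hC
  set v := h'.re
  have hP : Complex.normSq h' = v ^ 2 + h'.im ^ 2 := by rw [Complex.normSq_apply]; ring
  have ha2 : 0 < a ^ 2 := by positivity
  -- the third root of the cubic
  set r := -(2 * v * a ^ 2) / N' with hr
  have hrN : r * N' = -(2 * v * a ^ 2) := by rw [hr]; field_simp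
  have hσN : σ * N' = 2 * v * Complex.normSq h' := by rw [hσ]; field_simp
  have hσr : σ = r + 2 * v := by
    apply mul_right_cancel₀ hN'.ne'
    rw [hσN, add_mul, hrN, hN'def]
    ring
  have h4t : 4 * t * a ^ 2 = N' * (a ^ 2 - r ^ 2) := by
    apply mul_right_cancel₀ hN'.ne'
    linear_combination a ^ 2 * hC + (r * N' - 2 * v * a ^ 2) * hrN
  -- The roots of the cubic over the real point `σ` are `h'`, its conjugate and `r`; `x` must be one
  -- of them.
  have hfac : (x - r) * ((x - v) ^ 2 + h'.im ^ 2) = 0 := by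
    have e1 : (4 * t - a ^ 2 - Complex.normSq h' - 2 * v * r) = 0 := by
      apply mul_right_cancel₀ (mul_pos hN' ha2).ne'
      have : Complex.normSq h' = N' - a ^ 2 := by rw [hN'def]; ring
      rw [this]
      linear_combination N' * h4t - (r * N' + 0) * hrN
    have e2 : a ^ 2 * σ + r * Complex.normSq h' = 0 := by
      have : Complex.normSq h' = N' - a ^ 2 := by rw [hN'def]; ring
      rw [this, hσr]
      linear_combination hrN
    rw [hP] at e1 e2
    rw [hσr] at hcubic
    rw [hσr] at e2
    linear_combination hcubic - x * e1 - e2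
  rcases mul_eq_zero.1 hfac with h0 | h0
  -- The third root lies strictly outside `charClosure`: $4ta^2=N'(a^2-r^2)$ and $N'\ge a^2$ give
  -- $4t(r^2+a^2)\ge a^4-r^4\ge(r^2-a^2)^2$.
  · have hxr : x = r := sub_eq_zero.1 h0
    rw [hxr] at hlt'
    have hpos : 0 < a ^ 2 - r ^ 2 := by
      have : 0 < N' * (a ^ 2 - r ^ 2) := by rw [← h4t]; positivity
      exact pos_of_mul_pos_right this hN'.le
    have hNa : a ^ 2 ≤ N' := by
      rw [hN'def]
      linarith [Complex.normSq_nonneg h']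
    have h5 : a ^ 2 * (4 * t * (r ^ 2 + a ^ 2)) < a ^ 2 * (r ^ 2 - a ^ 2) ^ 2 := by gcongr
    have h6 : a ^ 2 * (4 * t * (r ^ 2 + a ^ 2)) = N' * (a ^ 2 - r ^ 2) * (r ^ 2 + a ^ 2) := by
      rw [← h4t]; ring
    have h7 : a ^ 2 * (a ^ 2 - r ^ 2) * (r ^ 2 + a ^ 2) ≤ N' * (a ^ 2 - r ^ 2) * (r ^ 2 + a ^ 2) := by
      gcongr
    nlinarith [mul_nonneg (mul_nonneg ha2.le hpos.le) (sq_nonneg r)]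
  · have hv0 : (x - v) ^ 2 = 0 := by nlinarith [sq_nonneg (x - v), sq_nonneg h'.im]
    have hw0 : h'.im ^ 2 = 0 := by nlinarith [sq_nonneg (x - v), sq_nonneg h'.im]
    have hxv : x = v := sub_eq_zero.1 (pow_eq_zero_iff two_ne_zero |>.1 hv0)
    have : h = h' := Complex.ext hxv
      (by rw [him]; exact (pow_eq_zero_iff two_ne_zero |>.1 hw0).symm)
    rw [this] at hlt
    exact hlt.ne hh'.2

end HittingCurve

/-! ### The support of the hydrodynamic limit -/

section Support

variable {a t : ℝ} {h z : ℂ} {μ : ℝ → ProbabilityMeasure ℝ}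

theorem mul_norm_initialGreen_le (ht : 0 ≤ t) (hh : h ∈ charClosure a t) :
    t * ‖initialGreen a h‖ ≤ √t := by
  apply Real.le_sqrt_of_sq_le
  calc (t * ‖initialGreen a h‖) ^ 2 = t * (t * ‖initialGreen a h‖ ^ 2) := by ring
    _ ≤ t * 1 := by gcongr; exact mul_norm_initialGreen_sq_le ht hh.2
    _ = t := mul_one t

theorem norm_sub_charMap_le (ht : 0 ≤ t) (hh : h ∈ charClosure a t) :
    ‖charMap a t h - h‖ ≤ 2 * √t := by
  rw [charMap, add_sub_cancel_left, norm_mul, norm_mul, Complex.norm_two, Complex.norm_real,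
    Real.norm_of_nonneg ht]
  linarith [mul_norm_initialGreen_le ht hh]

theorem norm_le_norm_charMap_add (ht : 0 ≤ t) (hh : h ∈ charClosure a t) :
    ‖h‖ ≤ ‖charMap a t h‖ + 2 * √t := by
  have := norm_sub_norm_le h (charMap a t h)
  rw [norm_sub_rev] at this
  linarith [norm_sub_charMap_le ht hh]

/-- Thus $-\operatorname{Im}M_t/\operatorname{Im}z$ can blow up at bounded `h` only where the gap in
the inequality of `charDomain` closes. -/
theorem neg_im_green_mul (hμ : IsHydrodynamicLimit (twoSources a) μ) (ht : 0 ≤ t)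
    (hh : h ∈ charDomain a t) :
    -(green μ t (charMap a t h)).im
      * (Complex.normSq (h ^ 2 - (a : ℂ) ^ 2) - 4 * t * (Complex.normSq h + a ^ 2))
      = 2 * (Complex.normSq h + a ^ 2) * (charMap a t h).im := by
  have hq := Complex.normSq_pos.2 (sq_sub_sq_ne_zero_of_im (a := a) hh.1.ne')
  rw [hμ.green_charMap ht hh, im_initialGreen, im_charMap]
  field_simp

/-- Away from the image of the hitting curve, the density of `μ_t` vanishes. -/
theorem exists_neg_im_green_le (hμ : IsHydrodynamicLimit (twoSources a) μ) (ht : 0 ≤ t) {x : ℝ}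
    (hx : ∀ h ∈ charCurve a t, charMap a t h ≠ x) (ha : a ≠ 0) :
    ∃ C : ℝ, ∃ δ > 0, ∀ z : ℂ, 0 < z.im → ‖z - x‖ < δ →
      -(green μ t z).im ≤ C * z.im := by
  set R : ℝ := |x| + 1 + 2 * √t
  set S : Set ℂ := charClosure a t ∩ Metric.closedBall 0 R
  have hS : IsCompact S := (isCompact_closedBall 0 R).inter_left (isClosed_charClosure a t)
  -- Both terms are non-negative on `S` and vanish together only at a curve point over `x`, which
  -- `hx` excludes. A positive minimum `c` then leaves a gap of at least `c / 2` for images within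
  -- `c / 2` of `x`.
  let ψ : ℂ → ℝ := fun h => ‖charMap a t h - x‖
    + (Complex.normSq (h ^ 2 - (a : ℂ) ^ 2) - 4 * t * (Complex.normSq h + a ^ 2))
  have hψc : ContinuousOn ψ S := by
    intro h hh
    have h0 := continuousAt_charMap ha ht hh.1
    have h1 : Continuous fun h : ℂ => 4 * t * (Complex.normSq h + a ^ 2) :=
      continuous_const.mul (Complex.continuous_normSq.add continuous_const)
    have h2 : Continuous fun h : ℂ => Complex.normSq (h ^ 2 - (a : ℂ) ^ 2) :=
      Complex.continuous_normSq.comp (by fun_prop)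
    exact (((h0.sub continuousAt_const).norm).add
      (h2.sub h1).continuousAt).continuousWithinAt
  have hψpos : ∀ h ∈ S, 0 < ψ h := by
    intro h hh
    have h1 := sub_nonneg.2 hh.1.2
    have h2 := norm_nonneg (charMap a t h - x)
    refine (add_nonneg h2 h1).lt_of_ne fun h0 => ?_
    have h3 := (add_eq_zero_iff_of_nonneg h2 h1).1 h0.symm
    exact hx h ⟨hh.1.1, (sub_eq_zero.1 h3.2).symm⟩ (sub_eq_zero.1 (norm_eq_zero.1 h3.1))
  obtain ⟨c, hc, hcψ⟩ : ∃ c > 0, ∀ h ∈ S, c ≤ ψ h := by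
    rcases S.eq_empty_or_nonempty with hE | hne
    · exact ⟨1, one_pos, by simp [hE]⟩
    · obtain ⟨h, hh, hmin⟩ := hS.exists_isMinOn hne hψc
      exact ⟨ψ h, hψpos h hh, fun k hk => hmin hk⟩
  refine ⟨2 * (R ^ 2 + a ^ 2) / (c / 2), min (c / 2) 1, by positivity,
    fun z hz hzx => ?_⟩
  obtain ⟨h, hh, rfl⟩ := exists_charMap_eq (a := a) (t := t) hz
  have hzx1 := hzx.trans_le (min_le_left _ _)
  have hzx2 := hzx.trans_le (min_le_right _ _)
  have hhc := charDomain_subset_charClosure hh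
  have hhR : ‖h‖ ≤ R := by
    have h1 := norm_le_norm_charMap_add ht hhc
    have h2 := norm_sub_norm_le (charMap a t h) x
    rw [Complex.norm_real, Real.norm_eq_abs] at h2
    simp only [R]
    linarith
  have hψ := hcψ h ⟨hhc, by simpa using hhR⟩
  have hgap : c / 2 ≤ Complex.normSq (h ^ 2 - (a : ℂ) ^ 2)
      - 4 * t * (Complex.normSq h + a ^ 2) := by
    simp only [ψ] at hψ
    linarith
  have hmul := neg_im_green_mul hμ ht hh
  have hM := im_green_nonpos (μ := μ) (t := t) hz
  have hN : Complex.normSq h ≤ R ^ 2 := by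
    rw [← Complex.sq_norm]
    gcongr
  rw [div_mul_eq_mul_div, le_div_iff₀ (by positivity)]
  calc -(green μ t (charMap a t h)).im * (c / 2)
      ≤ -(green μ t (charMap a t h)).im * (Complex.normSq (h ^ 2 - (a : ℂ) ^ 2)
        - 4 * t * (Complex.normSq h + a ^ 2)) := by gcongr; linarith
    _ = 2 * (Complex.normSq h + a ^ 2) * (charMap a t h).im := hmul
    _ ≤ 2 * (R ^ 2 + a ^ 2) * (charMap a t h).im := by gcongr

/-- The kernel $2y/((x-u)^2+y^2)$ is at least $1/y$ for $|u-x|\le y$; apply Markov's inequality. -/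
theorem measureReal_Icc_le {C y x : ℝ} (hy : 0 < y)
    (hC : -(green μ t ⟨x, y⟩).im ≤ C * y) :
    (μ t : Measure ℝ).real (Set.Icc (x - y) (x + y)) ≤ C * y ^ 2 := by
  have hz : (⟨x, y⟩ : ℂ).im ≠ 0 := hy.ne'
  rw [neg_im_green hz] at hC
  have h := mul_meas_ge_le_integral_of_nonneg
    (ae_of_all _ fun u : ℝ => by positivity) (integrable_poisson (μ t : Measure ℝ) hz) (1 / y)
  have hsub : Set.Icc (x - y) (x + y)
      ⊆ {u : ℝ | 1 / y ≤ 2 * (⟨x, y⟩ : ℂ).im / ‖(⟨x, y⟩ : ℂ) - u‖ ^ 2} := by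
    intro u hu
    have h1 : (x - u) ^ 2 ≤ y ^ 2 := by nlinarith [hu.1, hu.2]
    have h2 : ‖(⟨x, y⟩ : ℂ) - u‖ ^ 2 = (x - u) ^ 2 + y ^ 2 := by
      rw [Complex.sq_norm, Complex.normSq_apply]
      simp
      ring
    have h3 : 0 < (x - u) ^ 2 + y ^ 2 := by positivity
    rw [Set.mem_ofPred_eq, h2, div_le_div_iff₀ hy h3]
    change 1 * ((x - u) ^ 2 + y ^ 2) ≤ 2 * y * y
    nlinarith
  have h4 : 1 / y * (μ t : Measure ℝ).real (Set.Icc (x - y) (x + y)) ≤ C * y :=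
    (mul_le_mul_of_nonneg_left (measureReal_mono hsub) (by positivity)).trans (h.trans hC)
  rw [div_mul_eq_mul_div, one_mul, div_le_iff₀ hy] at h4
  linarith

/-- A finite measure charging every interval of radius `y` at most by `C y²` vanishes. -/
theorem measure_Icc_eq_zero_of_sq_bound {ν : Measure ℝ} [IsFiniteMeasure ν] {C x d : ℝ}
    (hd : 0 < d) (hν : ∀ x' y : ℝ, |x' - x| ≤ d → 0 < y → y ≤ d →
      ν.real (Set.Icc (x' - y) (x' + y)) ≤ C * y ^ 2) :
    ν (Set.Icc (x - d) (x + d)) = 0 := by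
  -- Cover by $n+1$ intervals of radius $2d/n$; $n\ge2$ keeps the radius at most `d`. The total is
  -- $O(1/n)$.
  have hbound : ∀ n : ℕ, 2 ≤ n →
      ν.real (Set.Icc (x - d) (x + d)) ≤ (n + 1 : ℕ) * (C * (2 * d / n) ^ 2) := by
    intro n hn
    have hn0 : (0 : ℝ) < n := by positivity
    have hn2 : (2 : ℝ) ≤ n := by exact_mod_cast hn
    set y := 2 * d / n with hy
    have hy0 : 0 < y := by positivity
    have hyn : y * n = 2 * d := by rw [hy]; field_simp
    have hcover : Set.Icc (x - d) (x + d)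
        ⊆ ⋃ k ∈ Finset.range (n + 1), Set.Icc (x - d + k * y - y) (x - d + k * y + y) := by
      intro u hu
      have h0 : 0 ≤ (u - (x - d)) / y := div_nonneg (by linarith [hu.1]) hy0.le
      have h1 := Nat.floor_le h0
      have h2 := Nat.lt_floor_add_one ((u - (x - d)) / y)
      rw [le_div_iff₀ hy0] at h1
      rw [div_lt_iff₀ hy0] at h2
      have hk : ⌊(u - (x - d)) / y⌋₊ < n + 1 := by
        have : (⌊(u - (x - d)) / y⌋₊ : ℝ) ≤ n := by
          apply le_of_mul_le_mul_right _ hy0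
          linarith [hu.2]
        exact Nat.lt_succ_of_le (by exact_mod_cast this)
      simp only [Set.mem_iUnion]
      exact ⟨_, Finset.mem_range.2 hk, by linarith, by linarith⟩
    calc ν.real (Set.Icc (x - d) (x + d))
        ≤ ν.real (⋃ k ∈ Finset.range (n + 1),
            Set.Icc (x - d + k * y - y) (x - d + k * y + y)) := measureReal_mono hcover (measure_ne_top _ _)
      _ ≤ ∑ k ∈ Finset.range (n + 1), ν.real (Set.Icc (x - d + k * y - y) (x - d + k * y + y)) :=
          measureReal_biUnion_finset_le _ _
      _ ≤ ∑ k ∈ Finset.range (n + 1), C * y ^ 2 := by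
          refine Finset.sum_le_sum fun k hk => hν _ _ ?_ hy0 ?_
          · have hk' : (k : ℝ) ≤ n := by exact_mod_cast Nat.lt_succ_iff.1 (Finset.mem_range.1 hk)
            have : k * y ≤ 2 * d := by
              rw [← hyn, mul_comm]
              gcongr
            rw [abs_le]
            constructor <;> nlinarith [(Nat.cast_nonneg k : (0 : ℝ) ≤ k)]
          · rw [hy, div_le_iff₀ hn0]
            nlinarith
      _ = (n + 1 : ℕ) * (C * y ^ 2) := by simp
  have hlim : Tendsto (fun n : ℕ => ((n + 1 : ℕ) : ℝ) * (C * (2 * d / n) ^ 2)) atTop (𝓝 0) := by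
    have h1 : Tendsto (fun n : ℕ => 1 / (n : ℝ)) atTop (𝓝 0) := tendsto_one_div_atTop_nhds_zero_nat
    have h2 := ((h1.add (h1.pow 2)).mul_const (4 * C * d ^ 2))
    simp only [ne_eq, OfNat.ofNat_ne_zero, not_false_eq_true, zero_pow, add_zero, zero_mul] at h2
    refine h2.congr' ?_
    filter_upwards [eventually_gt_atTop 0] with n hn
    have : (n : ℝ) ≠ 0 := by positivity
    push_cast
    field_simp
    ring
  have h0 : ν.real (Set.Icc (x - d) (x + d)) ≤ 0 :=
    ge_of_tendsto hlim (by filter_upwards [eventually_ge_atTop 2] with n hn using hbound n hn)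
  exact (measureReal_eq_zero_iff).1 (le_antisymm h0 measureReal_nonneg)

theorem notMem_support_of_forall_ne (hμ : IsHydrodynamicLimit (twoSources a) μ) (ht : 0 ≤ t)
    {x : ℝ} (hx : ∀ h ∈ charCurve a t, charMap a t h ≠ x) (ha : a ≠ 0) :
    x ∉ (μ t : Measure ℝ).support := by
  obtain ⟨C, δ, hδ, hCδ⟩ := exists_neg_im_green_le hμ ht hx ha
  rw [Measure.notMem_support_iff_exists]
  refine ⟨Set.Icc (x - δ / 3) (x + δ / 3), Icc_mem_nhds (by linarith) (by linarith),
    measure_Icc_eq_zero_of_sq_bound (C := C) (by positivity) fun x' y hx' hy hy' => ?_⟩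
  refine measureReal_Icc_le hy (hCδ ⟨x', y⟩ hy ?_)
  have h1 := Complex.norm_le_abs_re_add_abs_im ((⟨x', y⟩ : ℂ) - x)
  simp only [Complex.sub_re, Complex.ofReal_re, Complex.sub_im, Complex.ofReal_im, sub_zero,
    abs_of_pos hy] at h1
  linarith

theorem charMap_sub_charMap {k : ℂ} (hq : h ^ 2 - (a : ℂ) ^ 2 ≠ 0) (hq' : k ^ 2 - (a : ℂ) ^ 2 ≠ 0) :
    charMap a t k - charMap a t h = (k - h) * (1 - 4 * t * (k * h + (a : ℂ) ^ 2)
      / ((k ^ 2 - (a : ℂ) ^ 2) * (h ^ 2 - (a : ℂ) ^ 2))) := by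
  rw [charMap, charMap, initialGreen, initialGreen]
  field_simp
  ring

theorem tendsto_add_mul_I (h : ℂ) :
    Tendsto (fun ε : ℝ => h + ε * Complex.I) (𝓝[>] 0) (𝓝 h) := by
  have : ContinuousAt (fun ε : ℝ => h + ε * Complex.I) 0 := by fun_prop
  simpa [ContinuousAt] using this.tendsto.mono_left nhdsWithin_le_nhds

/-- If $\mu_t$ had no mass near `x`, then `charInv μ t` would be Lipschitz at `x` and real there.
Letting $\varepsilon\to0$ at $h+i\varepsilon$ identifies `charInv μ t x` with `h`, so `h` is real.
For real `h` the curve equation says that the derivative of `charMap a t` vanishes, which a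
Lipschitz inverse forbids. -/
theorem mem_support_of_mem_charCurve (hμ : IsHydrodynamicLimit (twoSources a) μ) (ht : 0 < t)
    {x : ℝ} (hh : h ∈ charCurve a t) (hx : charMap a t h = x) (ha : a ≠ 0) :
    x ∈ (μ t : Measure ℝ).support := by
  by_contra hns
  obtain ⟨U, hU, hU0⟩ := Measure.notMem_support_iff_exists.1 hns
  obtain ⟨d, hd, hdU⟩ := Metric.mem_nhds_iff.1 hU
  have hball : ∀ᵐ u : ℝ ∂(μ t : Measure ℝ), d ≤ |u - x| := by
    have h0 : (μ t : Measure ℝ) (Metric.ball x d) = 0 := measure_mono_null hdU hU0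
    filter_upwards [compl_mem_ae_iff.2 h0] with u hu
    simpa [Real.dist_eq] using hu
  have hnear : ∀ z : ℂ, ‖z - x‖ ≤ d / 2 → ∀ᵐ u : ℝ ∂(μ t : Measure ℝ), d / 2 ≤ ‖z - u‖ := by
    intro z hz
    filter_upwards [hball] with u hu
    have h1 : ‖((u : ℂ) - x)‖ = |u - x| := by
      rw [← Complex.ofReal_sub, Complex.norm_real, Real.norm_eq_abs]
    have h2 : ‖((u : ℂ) - x)‖ ≤ ‖(u : ℂ) - z‖ + ‖z - x‖ := norm_sub_le_norm_sub_add_norm_sub _ _ _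
    rw [norm_sub_rev (u : ℂ) z] at h2
    linarith
  have hd2 : 0 < d / 2 := by positivity
  set L := 1 + 2 * t * (2 / (d / 2 * (d / 2)))
  have hLip : ∀ z : ℂ, ‖z - x‖ ≤ d / 2 → ‖charInv μ t z - charInv μ t x‖ ≤ L * ‖z - x‖ := by
    intro z hz
    have hx' := hnear x (by simpa using hd2.le)
    have e : charInv μ t z - charInv μ t x = (z - x) * (1 + 2 * t * greenSlope μ t z x) := by
      rw [charInv, charInv]
      linear_combination -2 * t * green_sub_green_of_ae hd2 hd2 (hnear z hz) hx'
    rw [e, norm_mul, mul_comm]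
    gcongr
    refine (norm_add_le _ _).trans ?_
    rw [norm_one, norm_mul, norm_mul, Complex.norm_two, Complex.norm_real,
      Real.norm_of_nonneg ht.le]
    simp only [L]
    gcongr
    exact norm_greenSlope_le hd2 hd2 (hnear z hz) hx'
  have hhc := charCurve_subset_charClosure hh
  have hlimk := tendsto_add_mul_I h
  have hlimz : Tendsto (fun ε : ℝ => charMap a t (h + ε * Complex.I)) (𝓝[>] 0) (𝓝 (x : ℂ)) := by
    rw [← hx]
    exact (continuousAt_charMap ha ht.le hhc).tendsto.comp hlimk
  have hzx : Tendsto (fun ε : ℝ => ‖charMap a t (h + ε * Complex.I) - x‖) (𝓝[>] 0) (𝓝 0) :=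
    tendsto_iff_norm_sub_tendsto_zero.1 hlimz
  have hev : ∀ᶠ ε : ℝ in 𝓝[>] 0, ‖charMap a t (h + ε * Complex.I) - x‖ ≤ d / 2 :=
    hzx.eventually (Iic_mem_nhds hd2)
  have hbd : ∀ᶠ ε : ℝ in 𝓝[>] 0, ‖h + ε * Complex.I - charInv μ t x‖
      ≤ L * ‖charMap a t (h + ε * Complex.I) - x‖ := by
    filter_upwards [hev, self_mem_nhdsWithin] with ε hε hε0
    have := hLip _ hε
    rwa [hμ.charInv_charMap ht.le (add_mul_I_mem_charDomain ha ht.le hh hε0)] at this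
  have hhx : charInv μ t x = h := by
    have h1 : Tendsto (fun ε : ℝ => h + ε * Complex.I) (𝓝[>] 0) (𝓝 (charInv μ t x)) := by
      rw [tendsto_iff_norm_sub_tendsto_zero]
      refine squeeze_zero' (Eventually.of_forall fun _ => norm_nonneg _) hbd ?_
      simpa using hzx.const_mul L
    exact tendsto_nhds_unique h1 hlimk
  have him : h.im = 0 := by
    have hg : (green μ t x).im = 0 := by
      have := integral_im (𝕜 := ℂ) (integrable_green_of_ae hd2 (hnear x (by simpa using hd2.le)))
      rw [green, ← RCLike.im_to_complex, ← this]
      simp [im_two_div]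
    rw [← hhx, charInv, Complex.sub_im, Complex.ofReal_im,
      show (2 : ℂ) * t = ((2 * t : ℝ) : ℂ) by push_cast; ring, Complex.im_ofReal_mul, hg]
    simp
  have hq := sq_sub_sq_ne_zero ha ht hhc.2
  -- the derivative of `charMap a t` vanishes at `h`
  have hfac : 1 - 4 * t * (h * h + (a : ℂ) ^ 2)
      / ((h ^ 2 - (a : ℂ) ^ 2) * (h ^ 2 - (a : ℂ) ^ 2)) = 0 := by
    have hconj : (starRingEnd ℂ) h = h := Complex.conj_eq_iff_im.2 him
    have hC := congrArg (fun x : ℝ => (x : ℂ)) hh.2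
    simp only [Complex.ofReal_mul, Complex.ofReal_add, Complex.normSq_eq_conj_mul_self, map_sub,
      map_pow, Complex.conj_ofReal, hconj] at hC
    push_cast at hC
    rw [hC, div_self (mul_ne_zero hq hq), sub_self]
  have hlimfac : Tendsto (fun ε : ℝ => L * ‖1 - 4 * t * ((h + ε * Complex.I) * h + (a : ℂ) ^ 2)
      / (((h + ε * Complex.I) ^ 2 - (a : ℂ) ^ 2) * (h ^ 2 - (a : ℂ) ^ 2))‖) (𝓝[>] 0) (𝓝 0) := by
    have hc : ContinuousAt (fun k : ℂ => L * ‖1 - 4 * t * (k * h + (a : ℂ) ^ 2)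
      / ((k ^ 2 - (a : ℂ) ^ 2) * (h ^ 2 - (a : ℂ) ^ 2))‖) h := by
      have := mul_ne_zero hq hq
      fun_prop (disch := assumption)
    have := hc.tendsto.comp hlimk
    rw [hfac, norm_zero, mul_zero] at this
    exact this
  have hone : ∀ᶠ ε : ℝ in 𝓝[>] 0,
      1 ≤ L * ‖1 - 4 * t * ((h + ε * Complex.I) * h + (a : ℂ) ^ 2)
      / (((h + ε * Complex.I) ^ 2 - (a : ℂ) ^ 2) * (h ^ 2 - (a : ℂ) ^ 2))‖ := by
    filter_upwards [hbd, self_mem_nhdsWithin] with ε hε hε0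
    have hdom := add_mul_I_mem_charDomain ha ht.le hh hε0
    rw [hhx, ← hx, charMap_sub_charMap hq (sq_sub_sq_ne_zero_of_im hdom.1.ne'), norm_mul] at hε
    have hpos : 0 < ‖h + ε * Complex.I - h‖ := by
      have : (0 : ℝ) < ε := hε0
      simp [this.ne']
    apply le_of_mul_le_mul_left _ hpos
    linarith
  exact absurd (ge_of_tendsto hlimfac hone) (by norm_num)

theorem support_twoSources (a : ℝ) : (twoSources a).support = {a, -a} := by
  have hd : ∀ b : ℝ, (Measure.dirac b).support = {b} := by
    intro b
    ext x
    rw [Measure.mem_support_iff_forall, Set.mem_singleton_iff]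
    constructor
    · intro hx
      by_contra hne
      have := hx {b}ᶜ (isOpen_compl_singleton.mem_nhds hne)
      simp at this
    · rintro rfl U hU
      rw [Measure.dirac_apply_of_mem (mem_of_mem_nhds hU)]
      exact one_pos
  ext x
  have : x ∈ (twoSources a).support ↔ x ∈ (Measure.dirac a + Measure.dirac (-a)).support := by
    simp only [Measure.mem_support_iff_forall, twoSources, Measure.smul_apply, smul_eq_mul]
    simp [pos_iff_ne_zero]
  rw [this, Measure.support_add, hd, hd]
  simp [or_comm]

/-- The support of the hydrodynamic limit is the image of the hitting curve. -/
theorem IsHydrodynamicLimit.mem_support_iff (hμ : IsHydrodynamicLimit (twoSources a) μ)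
    (ha : a ≠ 0) (ht : 0 ≤ t) (x : ℝ) :
    x ∈ (μ t : Measure ℝ).support ↔ ∃ h ∈ charCurve a t, charMap a t h = x := by
  constructor
  · intro hx
    by_contra! hne
    exact notMem_support_of_forall_ne hμ ht hne ha hx
  · rintro ⟨h, hh, hx⟩
    rcases ht.eq_or_lt with rfl | ht
    · have h0 := charCurve_zero hh
      have hhx : h = x := by simpa [charMap] using hx
      rw [hhx] at h0
      have : x ^ 2 = a ^ 2 := sub_eq_zero.1 (by exact_mod_cast h0)
      rw [hμ.initial, support_twoSources]
      exact sq_eq_sq_iff_eq_or_eq_neg.1 this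
    · exact mem_support_of_mem_charCurve hμ ht hh hx ha

end Support

/-! ### The hull as the image of the hitting region -/

section Hull

variable {a s t : ℝ} {h z : ℂ} {μ : ℝ → ProbabilityMeasure ℝ}

/-- The points of the closed first quadrant whose characteristic hits the real line by time `t`. -/
def hitRegion (a t : ℝ) : Set ℂ :=
  {h | 0 ≤ h.re ∧ 0 ≤ h.im ∧
    Complex.normSq (h ^ 2 - (a : ℂ) ^ 2) ≤ 4 * t * (Complex.normSq h + a ^ 2)}

/-- A set together with its mirror image in the imaginary axis. -/
def symmetrize (K : Set ℂ) : Set ℂ := K ∪ (fun z : ℂ => -(starRingEnd ℂ) z) '' K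

theorem neg_conj_mem_symmetrize {K : Set ℂ} (hz : -(starRingEnd ℂ) z ∈ K) : z ∈ symmetrize K :=
  Or.inr ⟨_, hz, by simp⟩

/-- The curves are the level sets of the hitting time $|h^2-a^2|^2/(4(|h|^2+a^2))$. -/
theorem mem_hitRegion_iff (ha : a ≠ 0) : h ∈ hitRegion a t ↔
    ∃ s ∈ Set.Icc 0 t, h ∈ charCurve a s ∧ 0 ≤ h.re := by
  have hN := weight_pos ha h
  constructor
  · rintro ⟨hre, him, hq⟩
    refine ⟨Complex.normSq (h ^ 2 - (a : ℂ) ^ 2) / (4 * (Complex.normSq h + a ^ 2)), ⟨?_, ?_⟩,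
      ⟨him, ?_⟩, hre⟩
    · exact div_nonneg (Complex.normSq_nonneg _) (by positivity)
    · rw [div_le_iff₀ (by positivity)]
      linarith
    · field_simp
  · rintro ⟨s, hs, ⟨him, hC⟩, hre⟩
    refine ⟨hre, him, ?_⟩
    rw [← hC]
    gcongr
    exact hs.2

theorem isCompact_hitRegion (a t : ℝ) : IsCompact (hitRegion a t) := by
  have h1 : Continuous fun h : ℂ => 4 * t * (Complex.normSq h + a ^ 2) :=
    continuous_const.mul (Complex.continuous_normSq.add continuous_const)
  have h2 : Continuous fun h : ℂ => Complex.normSq (h ^ 2 - (a : ℂ) ^ 2) :=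
    Complex.continuous_normSq.comp (by fun_prop)
  refine Metric.isCompact_of_isClosed_isBounded
    ((isClosed_le continuous_const Complex.continuous_re).inter
      ((isClosed_le continuous_const Complex.continuous_im).inter (isClosed_le h2 h1))) ?_
  -- The inequality yields $|h|^2+a^2\le4a^2+4|t|$; the extra 1 ensures $|h|\le|h|^2$ beyond this
  -- radius.
  refine (Metric.isBounded_closedBall (x := (0 : ℂ)) (r := 4 * a ^ 2 + 4 * |t| + 1)).subset ?_
  rintro h ⟨-, -, hq⟩
  rw [mem_closedBall_zero_iff]
  rw [normSq_sq_sub_sq'] at hq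
  have hre : h.re ^ 2 ≤ Complex.normSq h := by
    rw [Complex.normSq_apply]
    nlinarith [sq_nonneg h.im]
  rw [← Complex.sq_norm] at hq hre
  set r := ‖h‖
  have hr : 0 ≤ r := norm_nonneg h
  have ht : t ≤ |t| := le_abs_self t
  by_contra! hlt
  have ha2 := sq_nonneg a
  have h1r : 1 ≤ r := by linarith [abs_nonneg t]
  have h3 : r ≤ r ^ 2 := by nlinarith
  have h4 : 4 * h.re ^ 2 * a ^ 2 ≤ 4 * a ^ 2 * (r ^ 2 + a ^ 2) := by nlinarith
  have h5 : 4 * t * (r ^ 2 + a ^ 2) ≤ 4 * |t| * (r ^ 2 + a ^ 2) := by gcongr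
  have h6 : (r ^ 2 + a ^ 2) ^ 2 ≤ (4 * a ^ 2 + 4 * |t|) * (r ^ 2 + a ^ 2) := by nlinarith
  have h7 : r ^ 2 + a ^ 2 ≤ 4 * a ^ 2 + 4 * |t| := by
    apply le_of_mul_le_mul_right _ (by positivity : 0 < r ^ 2 + a ^ 2)
    linarith
  linarith

theorem isClosed_symmetrize_image (ha : a ≠ 0) (t : ℝ) :
    IsClosed (symmetrize (hitPoint a '' hitRegion a t)) := by
  have h1 : IsCompact (hitPoint a '' hitRegion a t) :=
    (isCompact_hitRegion a t).image_of_continuousOn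
      ((continuousOn_hitPoint ha).mono fun h hh => ⟨hh.1, hh.2.1⟩)
  exact (h1.union (h1.image (Complex.continuous_conj.neg))).isClosed

theorem eq_hitPoint (ha : a ≠ 0) (hh : h ∈ charCurve a t) (hre : 0 ≤ h.re) (hz : 0 ≤ z.im)
    (hzre : 0 ≤ z.re) (hE : firstIntegral a t h = z ^ 2 - (a : ℂ) ^ 2) : z = hitPoint a h := by
  refine eq_of_sq_eq_sq_of_quadrant (mul_nonneg hzre (hitPoint_re_nonneg ha hre hh.1))
    (mul_nonneg hz (hitPoint_im_nonneg a h)) ?_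
  have := hitPoint_sq a h
  rw [← firstIntegral_eq_hitIntegral ha hh] at this
  linear_combination -hE - this

theorem neg_conj_eq_hitPoint (ha : a ≠ 0) (hh : h ∈ charCurve a t) (hre : h.re ≤ 0)
    (hz : 0 ≤ z.im) (hzre : z.re ≤ 0) (hE : firstIntegral a t h = z ^ 2 - (a : ℂ) ^ 2) :
    -(starRingEnd ℂ) z = hitPoint a (-(starRingEnd ℂ) h) := by
  refine eq_hitPoint ha (neg_conj_mem_charCurve hh) (by simpa using hre) (by simpa using hz)
    (by simpa using hzre) ?_
  rw [firstIntegral_neg_conj, hE]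
  simp

/-- The part of the hitting curve in the closed right half-plane. -/
def rightCurve (a s : ℝ) : Set ℂ := charCurve a s ∩ {h | 0 ≤ h.re}

theorem mem_symmetrize_of_firstIntegral (ha : a ≠ 0) (hh : h ∈ charCurve a s) (hz : 0 ≤ z.im)
    (hsign : 0 ≤ h.re ∧ 0 ≤ z.re ∨ h.re ≤ 0 ∧ z.re ≤ 0)
    (hE : firstIntegral a s h = z ^ 2 - (a : ℂ) ^ 2) :
    z ∈ symmetrize (hitPoint a '' rightCurve a s) := by
  rcases hsign with ⟨h1, h2⟩ | ⟨h1, h2⟩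
  · exact Or.inl ⟨h, ⟨hh, h1⟩, (eq_hitPoint ha hh h1 hz h2 hE).symm⟩
  · refine neg_conj_mem_symmetrize ⟨_, ⟨neg_conj_mem_charCurve hh, ?_⟩,
      (neg_conj_eq_hitPoint ha hh h1 hz h2 hE).symm⟩
    simpa using h1

theorem symmetrize_mono {K L : Set ℂ} (hKL : K ⊆ L) : symmetrize K ⊆ symmetrize L :=
  Set.union_subset_union hKL (Set.image_mono hKL)

/-- Along an ultrafilter realizing the cluster point, the characteristic coordinates stay bounded
and converge to some `h` in `charClosure a s`. Its image lies in the support, so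
`mem_charCurve_of_charMap_eq` puts `h` on the curve, and the first integral passes to the limit. -/
theorem IsHydrodynamicLimit.hullCurve_subset (hμ : IsHydrodynamicLimit (twoSources a) μ)
    (ha : a ≠ 0) (hs : 0 ≤ s) :
    hullCurve μ s ⊆ symmetrize (hitPoint a '' rightCurve a s) := by
  rintro z ⟨u, hu, hcl⟩
  obtain ⟨U, hU, hlim⟩ := mapClusterPt_iff_ultrafilter.1 hcl
  have hD : ∀ᶠ w in (U : Filter ℂ), w ∈ loewnerDomain μ s :=
    hU self_mem_nhdsWithin
  have hUz : Tendsto (fun w : ℂ => w) U (𝓝 z) := hU.trans nhdsWithin_le_nhds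
  have hex : ∀ w ∈ loewnerDomain μ s, ∃ h ∈ charDomain a s,
      firstIntegral a s h = w ^ 2 - (a : ℂ) ^ 2 ∧ loewnerMap μ s w = charMap a s h := by
    intro w hw
    obtain ⟨h, hh, hE⟩ := hμ.exists_of_mem_loewnerDomain hs hw
    exact ⟨h, hh, hE, (hμ.mem_loewnerDomain_of_firstIntegral hs hw.1 hh hE).2⟩
  choose! k hk hkE hkg using hex
  have hlimg : Tendsto (fun w => charMap a s (k w)) U (𝓝 (u : ℂ)) :=
    hlim.congr' (by filter_upwards [hD] with w hw using hkg w hw)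
  set R := ‖(u : ℂ)‖ + 1 + 2 * √s
  have hmem : ∀ᶠ w in (U : Filter ℂ), k w ∈ charClosure a s ∩ Metric.closedBall 0 R := by
    have hn : ∀ᶠ w in (U : Filter ℂ), ‖charMap a s (k w)‖ < ‖(u : ℂ)‖ + 1 :=
      hlimg.norm.eventually (Iio_mem_nhds (by linarith))
    filter_upwards [hD, hn] with w hw hw'
    have h1 := charDomain_subset_charClosure (hk w hw)
    have h2 := norm_le_norm_charMap_add hs h1
    exact ⟨h1, by rw [mem_closedBall_zero_iff]; linarith⟩
  have hcomp : IsCompact (charClosure a s ∩ Metric.closedBall 0 R) :=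
    (isCompact_closedBall 0 R).inter_left (isClosed_charClosure a s)
  obtain ⟨h, ⟨hh, -⟩, hkh⟩ := hcomp.ultrafilter_le_nhds (U.map k) (by
    rw [le_principal_iff]
    exact hmem)
  have hkh' : Tendsto k U (𝓝 h) := hkh
  have hH : charMap a s h = u :=
    tendsto_nhds_unique ((continuousAt_charMap ha hs hh).tendsto.comp hkh') hlimg
  obtain ⟨h', hh', hH'⟩ := (hμ.mem_support_iff ha hs u).1 hu
  have hhC : h ∈ charCurve a s := mem_charCurve_of_charMap_eq ha hs hh hh' (hH.trans hH'.symm)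
  have hE : firstIntegral a s h = z ^ 2 - (a : ℂ) ^ 2 := by
    refine tendsto_nhds_unique ((continuousAt_firstIntegral ha hs hh).tendsto.comp hkh') ?_
    refine ((hUz.pow 2).sub_const _).congr' ?_
    filter_upwards [hD] with w hw using (hkE w hw).symm
  have hzre : Tendsto Complex.re U (𝓝 z.re) := (Complex.continuous_re.tendsto z).comp hUz
  have hzim : Tendsto Complex.im U (𝓝 z.im) := (Complex.continuous_im.tendsto z).comp hUz
  have hkre : Tendsto (fun w => (k w).re) U (𝓝 h.re) := (Complex.continuous_re.tendsto h).comp hkh'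
  have hz0 : 0 ≤ z.im :=
    ge_of_tendsto hzim (by filter_upwards [hD] with w hw using le_of_lt hw.1)
  refine mem_symmetrize_of_firstIntegral ha hhC hz0 ?_ hE
  rcases lt_trichotomy h.re 0 with h0 | h0 | h0
  · refine Or.inr ⟨h0.le, le_of_tendsto hzre ?_⟩
    filter_upwards [hD, hkre.eventually_lt_const h0] with w hw hw'
    exact re_nonpos_of_firstIntegral ha hs (charDomain_subset_charClosure (hk w hw)) hw'.le hw.1
      (hkE w hw)
  -- The approximants may lie on either side here, but $z^2\le0$ forces `z` onto the imaginary axis.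
  · obtain ⟨x, hx, hx'⟩ := firstIntegral_of_re_eq_zero ha hs hh h0
    rw [hE] at hx
    have hre := congrArg Complex.re hx
    have him := congrArg Complex.im hx
    rw [im_sq_sub_sq, Complex.ofReal_im] at him
    simp only [Complex.sub_re, ← Complex.ofReal_pow, Complex.ofReal_re] at hre
    simp only [pow_two, Complex.mul_re] at hre hx'
    have hz1 : z.re = 0 := by
      rcases mul_eq_zero.1 (by linarith : z.re * z.im = 0) with h1 | h1
      · exact h1
      · rw [h1] at hre
        nlinarith
    exact Or.inl ⟨h0.ge, hz1.ge⟩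
  · refine Or.inl ⟨h0.le, ge_of_tendsto hzre ?_⟩
    filter_upwards [hD, hkre.eventually_const_lt h0] with w hw hw'
    exact re_nonneg_of_firstIntegral ha hs (charDomain_subset_charClosure (hk w hw)) hw'.le hw.1
      (hkE w hw)

/-- Approach `h` vertically through `charDomain`. The preimages $w_\varepsilon$ satisfy
$w_\varepsilon^2\to z^2$ and lie in the quadrant of `z`, so `norm_sub_sq_le` gives $w_\varepsilon\to
z$. -/
theorem IsHydrodynamicLimit.mem_hullCurve (hμ : IsHydrodynamicLimit (twoSources a) μ)
    (ha : a ≠ 0) (hs : 0 ≤ s) (hh : h ∈ charCurve a s) (hz : 0 ≤ z.im)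
    (hsign : 0 ≤ h.re ∧ 0 ≤ z.re ∨ h.re ≤ 0 ∧ z.re ≤ 0)
    (hE : firstIntegral a s h = z ^ 2 - (a : ℂ) ^ 2) : z ∈ hullCurve μ s := by
  have hhc := charCurve_subset_charClosure hh
  have hH := charMap_of_mem_charCurve ha hh
  refine ⟨_, (hμ.mem_support_iff ha hs _).2 ⟨h, hh, hH⟩, ?_⟩
  rw [← hH]
  have hex : ∀ ε : ℝ, 0 < ε → ∃ w : ℂ, w ∈ loewnerDomain μ s ∧
      firstIntegral a s (h + ε * Complex.I) = w ^ 2 - (a : ℂ) ^ 2 ∧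
      loewnerMap μ s w = charMap a s (h + ε * Complex.I) ∧ 0 ≤ w.re * z.re := by
    intro ε hε
    have hd := add_mul_I_mem_charDomain ha hs hh hε
    obtain ⟨w, -, -, hw, -, hwE⟩ := hμ.exists_loewnerPath hs hd
    obtain ⟨h1, h2⟩ := hμ.mem_loewnerDomain_of_firstIntegral hs hw hd hwE
    refine ⟨w, h1, hwE, h2, ?_⟩
    have hre : (h + ε * Complex.I).re = h.re := by simp
    have hdc := charDomain_subset_charClosure hd
    rcases hsign with ⟨h3, h4⟩ | ⟨h3, h4⟩
    · exact mul_nonneg (re_nonneg_of_firstIntegral ha hs hdc (hre ▸ h3) hw hwE) h4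
    · exact mul_nonneg_of_nonpos_of_nonpos
        (re_nonpos_of_firstIntegral ha hs hdc (hre ▸ h3) hw hwE) h4
  choose! w hwD hwE hwg hwre using hex
  have hlimk := tendsto_add_mul_I h
  have hlimE := (continuousAt_firstIntegral ha hs hhc).tendsto.comp hlimk
  have hlimw : Tendsto w (𝓝[>] 0) (𝓝 z) := by
    rw [tendsto_iff_norm_sub_tendsto_zero]
    have h0 : Tendsto (fun ε : ℝ => √‖firstIntegral a s (h + ε * Complex.I)
        - firstIntegral a s h‖) (𝓝[>] 0) (𝓝 0) := by
      have := (tendsto_iff_norm_sub_tendsto_zero.1 hlimE).sqrt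
      simpa using this
    refine squeeze_zero' (Eventually.of_forall fun _ => norm_nonneg _) ?_ h0
    filter_upwards [self_mem_nhdsWithin] with ε hε
    apply Real.le_sqrt_of_sq_le
    have hwim : 0 < (w ε).im := (hwD ε hε).1
    have := norm_sub_sq_le (hwre ε hε) (mul_nonneg hwim.le hz)
    rw [hwE ε hε, hE]
    simpa using this
  refine MapClusterPt.of_comp (φ := w) (p := 𝓝[>] (0 : ℝ)) ?_ ?_
  · exact tendsto_nhdsWithin_iff.2 ⟨hlimw, by
      filter_upwards [self_mem_nhdsWithin] with ε hε using hwD ε hε⟩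
  · have : Tendsto (fun ε : ℝ => charMap a s (h + ε * Complex.I)) (𝓝[>] 0)
        (𝓝 (charMap a s h)) := (continuousAt_charMap ha hs hhc).tendsto.comp hlimk
    refine Tendsto.mapClusterPt (this.congr' ?_)
    filter_upwards [self_mem_nhdsWithin] with ε hε using (hwg ε hε).symm

theorem IsHydrodynamicLimit.hullCurve_eq (hμ : IsHydrodynamicLimit (twoSources a) μ)
    (ha : a ≠ 0) (hs : 0 ≤ s) :
    hullCurve μ s = symmetrize (hitPoint a '' rightCurve a s) := by
  refine (hμ.hullCurve_subset ha hs).antisymm ?_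
  have key : ∀ h ∈ rightCurve a s,
      firstIntegral a s h = hitPoint a h ^ 2 - (a : ℂ) ^ 2 := fun h hh => by
    rw [hitPoint_sq, firstIntegral_eq_hitIntegral ha hh.1]
  rintro z (⟨h, hh, rfl⟩ | ⟨-, ⟨h, hh, rfl⟩, rfl⟩)
  · exact hμ.mem_hullCurve ha hs hh.1 (hitPoint_im_nonneg a h)
      (Or.inl ⟨hh.2, hitPoint_re_nonneg ha hh.2 hh.1.1⟩) (key h hh)
  · refine hμ.mem_hullCurve ha hs (neg_conj_mem_charCurve hh.1)
      (by simpa using hitPoint_im_nonneg a h)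
      (Or.inr ⟨by simpa using hh.2, by simpa using hitPoint_re_nonneg ha hh.2 hh.1.1⟩) ?_
    rw [firstIntegral_neg_conj, key h hh]
    simp

theorem IsHydrodynamicLimit.iUnion_hullCurve (hμ : IsHydrodynamicLimit (twoSources a) μ)
    (ha : a ≠ 0) (t : ℝ) :
    (⋃ s ∈ Set.Icc 0 t, hullCurve μ s) = symmetrize (hitPoint a '' hitRegion a t) := by
  ext z
  simp only [Set.mem_iUnion, exists_prop]
  constructor
  · rintro ⟨s, hs, hz⟩
    rw [hμ.hullCurve_eq ha hs.1] at hz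
    exact symmetrize_mono (Set.image_mono fun h hh => (mem_hitRegion_iff ha).2 ⟨s, hs, hh⟩) hz
  · rintro (⟨h, hh, rfl⟩ | ⟨-, ⟨h, hh, rfl⟩, rfl⟩)
    · obtain ⟨s, hs, hh⟩ := (mem_hitRegion_iff ha).1 hh
      refine ⟨s, hs, ?_⟩
      rw [hμ.hullCurve_eq ha hs.1]
      exact Or.inl ⟨h, hh, rfl⟩
    · obtain ⟨s, hs, hh⟩ := (mem_hitRegion_iff ha).1 hh
      refine ⟨s, hs, ?_⟩
      rw [hμ.hullCurve_eq ha hs.1]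
      exact Or.inr ⟨_, ⟨h, hh, rfl⟩, rfl⟩

/-! The hull. -/

/-- The exponent has norm at most 1, so the exponential factor is at least $e^{-1}$ in modulus. The
bound is uniform in `t`, as needed when time varies too. -/
theorem norm_sq_le_of_firstIntegral (ht : 0 ≤ t) (hh : h ∈ charClosure a t) :
    ‖h‖ ^ 2 ≤ Real.exp 1 * ‖firstIntegral a t h‖ + a ^ 2 := by
  have h1 : Real.exp (-1) ≤ Real.exp (t * initialGreen a h ^ 2).re := by
    apply Real.exp_le_exp.2
    have h2 := (Complex.abs_re_le_norm (t * initialGreen a h ^ 2))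
    rw [norm_mul, norm_pow, Complex.norm_real, Real.norm_of_nonneg ht] at h2
    have := mul_norm_initialGreen_sq_le ht hh.2
    linarith [neg_le_of_abs_le (h2.trans this)]
  have h2 : ‖h ^ 2 - (a : ℂ) ^ 2‖ ≤ Real.exp 1 * ‖firstIntegral a t h‖ := by
    rw [firstIntegral, norm_mul, Complex.norm_exp]
    calc ‖h ^ 2 - (a : ℂ) ^ 2‖ = Real.exp 1 * (‖h ^ 2 - (a : ℂ) ^ 2‖ * Real.exp (-1)) := by
          rw [mul_left_comm, ← Real.exp_add]; simp
      _ ≤ _ := by gcongr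
  have h3 := norm_sub_norm_le (h ^ 2) ((a : ℂ) ^ 2)
  rw [norm_pow, norm_pow, Complex.norm_real, Real.norm_eq_abs, sq_abs] at h3
  linarith

theorem isOpen_charDomain (a t : ℝ) : IsOpen (charDomain a t) := by
  have h1 : Continuous fun h : ℂ => 4 * t * (Complex.normSq h + a ^ 2) :=
    continuous_const.mul (Complex.continuous_normSq.add continuous_const)
  have h2 : Continuous fun h : ℂ => Complex.normSq (h ^ 2 - (a : ℂ) ^ 2) :=
    Complex.continuous_normSq.comp (by fun_prop)
  exact (isOpen_lt continuous_const Complex.continuous_im).inter (isOpen_lt h1 h2)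

/-- Let $\tau$ be the lifetime of `z`, which is not attained. Coordinates of `z` at times tending to
$\tau$ accumulate at some `h` in `charClosure a τ`. Off the curve, `h` would be either in
`charDomain a τ`, putting `z` in the domain at time $\tau$, or real, giving $z^2\ge0$. -/
theorem IsHydrodynamicLimit.diff_subset (hμ : IsHydrodynamicLimit (twoSources a) μ)
    (ha : a ≠ 0) (ht : 0 < t) :
    upperHalf \ loewnerDomain μ t ⊆ symmetrize (hitPoint a '' hitRegion a t) := by
  rintro z ⟨hz, hzt⟩
  have hz' : 0 < z.im := hz
  set A : Set ℝ := {s | s ∈ Set.Icc 0 t ∧ z ∈ loewnerDomain μ s}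
  have h0A : (0 : ℝ) ∈ A := by
    refine ⟨⟨le_rfl, ht.le⟩, (hμ.mem_loewnerDomain_of_firstIntegral le_rfl hz' (h := z) ⟨hz', ?_⟩
      ?_).1⟩
    · simpa using sq_sub_sq_ne_zero_of_im hz'.ne'
    · simp [firstIntegral]
  have hbdd : BddAbove A := ⟨t, fun s hs => hs.1.2⟩
  have hext : ∀ s ∈ A, ∃ r ∈ A, s < r := by
    intro s hs
    obtain ⟨r, hr, hzr⟩ := hμ.exists_mem_loewnerDomain_gt hs.1.1 hs.2
    have hst : s < t := hs.1.2.lt_of_ne fun h0 => hzt (h0 ▸ hs.2)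
    exact ⟨min r t, ⟨⟨(hs.1.1.trans_lt (lt_min hr hst)).le, min_le_right _ _⟩,
      loewnerDomain_anti (min_le_left _ _) hzr⟩, lt_min hr hst⟩
  set τ := sSup A
  have hτA : τ ∉ A := fun hτ => by
    obtain ⟨r, hr, hlt⟩ := hext τ hτ
    exact (le_csSup hbdd hr).not_gt hlt
  have hτ0 : 0 < τ := (le_csSup hbdd h0A).lt_of_ne fun h0 => by
    rw [show τ = 0 from h0.symm] at hτA
    exact hτA h0A
  have hτt : τ ≤ t := csSup_le ⟨0, h0A⟩ fun s hs => hs.1.2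
  obtain ⟨σ, -, hσ, hσA⟩ := exists_seq_tendsto_sSup ⟨0, h0A⟩ hbdd
  have hex : ∀ n, ∃ h ∈ charDomain a (σ n), firstIntegral a (σ n) h = z ^ 2 - (a : ℂ) ^ 2 :=
    fun n => hμ.exists_of_mem_loewnerDomain (hσA n).1.1 (hσA n).2
  choose k hk hkE using hex
  obtain ⟨h, -, φ, hφ, hlim⟩ := (isCompact_closedBall (0 : ℂ)
    (√(Real.exp 1 * ‖z ^ 2 - (a : ℂ) ^ 2‖ + a ^ 2))).tendsto_subseq (x := k) fun n => by
      rw [mem_closedBall_zero_iff]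
      apply Real.le_sqrt_of_sq_le
      rw [← hkE n]
      exact norm_sq_le_of_firstIntegral (hσA n).1.1 (charDomain_subset_charClosure (hk n))
  have hσφ : Tendsto (fun n => σ (φ n)) atTop (𝓝 τ) := hσ.comp hφ.tendsto_atTop
  have hhc : h ∈ charClosure a τ := by
    constructor
    · exact ge_of_tendsto ((Complex.continuous_im.tendsto h).comp hlim)
        (Eventually.of_forall fun n => (hk (φ n)).1.le)
    · have h1 : Tendsto (fun n => 4 * σ (φ n) * (Complex.normSq (k (φ n)) + a ^ 2)) atTop
          (𝓝 (4 * τ * (Complex.normSq h + a ^ 2))) :=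
        (hσφ.const_mul 4).mul (((Complex.continuous_normSq.tendsto h).comp hlim).add_const _)
      have h2 : Tendsto (fun n => Complex.normSq (k (φ n) ^ 2 - (a : ℂ) ^ 2)) atTop
          (𝓝 (Complex.normSq (h ^ 2 - (a : ℂ) ^ 2))) :=
        (Complex.continuous_normSq.tendsto _).comp ((hlim.pow 2).sub_const _)
      exact le_of_tendsto_of_tendsto h1 h2 (Eventually.of_forall fun n => (hk (φ n)).2.le)
  have hq := sq_sub_sq_ne_zero ha hτ0 hhc.2
  have hE : firstIntegral a τ h = z ^ 2 - (a : ℂ) ^ 2 := by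
    have h1 := (continuousAt_firstIntegral_uncurry (t := τ) hq).tendsto.comp
      (hσφ.prodMk_nhds hlim)
    refine tendsto_nhds_unique h1 (tendsto_const_nhds.congr fun n => ?_)
    exact (hkE (φ n)).symm
  rcases hhc.2.eq_or_lt with hC | hlt
  · have hhC : h ∈ charCurve a τ := ⟨hhc.1, hC⟩
    refine symmetrize_mono (Set.image_mono fun k hk =>
      (mem_hitRegion_iff ha).2 ⟨τ, ⟨hτ0.le, hτt⟩, hk⟩)
      (mem_symmetrize_of_firstIntegral ha hhC hz'.le ?_ hE)
    rcases le_total 0 h.re with h0 | h0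
    · exact Or.inl ⟨h0, re_nonneg_of_firstIntegral ha hτ0.le hhc h0 hz' hE⟩
    · exact Or.inr ⟨h0, re_nonpos_of_firstIntegral ha hτ0.le hhc h0 hz' hE⟩
  · exfalso
    rcases hhc.1.eq_or_lt with him | him
    · obtain ⟨x, hx, hx'⟩ := firstIntegral_of_im_eq_zero ha hτ0.le hhc him.symm
      rw [hE] at hx
      have hre := congrArg Complex.re hx
      have him := congrArg Complex.im hx
      rw [im_sq_sub_sq, Complex.ofReal_im] at him
      simp only [Complex.sub_re, ← Complex.ofReal_pow, Complex.ofReal_re] at hre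
      simp only [pow_two, Complex.mul_re] at hre hx'
      have hz1 : z.re = 0 :=
        (mul_eq_zero.1 (by linarith : z.re * z.im = 0)).resolve_right hz'.ne'
      rw [hz1] at hre
      nlinarith
    · exact hτA ⟨⟨hτ0.le, hτt⟩,
        (hμ.mem_loewnerDomain_of_firstIntegral hτ0.le hz' ⟨him, hlt⟩ hE).1⟩

/-- Otherwise some `k` in `charDomain a s` has the same first integral as the boundary point `h`. By
the open mapping theorem the values at $h+i\varepsilon$ are also attained near `k`, against
injectivity. -/
theorem IsHydrodynamicLimit.notMem_loewnerDomain (hμ : IsHydrodynamicLimit (twoSources a) μ)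
    (ha : a ≠ 0) (hs : 0 ≤ s) (hh : h ∈ charCurve a s)
    (hE : firstIntegral a s h = z ^ 2 - (a : ℂ) ^ 2) : z ∉ loewnerDomain μ s := by
  intro hz
  obtain ⟨k, hk, hkE⟩ := hμ.exists_of_mem_loewnerDomain hs hz
  have hne : k ≠ h := by
    rintro rfl
    exact hk.2.ne hh.2
  have han : AnalyticAt ℂ (firstIntegral a s) k := by
    have hq := sq_sub_sq_ne_zero_of_im (a := a) hk.1.ne'
    unfold firstIntegral initialGreen
    fun_prop (disch := assumption)
  have hopen : 𝓝 (firstIntegral a s k) ≤ map (firstIntegral a s) (𝓝 k) := by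
    refine han.eventually_constant_or_nhds_le_map_nhds.resolve_left fun hc => ?_
    have h1 : ∀ᶠ w in 𝓝[≠] k, False := by
      filter_upwards [hc.filter_mono nhdsWithin_le_nhds, self_mem_nhdsWithin,
        nhdsWithin_le_nhds ((isOpen_charDomain a s).mem_nhds hk)] with w hw hwk hwd
      exact hwk (hμ.injOn_firstIntegral hs hwd hk hw)
    exact (h1.exists).choose_spec
  obtain ⟨V, W, hV, hW, hkV, hhW, hVW⟩ := t2_separation hne
  have hVn : V ∩ charDomain a s ∈ 𝓝 k :=
    (hV.inter (isOpen_charDomain a s)).mem_nhds ⟨hkV, hk⟩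
  have himg : firstIntegral a s '' (V ∩ charDomain a s) ∈ 𝓝 (firstIntegral a s h) := by
    rw [hE, ← hkE]
    exact hopen (image_mem_map hVn)
  have hlimk := tendsto_add_mul_I h
  have h1 := (((continuousAt_firstIntegral ha hs
    (charCurve_subset_charClosure hh)).tendsto.comp hlimk).eventually himg)
  have h2 := hlimk.eventually (hW.mem_nhds hhW)
  obtain ⟨ε, ⟨⟨w, hw, hwE⟩, hεW⟩, hε⟩ := ((h1.and h2).and self_mem_nhdsWithin).exists
  have := hμ.injOn_firstIntegral hs hw.2 (add_mul_I_mem_charDomain ha hs hh hε) hwE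
  exact Set.disjoint_left.1 hVW hw.1 (this ▸ hεW)

theorem IsHydrodynamicLimit.neg_conj_mem_loewnerDomain
    (hμ : IsHydrodynamicLimit (twoSources a) μ) (ht : 0 ≤ t) (hz : z ∈ loewnerDomain μ t) :
    -(starRingEnd ℂ) z ∈ loewnerDomain μ t := by
  obtain ⟨h, hh, hE⟩ := hμ.exists_of_mem_loewnerDomain ht hz
  have hz' : 0 < z.im := hz.1
  refine (hμ.mem_loewnerDomain_of_firstIntegral ht (by simpa using hz')
    (neg_conj_mem_charDomain hh) ?_).1
  rw [firstIntegral_neg_conj, hE]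
  simp

theorem IsHydrodynamicLimit.neg_conj_mem_hull (hμ : IsHydrodynamicLimit (twoSources a) μ)
    (ht : 0 ≤ t) (hz : z ∈ hull μ t) : -(starRingEnd ℂ) z ∈ hull μ t := by
  refine map_mem_closure (f := fun z : ℂ => -(starRingEnd ℂ) z) (Complex.continuous_conj.neg) hz fun w hw => ⟨?_, fun hw' => hw.2 ?_⟩
  · have : 0 < w.im := hw.1
    simpa [upperHalf] using this
  · simpa using hμ.neg_conj_mem_loewnerDomain ht hw'

/-- The hull is closed, so non-real `h` suffice, up to limits. A real `h` with strict inequality is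
reached from vertically above; a real `h` on the outer boundary is first moved along the axis
towards `a`. -/
theorem IsHydrodynamicLimit.hitPoint_mem_hull (hμ : IsHydrodynamicLimit (twoSources a) μ)
    (ha : 0 < a) (ht : 0 < t) (hh : h ∈ hitRegion a t) : hitPoint a h ∈ hull μ t := by
  have hupper : ∀ k ∈ hitRegion a t, 0 < k.im → hitPoint a k ∈ hull μ t := by
    intro k hk hkim
    obtain ⟨s, hs, hkC, hkre⟩ := (mem_hitRegion_iff ha.ne').1 hk
    refine subset_closure ⟨hitPoint_im_pos ha.ne' hkre hkim, fun hD => ?_⟩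
    refine hμ.notMem_loewnerDomain ha.ne' hs.1 hkC ?_ (loewnerDomain_anti hs.2 hD)
    rw [hitPoint_sq, firstIntegral_eq_hitIntegral ha.ne' hkC]
  have hclosed : IsClosed (hull μ t) := isClosed_closure
  have hpass : ∀ (k : ℝ → ℂ) (k₀ : ℂ), 0 ≤ k₀.re → 0 ≤ k₀.im → Tendsto k (𝓝[>] 0) (𝓝 k₀) →
      (∀ᶠ ε in 𝓝[>] (0 : ℝ), k ε ∈ hitRegion a t ∧ hitPoint a (k ε) ∈ hull μ t) →
      hitPoint a k₀ ∈ hull μ t := by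
    intro k k₀ hre him hlim hev
    have h1 : Tendsto (fun ε => hitPoint a (k ε)) (𝓝[>] 0) (𝓝 (hitPoint a k₀)) := by
      refine (continuousOn_hitPoint ha.ne' k₀ ⟨hre, him⟩).tendsto.comp
        (tendsto_nhdsWithin_iff.2 ⟨hlim, ?_⟩)
      filter_upwards [hev] with ε hε using ⟨hε.1.1, hε.1.2.1⟩
    exact hclosed.mem_of_tendsto h1 (hev.mono fun ε hε => hε.2)
  have hstrict : ∀ k ∈ hitRegion a t,
      Complex.normSq (k ^ 2 - (a : ℂ) ^ 2) < 4 * t * (Complex.normSq k + a ^ 2) →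
      hitPoint a k ∈ hull μ t := by
    intro k hk hlt
    refine hpass (fun ε => k + ε * Complex.I) k hk.1 hk.2.1 (tendsto_add_mul_I k) ?_
    have h1 : Continuous fun h : ℂ => 4 * t * (Complex.normSq h + a ^ 2) :=
      continuous_const.mul (Complex.continuous_normSq.add continuous_const)
    have h2 : Continuous fun h : ℂ => Complex.normSq (h ^ 2 - (a : ℂ) ^ 2) :=
      Complex.continuous_normSq.comp (by fun_prop)
    filter_upwards [(tendsto_add_mul_I k).eventually ((isOpen_lt h2 h1).mem_nhds hlt),
      self_mem_nhdsWithin] with ε hε hε0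
    have hε0' : (0 : ℝ) < ε := hε0
    have him : 0 < (k + ε * Complex.I).im := by
      have := hk.2.1
      simp only [Complex.add_im, Complex.mul_im, Complex.ofReal_re, Complex.I_im, mul_one,
        Complex.ofReal_im, Complex.I_re, mul_zero, add_zero]
      linarith
    have hmem : k + ε * Complex.I ∈ hitRegion a t := ⟨by simpa using hk.1, him.le, le_of_lt hε⟩
    exact ⟨hmem, hupper _ hmem him⟩
  rcases hh.2.1.eq_or_lt with him | him
  swap
  · exact hupper h hh him
  rcases hh.2.2.lt_or_eq with hlt | heq
  · exact hstrict h hh hlt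
  set x := h.re
  have hx0 : 0 ≤ x := hh.1
  have hhx : h = (x : ℂ) := Complex.ext (by simp [x]) (by simp [← him])
  have hnq : ∀ y : ℝ, Complex.normSq ((y : ℂ) ^ 2 - (a : ℂ) ^ 2) = (y ^ 2 - a ^ 2) ^ 2 := by
    intro y
    rw [normSq_sq_sub_sq]
    simp
    ring
  have hnn : ∀ y : ℝ, Complex.normSq (y : ℂ) = y ^ 2 := fun y => by
    rw [Complex.normSq_ofReal]; ring
  rw [hhx, hnq, hnn] at heq
  have hxa : x ^ 2 - a ^ 2 ≠ 0 := by
    intro h0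
    rw [h0] at heq
    have : 0 < 4 * t * (x ^ 2 + a ^ 2) := by positivity
    nlinarith
  rw [hhx]
  refine hpass (fun ε => (((1 - ε) * x + ε * a : ℝ) : ℂ)) x (by simpa using hx0) (by simp) ?_ ?_
  · have : ContinuousAt (fun ε : ℝ => (((1 - ε) * x + ε * a : ℝ) : ℂ)) 0 := by fun_prop
    simpa [ContinuousAt] using this.tendsto.mono_left nhdsWithin_le_nhds
  filter_upwards [Ioo_mem_nhdsGT (zero_lt_one' ℝ)] with ε hε
  set y := (1 - ε) * x + ε * a
  have hε1 : 0 < 1 - ε := by linarith [hε.2]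
  have hy0 : 0 < y := add_pos_of_nonneg_of_pos (mul_nonneg hε1.le hx0) (mul_pos hε.1 ha)
  have hlt : (y ^ 2 - a ^ 2) ^ 2 < 4 * t * (y ^ 2 + a ^ 2) := by
    have hpos : 0 < x ^ 2 + a ^ 2 := by positivity
    -- On the non-negative axis the hitting time strictly decreases towards `a`; this is the
    -- comparison of its values at `y` and `x`, cross-multiplied.
    suffices (y ^ 2 - a ^ 2) ^ 2 * (x ^ 2 + a ^ 2) < (x ^ 2 - a ^ 2) ^ 2 * (y ^ 2 + a ^ 2) by
      apply lt_of_mul_lt_mul_right _ hpos.le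
      rw [heq] at this
      linarith
    have hid : (x ^ 2 - a ^ 2) ^ 2 * (y ^ 2 + a ^ 2) - (y ^ 2 - a ^ 2) ^ 2 * (x ^ 2 + a ^ 2)
        = (x ^ 2 - y ^ 2) * ((x ^ 2 - a ^ 2) * (y ^ 2 - a ^ 2)
          + 2 * a ^ 2 * ((x ^ 2 - a ^ 2) + (y ^ 2 - a ^ 2))) := by ring
    have hxy : x - y = ε * (x - a) := by simp only [y]; ring
    have hya : y - a = (1 - ε) * (x - a) := by simp only [y]; ring
    have ha2 : 0 < a ^ 2 := by positivity
    rcases lt_or_gt_of_ne (fun h0 : x = a => hxa (by rw [h0, sub_self])) with hlt | hgt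
    · have h1 : x < y := by nlinarith [hε.1]
      have h2 : y < a := by nlinarith
      have h3 : x ^ 2 < y ^ 2 := by nlinarith
      have h4 : y ^ 2 < a ^ 2 := by nlinarith
      have h5 : 0 ≤ x ^ 2 := sq_nonneg x
      nlinarith [mul_pos (sub_pos.2 h3) (mul_pos ha2 (sub_pos.2 h4)),
        mul_pos (sub_pos.2 h3) (mul_pos ha2 (sub_pos.2 (h3.trans h4))),
        mul_nonneg (mul_nonneg (sub_pos.2 h3).le h5) (sub_pos.2 h4).le]
    · have h1 : y < x := by nlinarith [hε.1]
      have h2 : a < y := by nlinarith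
      have h3 : y ^ 2 < x ^ 2 := by nlinarith
      have h4 : a ^ 2 < y ^ 2 := by nlinarith
      have := mul_pos (sub_pos.2 h3) (add_pos (mul_pos (sub_pos.2 (h4.trans h3)) (sub_pos.2 h4))
        (mul_pos (mul_pos two_pos ha2) (add_pos (sub_pos.2 (h4.trans h3)) (sub_pos.2 h4))))
      linarith
  have hmem : (y : ℂ) ∈ hitRegion a t :=
    ⟨by simpa using hy0.le, by simp, by rw [hnq, hnn]; exact hlt.le⟩
  exact ⟨hmem, hstrict _ hmem (by rw [hnq, hnn]; exact hlt)⟩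

theorem IsHydrodynamicLimit.hull_eq (hμ : IsHydrodynamicLimit (twoSources a) μ)
    (ha : 0 < a) (ht : 0 < t) : hull μ t = symmetrize (hitPoint a '' hitRegion a t) := by
  refine (closure_minimal (hμ.diff_subset ha.ne' ht)
    (isClosed_symmetrize_image ha.ne' t)).antisymm ?_
  rintro z (⟨h, hh, rfl⟩ | ⟨-, ⟨h, hh, rfl⟩, rfl⟩)
  · exact hμ.hitPoint_mem_hull ha ht hh
  · exact hμ.neg_conj_mem_hull ht.le (hμ.hitPoint_mem_hull ha ht hh)

end Hull

/-! ### Cardano's formula for the hitting curve -/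

section Cardano

variable {σ τ : ℝ} {k : ℂ}

theorem realCbrt_pow (x : ℝ) : realCbrt x ^ 3 = x := by
  have key : ∀ y : ℝ, 0 ≤ y → (y ^ (1 / 3 : ℝ)) ^ 3 = y := by
    intro y hy
    rw [← Real.rpow_natCast, ← Real.rpow_mul hy]
    norm_num
  rw [realCbrt]
  split_ifs with h
  · exact key x h
  · rw [neg_pow, key _ (by linarith)]
    ring

/-- The radicand in Cardano's formula: a negative multiple of the discriminant of the cubic. -/
def cardanoRadicand (σ τ : ℝ) : ℝ :=
  -σ ^ 4 - 2 * (2 * τ ^ 2 - 10 * τ - 1) * σ ^ 2 + (4 * τ - 1) ^ 3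

/-- The cubes of the two Cardano roots are $X\pm Y$ with $X^2-Y^2=Q^3$. Writing `vPart` through
$S+T$ removes the division: when $S=0$ also $Q=0$, and $T$ is the cube root of $2X$. -/
theorem exists_cardano_conj (hD : 0 ≤ cardanoRadicand σ τ) : ∃ S T : ℝ,
    S * T = σ ^ 2 - 3 * (4 * τ - 1) ∧ S ^ 3 + T ^ 3 = 2 * (σ ^ 3 - 9 * σ * (2 * τ + 1)) ∧
    vPart σ τ = σ / 3 - (S + T) / 6 := by
  set X := σ ^ 3 - 9 * σ * (2 * τ + 1) with hX
  set Q := σ ^ 2 - 3 * (4 * τ - 1) with hQ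
  set Y := 3 * √3 * √(cardanoRadicand σ τ) with hY
  have hY2 : Y ^ 2 = 27 * cardanoRadicand σ τ := by
    rw [hY, mul_pow, mul_pow, Real.sq_sqrt hD, Real.sq_sqrt (by norm_num)]
    ring
  have hXY : X ^ 2 - Y ^ 2 = Q ^ 3 := by
    rw [hY2, hX, hQ, cardanoRadicand]
    ring
  have hS3 : cardanoS σ τ ^ 3 = X + Y := by
    rw [cardanoS, realCbrt_pow, ← cardanoRadicand, ← hY, hX]
    ring
  rcases eq_or_ne (cardanoS σ τ) 0 with h0 | h0
  · rw [h0] at hS3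
    have hQ0 : Q = 0 := by
      apply pow_eq_zero_iff (three_ne_zero) |>.1
      rw [← hXY]
      linear_combination -(X - Y) * hS3
    refine ⟨0, realCbrt (2 * X), by rw [hQ0, zero_mul], ?_, ?_⟩
    · rw [realCbrt_pow]; ring
    · rw [vPart, if_pos h0]; ring
  · set S := cardanoS σ τ
    refine ⟨S, Q / S, by field_simp, ?_, ?_⟩
    · have : S ^ 3 ≠ 0 := pow_ne_zero 3 h0
      rw [div_pow, ← hXY]
      field_simp
      linear_combination (S ^ 3 - X + Y) * hS3
    · rw [vPart, if_neg h0, hQ, show cardanoS σ τ = S from rfl]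
      field_simp
      ring

/-- By Vieta $\sigma-2v=(\sigma+S+T)/3$ is the real Cardano root, the other two being $v\pm iw$. -/
theorem vPart_cubic (hD : 0 ≤ cardanoRadicand σ τ) :
    (σ - 2 * vPart σ τ) ^ 3 - σ * (σ - 2 * vPart σ τ) ^ 2 + (4 * τ - 1) * (σ - 2 * vPart σ τ) + σ
      = 0 := by
  obtain ⟨S, T, h1, h2, h3⟩ := exists_cardano_conj hD
  rw [h3]
  linear_combination (S + T) / 9 * h1 + h2 / 27

theorem wPart_radicand_nonneg (hD : 0 ≤ cardanoRadicand σ τ) :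
    0 ≤ 3 * vPart σ τ ^ 2 - 2 * σ * vPart σ τ + 4 * τ - 1 := by
  obtain ⟨S, T, h1, -, h3⟩ := exists_cardano_conj hD
  have : 3 * vPart σ τ ^ 2 - 2 * σ * vPart σ τ + 4 * τ - 1 = (S - T) ^ 2 / 12 := by
    rw [h3]
    linear_combination h1 / 3
  rw [this]
  positivity

/-- The point `v + i w` of Cardano's formula. -/
def cardanoPoint (σ τ : ℝ) : ℂ := (vPart σ τ : ℂ) + Complex.I * (wPart σ τ : ℂ)

theorem cardanoPoint_re (σ τ : ℝ) : (cardanoPoint σ τ).re = vPart σ τ := by simp [cardanoPoint]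

theorem cardanoPoint_im (σ τ : ℝ) : (cardanoPoint σ τ).im = wPart σ τ := by simp [cardanoPoint]

theorem normSq_cardanoPoint (hD : 0 ≤ cardanoRadicand σ τ) : Complex.normSq (cardanoPoint σ τ)
    = 4 * vPart σ τ ^ 2 - 2 * σ * vPart σ τ + 4 * τ - 1 := by
  rw [Complex.normSq_apply, cardanoPoint_re, cardanoPoint_im, wPart,
    Real.mul_self_sqrt (wPart_radicand_nonneg hD)]
  ring

theorem cardanoPoint_mem_charCurve (hD : 0 ≤ cardanoRadicand σ τ) :
    cardanoPoint σ τ ∈ charCurve 1 τ := by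
  refine ⟨by rw [cardanoPoint_im, wPart]; positivity, ?_⟩
  rw [normSq_sq_sub_sq', normSq_cardanoPoint hD, cardanoPoint_re]
  linear_combination (2 * vPart σ τ) * vPart_cubic hD

theorem charCurve_cardanoPoint_mul (hD : 0 ≤ cardanoRadicand σ τ) :
    2 * vPart σ τ * Complex.normSq (cardanoPoint σ τ)
      = σ * (Complex.normSq (cardanoPoint σ τ) + 1) := by
  rw [normSq_cardanoPoint hD]
  linear_combination -vPart_cubic hD

theorem charMap_cardanoPoint (hD : 0 ≤ cardanoRadicand σ τ) :
    charMap 1 τ (cardanoPoint σ τ) = σ := by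
  rw [charMap_of_mem_charCurve one_ne_zero (cardanoPoint_mem_charCurve hD), cardanoPoint_re,
    charCurve_cardanoPoint_mul hD, one_pow, mul_div_cancel_right₀]
  have := Complex.normSq_nonneg (cardanoPoint σ τ)
  positivity

theorem vPart_nonneg (hσ : 0 ≤ σ) (hD : 0 ≤ cardanoRadicand σ τ) : 0 ≤ vPart σ τ := by
  have h1 := charCurve_cardanoPoint_mul hD
  have h2 := Complex.normSq_nonneg (cardanoPoint σ τ)
  rcases h2.eq_or_lt with h0 | h0
  · have : cardanoPoint σ τ = 0 := Complex.normSq_eq_zero.1 h0.symm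
    rw [← cardanoPoint_re, this, Complex.zero_re]
  · have : 0 ≤ 2 * vPart σ τ * Complex.normSq (cardanoPoint σ τ) := by rw [h1]; positivity
    linarith [nonneg_of_mul_nonneg_left this h0]

/-- Cardano's formula recovers the points of the hitting curve. -/
theorem cardanoPoint_eq (hk : k ∈ charCurve 1 τ) (hσ : charMap 1 τ k = σ) :
    0 ≤ cardanoRadicand σ τ ∧ cardanoPoint σ τ = k := by
  rw [charMap_of_mem_charCurve one_ne_zero hk, Complex.ofReal_inj] at hσ
  have hN := weight_pos one_ne_zero k
  obtain ⟨hk0, hC⟩ := hk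
  rw [normSq_sq_sub_sq'] at hC
  set v := k.re
  set w := k.im
  set N := Complex.normSq k + 1 ^ 2 with hNdef
  have hP : Complex.normSq k = N - 1 := by rw [hNdef]; ring
  have hNvw : N = v ^ 2 + w ^ 2 + 1 := by rw [hNdef, Complex.normSq_apply]; ring
  rw [hP, div_eq_iff hN.ne'] at hσ
  -- the real root of the cubic
  set r := σ - 2 * v with hr
  have hv : 2 * v = -(r * N) := by rw [hr]; linear_combination -hσ
  have hσr : σ = r * (1 - N) := by linear_combination hv + hr
  have hτ : 4 * τ = N * (1 - r ^ 2) := by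
    apply mul_right_cancel₀ hN.ne'
    linear_combination hC - (2 * v - r * N) * hv
  have hw : w ^ 2 = N - 1 - (r * N) ^ 2 / 4 := by
    linear_combination -hNvw - (2 * v - r * N) / 4 * hv
  have hD : 0 ≤ cardanoRadicand σ τ := by
    -- The bracket is $(r-v)^2+w^2$, so this is $-\frac14$ of the discriminant of the cubic with
    -- roots $r$, $v\pm iw$.
    have e : cardanoRadicand σ τ = (r ^ 2 + r * (r * N) + (N - 1)) ^ 2 * w ^ 2 := by
      rw [hw, cardanoRadicand, hσr, show τ = N * (1 - r ^ 2) / 4 by linarith]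
      ring
    rw [e]
    positivity
  refine ⟨hD, ?_⟩
  have hroot := vPart_cubic hD
  have hW := wPart_radicand_nonneg hD
  set v' := vPart σ τ with hv'
  have hfac : (σ - 2 * v' - r) * ((σ - 2 * v' - v) ^ 2 + w ^ 2) = 0 := by
    have h1 : 4 * τ - 1 = N - 1 + 2 * v * r := by linear_combination hτ - r * hv
    rw [h1] at hroot
    have h2 : σ = -(r * (N - 1)) := by linear_combination hσr
    linear_combination hroot - hNvw * (σ - 2 * v' - r) - h2 + (σ - 2 * v') ^ 2 * hr
  have hvv : v' = v := by
    rcases mul_eq_zero.1 hfac with h0 | h0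
    · linarith
    -- Here $w=0$ and Cardano's real root might be the double root `v`. The radicand of `wPart`
    -- would then be $-(r-v)^2/4$, and its sign forces $r=v$.
    · have e1 : (σ - 2 * v' - v) ^ 2 = 0 := by
        nlinarith [sq_nonneg (σ - 2 * v' - v), sq_nonneg w]
      have e2 : w ^ 2 = 0 := by nlinarith [sq_nonneg (σ - 2 * v' - v), sq_nonneg w]
      have e3 : σ - 2 * v' - v = 0 := pow_eq_zero_iff two_ne_zero |>.1 e1
      have e4 : v' = (r + v) / 2 := by linarith
      have e5 : 4 * τ - 1 = v ^ 2 + 2 * v * r := by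
        linear_combination hτ - r * hv + hNvw + e2
      have e6 : σ = r + 2 * v := by linarith
      have e7 : 0 ≤ -((r - v) ^ 2 / 4) := by
        have : 3 * v' ^ 2 - 2 * σ * v' + 4 * τ - 1 = -((r - v) ^ 2 / 4) := by
          rw [e4, e6]
          linear_combination e5
        rwa [this] at hW
      have e8 : (r - v) ^ 2 = 0 := by nlinarith [sq_nonneg (r - v)]
      have e9 : r - v = 0 := pow_eq_zero_iff two_ne_zero |>.1 e8
      linarith
  apply Complex.ext
  · rw [cardanoPoint_re, ← hv', hvv]
  · rw [cardanoPoint_im, wPart, ← hv', hvv]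
    change _ = w
    rw [← Real.sqrt_sq hk0]
    congr 1
    linear_combination hτ - r * hv + hNvw + 2 * v * hr

/-- The radicand is quadratic in $\sigma^2$. The smaller root stays expanded because past
$\tau=\frac14$ it is no longer `bMinus τ ^ 2`: the number under that square root becomes negative.
-/
theorem cardanoRadicand_eq (hτ : 0 ≤ τ) : cardanoRadicand σ τ
    = (bPlus τ ^ 2 - σ ^ 2)
      * (σ ^ 2 - ((1 + 2 * τ) - 2 * √(τ * (τ + 2))) * ((1 - τ) - √(τ * (τ + 2))) ^ 2) := by
  have hq : √(τ * (τ + 2)) ^ 2 = τ * (τ + 2) := Real.sq_sqrt (by positivity)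
  rw [bPlus, mul_pow, Real.sq_sqrt (by positivity), cardanoRadicand]
  set q := √(τ * (τ + 2))
  have h4 : q ^ 4 = (τ * (τ + 2)) ^ 2 := by rw [← hq]; ring
  have h6 : q ^ 6 = (τ * (τ + 2)) ^ 3 := by rw [← hq]; ring
  ring_nf
  ring_nf at hq h4 h6
  rw [h6, h4, hq]
  ring

theorem bPlus_nonneg (hτ : 0 ≤ τ) : 0 ≤ bPlus τ := by
  have h : τ ≤ √(τ * (τ + 2)) := Real.le_sqrt_of_sq_le (by nlinarith)
  exact mul_nonneg (Real.sqrt_nonneg _) (by linarith)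

theorem bMinus_nonneg (hτ' : τ < 1 / 4) : 0 ≤ bMinus τ := by
  have h : √(τ * (τ + 2)) ≤ 1 - τ := Real.sqrt_le_iff.2 ⟨by linarith, by nlinarith⟩
  exact mul_nonneg (Real.sqrt_nonneg _) (by linarith)

theorem bMinus_le_bPlus (hτ' : τ < 1 / 4) : bMinus τ ≤ bPlus τ := by
  have h : √(τ * (τ + 2)) ≤ 1 - τ := Real.sqrt_le_iff.2 ⟨by linarith, by nlinarith⟩
  have h0 := Real.sqrt_nonneg (τ * (τ + 2))
  rw [bMinus, bPlus]
  gcongr <;> linarith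

theorem bMinus_sq (hτ : 0 ≤ τ) (hτ' : τ < 1 / 4) : bMinus τ ^ 2
    = ((1 + 2 * τ) - 2 * √(τ * (τ + 2))) * ((1 - τ) - √(τ * (τ + 2))) ^ 2 := by
  have h : √(τ * (τ + 2)) ≤ (1 + 2 * τ) / 2 := Real.sqrt_le_iff.2 ⟨by linarith, by nlinarith⟩
  rw [bMinus, mul_pow, Real.sq_sqrt (by linarith)]

theorem cardanoRadicand_nonneg_iff_of_lt (hτ : 0 ≤ τ) (hτ' : τ < 1 / 4) :
    0 ≤ cardanoRadicand σ τ ↔ bMinus τ ≤ |σ| ∧ |σ| ≤ bPlus τ := by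
  have h0 := bMinus_nonneg hτ'
  have h1 := bMinus_le_bPlus hτ'
  rw [cardanoRadicand_eq hτ, ← bMinus_sq hτ hτ', ← sq_abs σ]
  have h2 := abs_nonneg σ
  constructor
  · intro h
    by_contra hcon
    rcases not_and_or.1 hcon with h3 | h3
    · have h4 : |σ| ^ 2 < bMinus τ ^ 2 := by nlinarith [not_le.1 h3]
      have h5 : bMinus τ ^ 2 ≤ bPlus τ ^ 2 := by gcongr
      nlinarith [mul_pos (sub_pos.2 (h4.trans_le h5)) (sub_pos.2 h4)]
    · have h4 : bPlus τ ^ 2 < |σ| ^ 2 := by nlinarith [not_le.1 h3]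
      have h5 : bMinus τ ^ 2 ≤ bPlus τ ^ 2 := by gcongr
      nlinarith [mul_pos (sub_pos.2 (h5.trans_lt h4)) (sub_pos.2 h4)]
  · rintro ⟨h3, h4⟩
    exact mul_nonneg (sub_nonneg.2 (by gcongr)) (sub_nonneg.2 (by gcongr))

theorem cardanoRadicand_nonneg_iff_of_le (hτ : 1 / 4 ≤ τ) :
    0 ≤ cardanoRadicand σ τ ↔ |σ| ≤ bPlus τ := by
  have hτ0 : 0 ≤ τ := by linarith
  have h : (1 + 2 * τ) / 2 ≤ √(τ * (τ + 2)) := Real.le_sqrt_of_sq_le (by nlinarith)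
  have hβ : ((1 + 2 * τ) - 2 * √(τ * (τ + 2))) * ((1 - τ) - √(τ * (τ + 2))) ^ 2 ≤ 0 :=
    mul_nonpos_of_nonpos_of_nonneg (by linarith) (sq_nonneg _)
  have h0 := bPlus_nonneg hτ0
  rw [cardanoRadicand_eq hτ0, ← sq_abs σ]
  have h2 := abs_nonneg σ
  constructor
  · intro h
    by_contra! h3
    have h4 : bPlus τ ^ 2 < |σ| ^ 2 := by gcongr
    have h5 : 0 < |σ| ^ 2 := lt_of_le_of_lt (sq_nonneg _) h4
    have := mul_pos (sub_pos.2 h4) (sub_pos.2 (hβ.trans_lt h5))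
    linarith
  · intro h3
    exact mul_nonneg (sub_nonneg.2 (by gcongr)) (by linarith [sq_nonneg |σ|])

theorem exists_sigmaPlus_eq_iff (hτ : 0 ≤ τ) :
    (∃ ξ ∈ Set.Icc (0 : ℝ) 1, σ = sigmaPlus τ ξ) ↔ 0 ≤ σ ∧ 0 ≤ cardanoRadicand σ τ := by
  have key : ∀ b c : ℝ, b ≤ c →
      ((∃ ξ ∈ Set.Icc (0 : ℝ) 1, σ = (1 - ξ) * b + ξ * c) ↔ b ≤ σ ∧ σ ≤ c) := by
    intro b c hbc
    rw [← Set.mem_Icc, ← segment_eq_Icc hbc, segment_eq_image]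
    simp only [Set.mem_image, smul_eq_mul, eq_comm]
  rcases lt_or_ge τ (1 / 4) with h | h
  · simp only [sigmaPlus, if_pos h, cardanoRadicand_nonneg_iff_of_lt hτ h]
    rw [key _ _ (bMinus_le_bPlus h)]
    constructor
    · rintro ⟨h1, h2⟩
      have h3 := (bMinus_nonneg h).trans h1
      rw [abs_of_nonneg h3]
      exact ⟨h3, h1, h2⟩
    · rintro ⟨h1, h2⟩
      rwa [abs_of_nonneg h1] at h2
  · simp only [sigmaPlus, if_neg (not_lt.2 h), cardanoRadicand_nonneg_iff_of_le h]
    have := key 0 _ (bPlus_nonneg hτ)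
    simp only [mul_zero, zero_add] at this
    rw [this]
    constructor
    · rintro ⟨h1, h2⟩
      rw [abs_of_nonneg h1]
      exact ⟨h1, h2⟩
    · rintro ⟨h1, h2⟩
      rw [abs_of_nonneg h1] at h2
      exact ⟨h1, h2⟩

end Cardano

/-! ### Reduction to $a=1$ by the scaling $(h,s)\mapsto(ah,a^2s)$ -/

section Scaling

variable {a s t : ℝ} {k : ℂ}

theorem mul_mem_charCurve_iff (ha : 0 < a) :
    (a : ℂ) * k ∈ charCurve a s ↔ k ∈ charCurve 1 (s / a ^ 2) := by
  have h1 : ((a : ℂ) * k).im = a * k.im := by simp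
  have h2 : Complex.normSq (a * k) = a ^ 2 * Complex.normSq k := by
    rw [map_mul, Complex.normSq_ofReal]; ring
  have h3 : Complex.normSq ((a * k) ^ 2 - (a : ℂ) ^ 2)
      = a ^ 4 * Complex.normSq (k ^ 2 - ((1 : ℝ) : ℂ) ^ 2) := by
    rw [show (a * k) ^ 2 - (a : ℂ) ^ 2 = (a : ℂ) ^ 2 * (k ^ 2 - ((1 : ℝ) : ℂ) ^ 2) by
      push_cast; ring, map_mul, map_pow, Complex.normSq_ofReal]
    ring
  have ha4 : (a ^ 4 : ℝ) ≠ 0 := by positivity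
  simp only [charCurve, Set.mem_ofPred_eq, h1, h2, h3, mul_nonneg_iff_of_pos_left ha]
  refine and_congr_right fun _ => ?_
  rw [← mul_right_inj' ha4 (b := 4 * (s / a ^ 2) * _)]
  field_simp

theorem initialGreen_mul_left (ha : 0 < a) :
    initialGreen a (a * k) = initialGreen 1 k / a := by
  have ha0 : (a : ℂ) ≠ 0 := by exact_mod_cast ha.ne'
  rw [initialGreen, initialGreen, show (a * k) ^ 2 - (a : ℂ) ^ 2
    = (a : ℂ) ^ 2 * (k ^ 2 - ((1 : ℝ) : ℂ) ^ 2) by push_cast; ring]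
  rw [show 2 * ((a : ℂ) * k) = a * (2 * k) by ring, pow_two (a : ℂ), mul_assoc,
    mul_div_mul_left _ _ ha0, div_div, mul_comm (a : ℂ)]

theorem charMap_mul_left (ha : 0 < a) :
    charMap a s (a * k) = a * charMap 1 (s / a ^ 2) k := by
  have ha0 : (a : ℂ) ≠ 0 := by exact_mod_cast ha.ne'
  rw [charMap, charMap, initialGreen_mul_left ha]
  push_cast
  field_simp

theorem firstIntegral_mul_left (ha : 0 < a) :
    firstIntegral a s (a * k) = a ^ 2 * firstIntegral 1 (s / a ^ 2) k := by
  have ha0 : (a : ℂ) ≠ 0 := by exact_mod_cast ha.ne'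
  rw [firstIntegral, firstIntegral, initialGreen_mul_left ha, show (a * k) ^ 2 - (a : ℂ) ^ 2
      = (a : ℂ) ^ 2 * (k ^ 2 - ((1 : ℝ) : ℂ) ^ 2) by push_cast; ring, mul_assoc]
  push_cast
  congr 3
  field_simp

theorem vMap_eq_hitPoint (hk : k ∈ charCurve 1 t) : vMap t k = hitPoint 1 k := by
  rw [vMap, hitPoint, ← firstIntegral_eq_hitIntegral one_ne_zero hk, firstIntegral, initialGreen]
  congr 2
  · simp
  · push_cast
    congr 2
    · ring
    · rw [div_pow]
      ring

theorem hitPoint_mul_left (ha : 0 < a) (hk : k ∈ charCurve 1 (s / a ^ 2)) (hre : 0 ≤ k.re) :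
    hitPoint a (a * k) = a * hitPoint 1 k := by
  symm
  have h1 := hitPoint_re_nonneg one_ne_zero hre hk.1
  have h2 := hitPoint_im_nonneg 1 k
  refine eq_hitPoint ha.ne' ((mul_mem_charCurve_iff ha).2 hk) ?_ ?_ ?_ ?_
  · rw [Complex.re_ofReal_mul]; positivity
  · rw [Complex.im_ofReal_mul]; positivity
  · rw [Complex.re_ofReal_mul]; positivity
  · rw [firstIntegral_mul_left ha, firstIntegral_eq_hitIntegral one_ne_zero hk, ← hitPoint_sq]
    push_cast
    ring

theorem gammaPlus_eq {ξ : ℝ} : gammaPlus a s ξ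
    = a * vMap (s / a ^ 2) (cardanoPoint (sigmaPlus (s / a ^ 2) ξ) (s / a ^ 2)) := rfl

/-- At each time, Cardano's formula parametrizes the right half of the hitting curve by its image,
the non-negative part of the support; on the curve `vMap` agrees with the time-free `hitPoint`. -/
theorem hullPlus_eq (ha : 0 < a) (t : ℝ) : hullPlus a t = hitPoint a '' hitRegion a t := by
  have ha0 : (a : ℂ) ≠ 0 := by exact_mod_cast ha.ne'
  ext z
  constructor
  · rintro ⟨s, hs, ξ, hξ, rfl⟩
    have hτ : 0 ≤ s / a ^ 2 := div_nonneg hs.1 (sq_nonneg a)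
    obtain ⟨hσ, hD⟩ := (exists_sigmaPlus_eq_iff hτ).1 ⟨ξ, hξ, rfl⟩
    have hk := cardanoPoint_mem_charCurve hD
    have hre := vPart_nonneg hσ hD
    rw [← cardanoPoint_re] at hre
    refine ⟨_, (mem_hitRegion_iff ha.ne').2 ⟨s, hs, (mul_mem_charCurve_iff ha).2 hk, ?_⟩, ?_⟩
    · rw [Complex.re_ofReal_mul]; positivity
    · rw [gammaPlus_eq, vMap_eq_hitPoint hk, hitPoint_mul_left ha hk hre]
  · rintro ⟨h, hh, rfl⟩
    obtain ⟨s, hs, hC, hre⟩ := (mem_hitRegion_iff ha.ne').1 hh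
    have hτ : 0 ≤ s / a ^ 2 := div_nonneg hs.1 (sq_nonneg a)
    obtain ⟨k, rfl⟩ : ∃ k : ℂ, h = a * k := ⟨h / a, by field_simp⟩
    have hk := (mul_mem_charCurve_iff ha).1 hC
    have hkre : 0 ≤ k.re := by
      rw [Complex.re_ofReal_mul] at hre
      exact nonneg_of_mul_nonneg_right hre ha
    have hmap := charMap_of_mem_charCurve one_ne_zero hk
    obtain ⟨hD, hkc⟩ := cardanoPoint_eq hk hmap
    have hσ : 0 ≤ 2 * k.re * Complex.normSq k / (Complex.normSq k + 1 ^ 2) := by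
      have := Complex.normSq_nonneg k
      positivity
    obtain ⟨ξ, hξ, hξσ⟩ := (exists_sigmaPlus_eq_iff hτ).2 ⟨hσ, hD⟩
    refine ⟨s, hs, ξ, hξ, ?_⟩
    rw [gammaPlus_eq, ← hξσ, hkc, vMap_eq_hitPoint hk, hitPoint_mul_left ha hk hkre]

theorem mem_twoSourceSupport_iff (ha : 0 < a) (ht : 0 ≤ t) (x : ℝ) :
    x ∈ twoSourceSupport a t ↔ 0 ≤ cardanoRadicand (x / a) (t / a ^ 2) := by
  have hτ : 0 ≤ t / a ^ 2 := by positivity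
  have hcrit : t < criticalTime a ↔ t / a ^ 2 < 1 / 4 := by
    rw [criticalTime, div_lt_iff₀ (by positivity), one_div_mul_eq_div]
  have habs : |x / a| = |x| / a := by rw [abs_div, abs_of_pos ha]
  rw [twoSourceSupport]
  split_ifs with h
  · rw [cardanoRadicand_nonneg_iff_of_lt hτ (hcrit.1 h), habs, le_div_iff₀' ha, div_le_iff₀' ha]
    rfl
  · rw [cardanoRadicand_nonneg_iff_of_le (not_lt.1 (hcrit.not.1 h)), habs, div_le_iff₀' ha]
    rfl

theorem exists_charCurve_iff (ha : 0 < a) (x : ℝ) :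
    (∃ h ∈ charCurve a t, charMap a t h = x) ↔ 0 ≤ cardanoRadicand (x / a) (t / a ^ 2) := by
  have ha0 : (a : ℂ) ≠ 0 := by exact_mod_cast ha.ne'
  constructor
  · rintro ⟨h, hh, hx⟩
    obtain ⟨k, rfl⟩ : ∃ k : ℂ, h = a * k := ⟨h / a, by field_simp⟩
    refine (cardanoPoint_eq ((mul_mem_charCurve_iff ha).1 hh) ?_).1
    rw [charMap_mul_left ha] at hx
    push_cast
    rw [← hx]
    field_simp
  · intro hD
    refine ⟨a * cardanoPoint (x / a) (t / a ^ 2),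
      (mul_mem_charCurve_iff ha).2 (cardanoPoint_mem_charCurve hD), ?_⟩
    rw [charMap_mul_left ha, charMap_cardanoPoint hD]
    push_cast
    field_simp

end Scaling

end MultipleSLE

end

/-! ### The proposition -/

theorem proposition4p2 (a : ℝ) (ha : 0 < a) (μ : ℝ → ProbabilityMeasure ℝ)
    (hμ : MultipleSLE.IsHydrodynamicLimit (MultipleSLE.twoSources a) μ) (t : ℝ) (ht : 0 ≤ t) :
    (μ t : Measure ℝ).support = MultipleSLE.twoSourceSupport a t ∧
    (⋃ s ∈ Set.Icc 0 t, MultipleSLE.hullCurve μ s)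
      = MultipleSLE.hullPlus a t ∪ MultipleSLE.hullMinus a t ∧
    (0 < t → MultipleSLE.hull μ t = MultipleSLE.hullPlus a t ∪ MultipleSLE.hullMinus a t) := by
  have hK : MultipleSLE.hullPlus a t ∪ MultipleSLE.hullMinus a t
      = MultipleSLE.symmetrize (MultipleSLE.hitPoint a '' MultipleSLE.hitRegion a t) := by
    rw [MultipleSLE.hullMinus, MultipleSLE.hullPlus_eq ha]
    rfl
  refine ⟨?_, ?_, fun ht' => ?_⟩
  · ext x
    rw [hμ.mem_support_iff ha.ne' ht, MultipleSLE.exists_charCurve_iff ha,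
      MultipleSLE.mem_twoSourceSupport_iff ha ht]
  · rw [hμ.iUnion_hullCurve ha.ne', hK]
  · rw [hμ.hull_eq ha ht', hK]
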